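/- For $a,q\in\mathbb{C}$ with $|q|<1$ and $n\ge 0$ put $(a;q)_n=\prod_{j=0}^{n-1}(1-aq^j)$, $(a;q)_\infty=\prod_{j\ge 0}(1-aq^j)$ and $(a,b,c;q)_\infty=(a;q)_\infty(b;q)_\infty(c;q)_\infty$. For $|q|<1$ define the sixth order mock theta functions $$\phi(q)=\sum_{n\ge0}\frac{(-1)^nq^{n^2}(q;q^2)_n}{(-q;q)_{2n}},\qquad \psi(q)=\sum_{n\ge0}\frac{(-1)^nq^{(n+1)^2}(q;q^2)_n}{(-q;q)_{2n+1}},$$ $$\rho(q)=\sum_{n\ge0}\frac{q^{n(n+1)/2}(-q;q)_n}{(q;q^2)_{n+1}},\qquad \sigma(q)=\sum_{n\ge0}\frac{q^{(n+1)(n+2)/2}(-q;q)_n}{(q;q^2)_{n+1}},$$ $$\lambda(q)=\sum_{n\ge0}\frac{(-q)^n(q;q^2)_n}{(-q;q)_n},\qquad \mu(q)=\sum_{n\ge0}\frac{(-1)^n(q;q^2)_n}{(-q;q)_n}.$$ For every complex $q$ with $|q|<1$ the first five series converge absolutely, and the series for $\mu$ converges in the Cesàro sense: its even partial sums and its odd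 partial sums each converge, and $\mu(q)$ denotes the average of the two limits. Moreover, for every complex $q$ with $|q|<1$ (and $q\ne0$ in the first and the last identity), $$q^{-1}\psi(q^2)+\rho(q)=(-q;q^2)_\infty^2\,(-q,-q^5,q^6;q^6)_\infty,$$ $$\phi(q^2)+2\sigma(q)=(-q;q^2)_\infty^2\,(-q^3,-q^3,q^6;q^6)_\infty,$$ $$2\phi(q^2)-2\mu(-q)=(-q;q^2)_\infty^2\,(-q^3,-q^3,q^6;q^6)_\infty,$$ $$2q^{-1}\psi(q^2)+\lambda(-q)=(-q;q^2)_\infty^2\,(-q,-q^5,q^6;q^6)_\infty.$$ -/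

import Mathlib

namespace SixthOrder

open Filter Topology

noncomputable section

/-- The finite `q`-Pochhammer symbol `(a;q)_n = ∏_{0 ≤ j < n} (1 - a q^j)`. -/
def qPoch (a q : ℂ) (n : ℕ) : ℂ := ∏ j ∈ Finset.range n, (1 - a * q ^ j)

/-- The infinite `q`-Pochhammer symbol `(a;q)_∞ = ∏_{j ≥ 0} (1 - a q^j)`. -/
def qPochInf (a q : ℂ) : ℂ := ∏' j : ℕ, (1 - a * q ^ j)

/-- `(a,b,c;q)_∞ = (a;q)_∞ (b;q)_∞ (c;q)_∞`. -/
def qPochInf₃ (a b c q : ℂ) : ℂ := qPochInf a q * qPochInf b q * qPochInf c q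

/-- The infinite products above converge for `|q| < 1`. -/
theorem multipliable_qPochInf (a : ℂ) {q : ℂ} (hq : ‖q‖ < 1) :
    Multipliable (fun j : ℕ => 1 - a * q ^ j) := by
  have h : Summable (fun j : ℕ => ‖-(a * q ^ j)‖) := by
    simp only [norm_neg, norm_mul, norm_pow]
    exact (summable_geometric_of_lt_one (norm_nonneg q) hq).mul_left _
  simpa [sub_eq_add_neg] using multipliable_one_add_of_summable h

/-- The denominators in the series below, which are of the form `(±q;q)_n` or `(q;q^2)_n`,
do not vanish for `|q| < 1`. -/
theorem qPoch_ne_zero {a q : ℂ} (ha : ‖a‖ < 1) (hq : ‖q‖ < 1) (n : ℕ) : qPoch a q n ≠ 0 := by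
  refine Finset.prod_ne_zero_iff.2 fun j _ h => ?_
  have h1 : ‖a * q ^ j‖ < 1 := by
    rw [norm_mul, norm_pow]
    exact lt_of_le_of_lt
      (mul_le_of_le_one_right (norm_nonneg a) (pow_le_one₀ (norm_nonneg q) hq.le)) ha
  rw [← sub_eq_zero.1 h, norm_one] at h1
  exact lt_irrefl _ h1

/-- General term of `φ`. -/
def phiTerm (q : ℂ) (n : ℕ) : ℂ :=
  (-1) ^ n * q ^ (n ^ 2) * qPoch q (q ^ 2) n / qPoch (-q) q (2 * n)

/-- General term of `ψ`. -/
def psiTerm (q : ℂ) (n : ℕ) : ℂ :=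
  (-1) ^ n * q ^ ((n + 1) ^ 2) * qPoch q (q ^ 2) n / qPoch (-q) q (2 * n + 1)

/-- General term of `ρ`; the division in the exponent is exact. -/
def rhoTerm (q : ℂ) (n : ℕ) : ℂ :=
  q ^ (n * (n + 1) / 2) * qPoch (-q) q n / qPoch q (q ^ 2) (n + 1)

/-- General term of `σ`; the division in the exponent is exact. -/
def sigmaTerm (q : ℂ) (n : ℕ) : ℂ :=
  q ^ ((n + 1) * (n + 2) / 2) * qPoch (-q) q n / qPoch q (q ^ 2) (n + 1)

/-- General term of `λ`. -/
def lambdaTerm (q : ℂ) (n : ℕ) : ℂ :=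
  (-q) ^ n * qPoch q (q ^ 2) n / qPoch (-q) q n

/-- General term of `μ`. -/
def muTerm (q : ℂ) (n : ℕ) : ℂ :=
  (-1) ^ n * qPoch q (q ^ 2) n / qPoch (-q) q n

/-- The sixth order mock theta function `φ`. -/
def phi (q : ℂ) : ℂ := ∑' n, phiTerm q n

/-- The sixth order mock theta function `ψ`. -/
def psi (q : ℂ) : ℂ := ∑' n, psiTerm q n

/-- The sixth order mock theta function `ρ`. -/
def rho (q : ℂ) : ℂ := ∑' n, rhoTerm q n

/-- The sixth order mock theta function `σ`. -/
def sigma (q : ℂ) : ℂ := ∑' n, sigmaTerm q n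

/-- The sixth order mock theta function `λ`. -/
def lambda (q : ℂ) : ℂ := ∑' n, lambdaTerm q n

/-- `∑ f n = s` in the Cesàro sense used for `μ`: the partial sums with an even and with an odd
number of terms converge separately, and `s` is the average of the two limits. -/
def HasCesaroSum (f : ℕ → ℂ) (s : ℂ) : Prop :=
  ∃ e o : ℂ,
    Tendsto (fun N : ℕ => ∑ n ∈ Finset.range (2 * N), f n) atTop (𝓝 e) ∧
    Tendsto (fun N : ℕ => ∑ n ∈ Finset.range (2 * N + 1), f n) atTop (𝓝 o) ∧
    s = (e + o) / 2

/-- The sixth order mock theta function `μ`: the average of the limits of the even and the odd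
partial sums. -/
def mu (q : ℂ) : ℂ :=
  (limUnder atTop (fun N : ℕ => ∑ n ∈ Finset.range (2 * N), muTerm q n) +
    limUnder atTop (fun N : ℕ => ∑ n ∈ Finset.range (2 * N + 1), muTerm q n)) / 2

end

end SixthOrder

/-! Bailey's lemma brings all six functions to Hecke-type series, and the four identities are then
read off from a single convolution identity for theta series.

Bailey side. The sequences β such as 1/(q;q²)_{n+1} or 1/(-q;q)_n satisfy a first order recurrence,
hence so do their inverse Bailey transforms, which are thereby found in closed form in terms of the
finite theta sums `triSum` and `sqSum`. The limiting Bailey lemma `bailey_limit`, which rests on the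
q-Gauss sum, turns each mock theta function into a quotient of infinite products times a series of
powers of q against these finite sums (`rho_hecke`, `psi_hecke`, ...). For μ the argument of the
q-Gauss sum is -1, on the boundary of convergence, and averages of consecutive partial sums replace
the sums (`bailey_limit_average`, `mu_cesaro`).

Theta side. Let P be the partial theta function `partThetaInt`; it satisfies P(m) = 1 - q^(2m+2)
P(m+1) and P(-1-m) = 1 - P(m). For ε = ±1 let θ be the sequence ε^l (-q)^(l(l-1)/2). The functional
equation of P gives a first order recurrence for the convolution θ * P. For ε = 1 its solution is a
multiple of `sqSum (-q)`; for ε = -1 it is a multiple of q^(m²), the constant coming from Jacobi's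
formula for the cube of the Euler product.

Now θ * θ * P is computed in two ways at m = -1 and m = 0 (`tsum_thetaTerm_mul_thetaConv`).
Multiplying the two theta sequences first, and splitting by the parity of the index sum, produces
ψ(q²) and ρ(q) for m = -1, and φ(q²) and σ(q) for m = 0, with ε only as a relative sign. Convolving
with P first produces λ(-q) and μ(-q) when ε = 1, and theta series in base (-q)³ when ε = -1. So ε =
-1 yields the first two identities, while ε = 1 yields q λ(-q) = q ρ(q) - ψ(q²) and 2 μ(-q) = φ(q²)
- 2 σ(q), from which the last two follow. -/

namespace SixthOrder

open Filter Topology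
open Finset.HasAntidiagonal (antidiagonal mem_antidiagonal)

/-! ### Finite and infinite `q`-Pochhammer symbols -/

@[simp] theorem qPoch_zero (a q : ℂ) : qPoch a q 0 = 1 := by simp [qPoch]

theorem qPoch_succ (a q : ℂ) (n : ℕ) : qPoch a q (n + 1) = qPoch a q n * (1 - a * q ^ n) := by
  simp [qPoch, Finset.prod_range_succ]

theorem qPoch_add (a q : ℂ) (m n : ℕ) :
    qPoch a q (m + n) = qPoch a q m * qPoch (a * q ^ m) q n := by
  simp only [qPoch, Finset.prod_range_add]
  congr 1
  refine Finset.prod_congr rfl fun i _ => ?_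
  ring

theorem qPoch_succ' (a q : ℂ) (n : ℕ) : qPoch a q (n + 1) = (1 - a) * qPoch (a * q) q n := by
  rw [add_comm, qPoch_add]
  simp [qPoch]

/-- The Euler symbol `(q;q)_n`, written with explicit last factor. -/
theorem qPoch_self_succ (q : ℂ) (n : ℕ) : qPoch q q (n + 1) = qPoch q q n * (1 - q ^ (n + 1)) := by
  rw [qPoch_succ, pow_succ' q n]

theorem one_sub_ne_zero_of_norm_lt_one {x : ℂ} (hx : ‖x‖ < 1) : 1 - x ≠ 0 := by
  intro h
  rw [← sub_eq_zero.1 h, norm_one] at hx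
  exact lt_irrefl _ hx

theorem norm_pow_succ_lt_one {q : ℂ} (hq : ‖q‖ < 1) (n : ℕ) : ‖q ^ (n + 1)‖ < 1 := by
  rw [norm_pow]
  exact pow_lt_one₀ (norm_nonneg q) hq n.succ_ne_zero

theorem one_sub_pow_succ_ne_zero {q : ℂ} (hq : ‖q‖ < 1) (n : ℕ) : 1 - q ^ (n + 1) ≠ 0 :=
  one_sub_ne_zero_of_norm_lt_one (norm_pow_succ_lt_one hq n)

theorem one_add_pow_succ_ne_zero {q : ℂ} (hq : ‖q‖ < 1) (n : ℕ) : 1 + q ^ (n + 1) ≠ 0 := by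
  have := one_sub_ne_zero_of_norm_lt_one (x := -q ^ (n + 1))
    (by rw [norm_neg]; exact norm_pow_succ_lt_one hq n)
  rwa [sub_neg_eq_add] at this

theorem qPoch_self_ne_zero {q : ℂ} (hq : ‖q‖ < 1) (n : ℕ) : qPoch q q n ≠ 0 :=
  qPoch_ne_zero hq hq n

theorem tendsto_qPoch (a : ℂ) {q : ℂ} (hq : ‖q‖ < 1) :
    Tendsto (qPoch a q) atTop (𝓝 (qPochInf a q)) :=
  (multipliable_qPochInf a hq).tendsto_prod_tprod_nat

theorem qPochInf_ne_zero {a q : ℂ} (ha : ‖a‖ < 1) (hq : ‖q‖ < 1) : qPochInf a q ≠ 0 := by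
  have h := tprod_one_add_ne_zero_of_summable (f := fun j : ℕ => -(a * q ^ j)) (fun j => ?_) ?_
  · simpa [qPochInf, sub_eq_add_neg] using h
  · rw [← sub_eq_add_neg]
    refine one_sub_ne_zero_of_norm_lt_one ?_
    rw [norm_mul, norm_pow]
    exact lt_of_le_of_lt
      (mul_le_of_le_one_right (norm_nonneg a) (pow_le_one₀ (norm_nonneg q) hq.le)) ha
  · simp only [norm_neg, norm_mul, norm_pow]
    exact (summable_geometric_of_lt_one (norm_nonneg q) hq).mul_left _

theorem qPochInf_eq_qPoch_mul (a : ℂ) {q : ℂ} (hq : ‖q‖ < 1) (n : ℕ) :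
    qPochInf a q = qPoch a q n * qPochInf (a * q ^ n) q := by
  refine tendsto_nhds_unique ((tendsto_add_atTop_iff_nat n).2 (tendsto_qPoch a hq)) ?_
  have h := (tendsto_qPoch (a * q ^ n) hq).const_mul (qPoch a q n)
  refine h.congr fun m => ?_
  rw [add_comm, qPoch_add]

theorem qPochInf_succ (a : ℂ) {q : ℂ} (hq : ‖q‖ < 1) :
    qPochInf a q = (1 - a) * qPochInf (a * q) q := by
  simpa [qPoch] using qPochInf_eq_qPoch_mul a hq 1

theorem qPochInf_mul_neg (a : ℂ) {q : ℂ} (hq : ‖q‖ < 1) :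
    qPochInf a q * qPochInf (-a) q = qPochInf (a ^ 2) (q ^ 2) := by
  rw [qPochInf, qPochInf,
    ← (multipliable_qPochInf a hq).tprod_mul (multipliable_qPochInf (-a) hq), qPochInf]
  refine tprod_congr fun j => ?_
  ring

/-- Splitting an infinite product according to the residue of the index modulo `k`. -/
theorem qPochInf_eq_prod (a : ℂ) {q : ℂ} (hq : ‖q‖ < 1) {k : ℕ} (hk : 0 < k) :
    qPochInf a q = ∏ i ∈ Finset.range k, qPochInf (a * q ^ i) (q ^ k) := by
  have hqk : ‖q ^ k‖ < 1 := by
    rw [norm_pow]; exact pow_lt_one₀ (norm_nonneg q) hq hk.ne'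
  have h1 : Tendsto (fun n => qPoch a q (k * n)) atTop (𝓝 (qPochInf a q)) :=
    (tendsto_qPoch a hq).comp (tendsto_id.const_mul_atTop' hk)
  refine tendsto_nhds_unique h1 ?_
  have h2 : Tendsto (fun n => ∏ i ∈ Finset.range k, qPoch (a * q ^ i) (q ^ k) n) atTop
      (𝓝 (∏ i ∈ Finset.range k, qPochInf (a * q ^ i) (q ^ k))) :=
    tendsto_finsetProd _ fun i _ => tendsto_qPoch _ hqk
  refine h2.congr fun n => ?_
  simp only [qPoch]
  rw [Finset.prod_comm]
  induction n with
  | zero => simp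
  | succ n ih =>
    rw [Finset.prod_range_succ, ih, Nat.mul_succ, Finset.prod_range_add]
    congr 1
    refine Finset.prod_congr rfl fun i _ => ?_
    rw [← pow_mul]
    ring

theorem norm_one_sub_mul_le_exp (a q : ℂ) (C : ℝ) (h : ‖a‖ ≤ C) (j : ℕ) :
    ‖1 - a * q ^ j‖ ≤ Real.exp (C * ‖q‖ ^ j) := by
  calc ‖1 - a * q ^ j‖ ≤ ‖(1 : ℂ)‖ + ‖a * q ^ j‖ := norm_sub_le _ _
    _ = ‖a‖ * ‖q‖ ^ j + 1 := by rw [norm_one, norm_mul, norm_pow, add_comm]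
    _ ≤ C * ‖q‖ ^ j + 1 := by gcongr
    _ ≤ _ := Real.add_one_le_exp _

theorem geom_sum_le_inv {r : ℝ} (h0 : 0 ≤ r) (h1 : r < 1) (n : ℕ) :
    ∑ i ∈ Finset.range n, r ^ i ≤ (1 - r)⁻¹ := by
  rw [← tsum_geometric_of_lt_one h0 h1]
  exact (summable_geometric_of_lt_one h0 h1).sum_le_tsum _ fun i _ => pow_nonneg h0 i

/-- A bound for finite `q`-Pochhammer symbols, uniform in the number of factors. -/
theorem norm_qPoch_le {a q : ℂ} {C : ℝ} (ha : ‖a‖ ≤ C) (hq : ‖q‖ < 1) (n : ℕ) :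
    ‖qPoch a q n‖ ≤ Real.exp (C * (1 - ‖q‖)⁻¹) := by
  have hC : 0 ≤ C := (norm_nonneg a).trans ha
  rw [qPoch, norm_prod]
  calc ∏ j ∈ Finset.range n, ‖1 - a * q ^ j‖
      ≤ ∏ j ∈ Finset.range n, Real.exp (C * ‖q‖ ^ j) :=
        Finset.prod_le_prod (fun _ _ => norm_nonneg _)
          fun j _ => norm_one_sub_mul_le_exp a q C ha j
    _ = Real.exp (C * ∑ j ∈ Finset.range n, ‖q‖ ^ j) := by
        rw [← Real.exp_sum, Finset.mul_sum]
    _ ≤ _ := by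
        gcongr
        exact geom_sum_le_inv (norm_nonneg q) hq n

/-- A bound for reciprocals of finite `q`-Pochhammer symbols, uniform in the number of factors
and in the parameter. -/
theorem norm_qPoch_inv_le {a q : ℂ} {r : ℝ} (ha : ‖a‖ ≤ r) (hr : r < 1) (hq : ‖q‖ < 1) (n : ℕ) :
    ‖(qPoch a q n)⁻¹‖ ≤ Real.exp ((1 - r)⁻¹ * (1 - ‖q‖)⁻¹) := by
  have hr0 : 0 ≤ r := (norm_nonneg a).trans ha
  have h1r : 0 < 1 - r := by linarith
  rw [qPoch, ← Finset.prod_inv_distrib, norm_prod]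
  calc ∏ j ∈ Finset.range n, ‖(1 - a * q ^ j)⁻¹‖
      ≤ ∏ j ∈ Finset.range n, Real.exp ((1 - r)⁻¹ * ‖q‖ ^ j) := by
        refine Finset.prod_le_prod (fun _ _ => norm_nonneg _) fun j _ => ?_
        set x := ‖q‖ ^ j with hx
        have hx0 : 0 ≤ x := by positivity
        have hx1 : x ≤ 1 := pow_le_one₀ (norm_nonneg q) hq.le
        have hlow : 1 - r * x ≤ ‖1 - a * q ^ j‖ := by
          have h := norm_sub_norm_le (1 : ℂ) (a * q ^ j)
          rw [norm_one, norm_mul, norm_pow] at h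
          have : ‖a‖ * x ≤ r * x := by gcongr
          linarith
        have hpos : 0 < 1 - r * x := by nlinarith
        rw [norm_inv]
        calc ‖1 - a * q ^ j‖⁻¹ ≤ (1 - r * x)⁻¹ := by gcongr
          _ ≤ (1 - r)⁻¹ * x + 1 := by
              rw [inv_le_iff_one_le_mul₀ hpos]
              have h3 : (1 - r)⁻¹ * (1 - r) = 1 := inv_mul_cancel₀ h1r.ne'
              have h4 : 0 < (1 - r)⁻¹ := inv_pos.2 h1r
              have h5 : 1 ≤ (1 - r)⁻¹ := by
                rw [one_le_inv₀ h1r]; linarith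
              -- (1 - r x)(1 + x/(1 - r)) equals 1 + (1 - r) x plus this nonnegative term.
              have h6 : 0 ≤ (1 - r)⁻¹ * (r * x * (1 - x)) := by
                have : 0 ≤ 1 - x := by linarith
                positivity
              nlinarith
          _ ≤ _ := Real.add_one_le_exp _
    _ = Real.exp ((1 - r)⁻¹ * ∑ j ∈ Finset.range n, ‖q‖ ^ j) := by
        rw [← Real.exp_sum, Finset.mul_sum]
    _ ≤ _ := by
        gcongr
        exact geom_sum_le_inv (norm_nonneg q) hq n

/-! ### Bailey pairs -/

/-- The inverse Bailey transform, relative to `a = q ^ (t + 1)` and without its very-well-poised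
factor, of a sequence `β`. -/
noncomputable def baileyInv (q : ℂ) (t : ℕ) (β : ℕ → ℂ) (r : ℕ) : ℂ :=
  ∑ j ∈ Finset.range (r + 1), (-1) ^ (r - j) * q ^ ((r - j).choose 2) *
    qPoch q q (r + j + t) / qPoch q q (r - j) * β j

theorem choose_succ_two (n : ℕ) : (n + 1).choose 2 = n.choose 2 + n := by
  rw [Nat.choose_succ_succ' n 1, Nat.choose_one_right, add_comm]

/-- The orthogonality sum is indefinitely summable: the right side is its telescoping certificate.
Writing M + 1 for the size keeps the denominator 1 - q^(M+1) nonzero. -/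
theorem bailey_orthogonality_partial {q : ℂ} (hq : ‖q‖ < 1) (M l R : ℕ) (hR : R ≤ M + 1) :
    ∑ s ∈ Finset.range R, (1 - q ^ (2 * s + l + 1)) * (-1) ^ s * q ^ (s.choose 2) *
        qPoch q q (s + l) / (qPoch q q s * qPoch q q (M + 1 - s) * qPoch q q (M + 1 + s + l + 1)) =
      -((-1) ^ R * q ^ (R.choose 2) * qPoch q q (R + l) * (1 - q ^ R)) /
        ((1 - q ^ (M + 1)) * (qPoch q q R * qPoch q q (M + 1 - R) *
          qPoch q q (M + 1 + R + l))) := by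
  induction R with
  | zero => simp
  | succ R ih =>
    rw [Finset.sum_range_succ, ih (by omega)]
    obtain ⟨d, rfl⟩ : ∃ d, M = R + d := ⟨M - R, by omega⟩
    have e1 : R + d + 1 - R = d + 1 := by omega
    have e2 : R + d + 1 - (R + 1) = d := by omega
    rw [e1, e2, choose_succ_two]
    have e3 : R + d + 1 + (R + 1) + l = (R + d + 1 + R + l) + 1 := by ring
    have e4 : R + 1 + l = R + l + 1 := by ring
    rw [e3, e4, qPoch_self_succ q R, qPoch_self_succ q d, qPoch_self_succ q (R + l),
      qPoch_self_succ q (R + d + 1 + R + l)]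
    have h1 := qPoch_self_ne_zero hq R
    have h2 := qPoch_self_ne_zero hq d
    have h3 := qPoch_self_ne_zero hq (R + d + 1 + R + l)
    have h4 := one_sub_pow_succ_ne_zero hq R
    have h5 := one_sub_pow_succ_ne_zero hq d
    have h6 := one_sub_pow_succ_ne_zero hq (R + d)
    have h7 := one_sub_pow_succ_ne_zero hq (R + d + 1 + R + l)
    field_simp
    ring

/-- For M > 0 the certificate at R = M cancels the last summand. This is an entry of the product of
the Bailey matrix with its inverse. -/
theorem bailey_orthogonality {q : ℂ} (hq : ‖q‖ < 1) (M l : ℕ) :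
    ∑ s ∈ Finset.range (M + 1), (1 - q ^ (2 * s + l + 1)) * (-1) ^ s * q ^ (s.choose 2) *
        qPoch q q (s + l) / (qPoch q q s * qPoch q q (M - s) * qPoch q q (M + s + l + 1)) =
      if M = 0 then 1 else 0 := by
  rcases M with _ | M
  · have h1 := qPoch_self_ne_zero hq l
    have h2 := one_sub_pow_succ_ne_zero hq l
    simp [qPoch_self_succ]
    field_simp
  · rw [Finset.sum_range_succ, bailey_orthogonality_partial hq M l (M + 1) le_rfl]
    have e : M + 1 + (M + 1) + l + 1 = (M + 1 + (M + 1) + l) + 1 := by ring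
    rw [e, qPoch_self_succ q (M + 1 + (M + 1) + l)]
    have h1 := qPoch_self_ne_zero hq (M + 1)
    have h2 := qPoch_self_ne_zero hq (M + 1 + (M + 1) + l)
    have h3 := one_sub_pow_succ_ne_zero hq M
    have h4 := one_sub_pow_succ_ne_zero hq (M + 1 + (M + 1) + l)
    simp
    field_simp
    ring

/-- Bailey inversion. -/
theorem bailey_inversion {q : ℂ} (hq : ‖q‖ < 1) (t : ℕ) (β : ℕ → ℂ) (n : ℕ) :
    ∑ r ∈ Finset.range (n + 1), (1 - q ^ (2 * r + t + 1)) * baileyInv q t β r /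
      (qPoch q q (n - r) * qPoch q q (n + r + t + 1)) = β n := by
  -- The coefficient of β j after exchanging sums; with r = j + s it is the orthogonality sum for M
  -- = n - j and l = 2j + t.
  have key : ∀ j ∈ Finset.range (n + 1),
      ∑ r ∈ Finset.Ico j (n + 1), (1 - q ^ (2 * r + t + 1)) * ((-1) ^ (r - j) *
        q ^ ((r - j).choose 2) * qPoch q q (r + j + t) / qPoch q q (r - j)) /
        (qPoch q q (n - r) * qPoch q q (n + r + t + 1)) = if n = j then 1 else 0 := by
    intro j hj
    obtain ⟨M, rfl⟩ : ∃ M, n = j + M := ⟨n - j, by simp at hj; omega⟩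
    have h := bailey_orthogonality hq M (2 * j + t)
    rw [Finset.sum_Ico_eq_sum_range]
    have e0 : j + M + 1 - j = M + 1 := by omega
    rw [e0]
    have e00 : (j + M = j) = (M = 0) := by simp
    simp only [e00]
    rw [← h]
    refine Finset.sum_congr rfl fun s hs => ?_
    have e1 : j + s - j = s := by omega
    have e2 : j + M - (j + s) = M - s := by omega
    have e3 : j + M + (j + s) + t + 1 = M + s + (2 * j + t) + 1 := by ring
    have e4 : j + s + j + t = s + (2 * j + t) := by ring
    have e5 : 2 * (j + s) + t + 1 = 2 * s + (2 * j + t) + 1 := by ring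
    rw [e1, e2, e3, e4, e5]
    have h1 := qPoch_self_ne_zero hq s
    have h2 := qPoch_self_ne_zero hq (M - s)
    have h3 := qPoch_self_ne_zero hq (M + s + (2 * j + t) + 1)
    field_simp
  calc _ = ∑ r ∈ Finset.range (n + 1), ∑ j ∈ Finset.range (r + 1),
        (1 - q ^ (2 * r + t + 1)) * ((-1) ^ (r - j) *
        q ^ ((r - j).choose 2) * qPoch q q (r + j + t) / qPoch q q (r - j)) /
        (qPoch q q (n - r) * qPoch q q (n + r + t + 1)) * β j := by
        refine Finset.sum_congr rfl fun r _ => ?_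
        rw [baileyInv, Finset.mul_sum, Finset.sum_div]
        refine Finset.sum_congr rfl fun j _ => ?_
        ring
    _ = ∑ j ∈ Finset.range (n + 1), ∑ r ∈ Finset.Ico j (n + 1),
        (1 - q ^ (2 * r + t + 1)) * ((-1) ^ (r - j) *
        q ^ ((r - j).choose 2) * qPoch q q (r + j + t) / qPoch q q (r - j)) /
        (qPoch q q (n - r) * qPoch q q (n + r + t + 1)) * β j := by
        refine Finset.sum_comm' fun r j => ?_
        simp only [Finset.mem_range, Finset.mem_Ico]
        omega
    _ = ∑ j ∈ Finset.range (n + 1), (if n = j then 1 else 0) * β j := by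
        refine Finset.sum_congr rfl fun j hj => ?_
        rw [← Finset.sum_mul, key j hj]
    _ = β n := by simp

/-- Creative telescoping in j: the combination of the summands at n + 1 and n is a difference in j,
because the quadratic factor at J turns β J into β (J - 1). -/
theorem baileyInv_recurrence_partial {q : ℂ} (hq : ‖q‖ < 1) (t : ℕ) {β : ℕ → ℂ} {e₁ e₂ : ℂ}
    (hβ : ∀ j, β j = (1 - e₁ * q ^ (j + 1) + e₂ * q ^ (2 * (j + 1))) * β (j + 1))
    (n J : ℕ) (hJ : J ≤ n + 1) :
    ∑ j ∈ Finset.range J,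
        ((1 - e₁ * q ^ (n + 1) + e₂ * q ^ (2 * (n + 1))) * ((-1) ^ (n + 1 - j) *
            q ^ ((n + 1 - j).choose 2) * qPoch q q (n + 1 + j + t) / qPoch q q (n + 1 - j) * β j) -
          q ^ (2 * n + 1) * (e₂ - e₁ * q ^ (t + n + 1) + q ^ (2 * (t + n + 1))) *
            ((-1) ^ (n - j) * q ^ ((n - j).choose 2) * qPoch q q (n + j + t) /
              qPoch q q (n - j) * β j)) =
      (-1) ^ (n + 1) * q ^ ((n + 2).choose 2) * qPoch q q (n + t) / qPoch q q (n + 1) *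
          (1 - q ^ (2 * n + 2 + t)) * ((1 - e₁ + e₂) * β 0) -
        (-1) ^ (n + 1 - J) * q ^ ((n + 2 - J).choose 2) * qPoch q q (n + J + t) /
          qPoch q q (n + 1 - J) * (1 - q ^ (2 * n + 2 + t)) *
            ((1 - e₁ * q ^ J + e₂ * q ^ (2 * J)) * β J) := by
  induction J with
  | zero => simp
  | succ J ih =>
    rw [Finset.sum_range_succ, ih (by omega)]
    obtain ⟨d, rfl⟩ : ∃ d, n = J + d := ⟨n - J, by omega⟩
    have e1 : J + d + 1 - J = d + 1 := by omega
    have e2 : J + d + 1 - (J + 1) = d := by omega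
    have e3 : J + d + 2 - J = d + 2 := by omega
    have e4 : J + d + 2 - (J + 1) = d + 1 := by omega
    have e5 : J + d - J = d := by omega
    rw [e1, e2, e3, e4, e5, choose_succ_two (d + 1), choose_succ_two d, ← hβ J]
    have e6 : J + d + (J + 1) + t = J + d + J + t + 1 := by ring
    have e7 : J + d + 1 + J + t = J + d + J + t + 1 := by ring
    rw [e6, e7, qPoch_self_succ q d, qPoch_self_succ q (J + d + J + t)]
    have h1 := qPoch_self_ne_zero hq d
    have h2 := one_sub_pow_succ_ne_zero hq d
    have h3 := qPoch_self_ne_zero hq (J + d + 1)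
    rw [sub_add, sub_right_inj]
    field_simp
    ring

/-- The first order recurrence for the inverse Bailey transform of `1 / ((qb;q)_n (qc;q)_n)`,
where `e₁ = b + c` and `e₂ = b c`. -/
theorem baileyInv_recurrence {q : ℂ} (hq : ‖q‖ < 1) (t : ℕ) {β : ℕ → ℂ} {e₁ e₂ : ℂ}
    (hβ : ∀ j, β j = (1 - e₁ * q ^ (j + 1) + e₂ * q ^ (2 * (j + 1))) * β (j + 1)) (n : ℕ) :
    (1 - e₁ * q ^ (n + 1) + e₂ * q ^ (2 * (n + 1))) * baileyInv q t β (n + 1) =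
      q ^ (2 * n + 1) * (e₂ - e₁ * q ^ (t + n + 1) + q ^ (2 * (t + n + 1))) * baileyInv q t β n +
      (-1) ^ (n + 1) * q ^ ((n + 2).choose 2) * qPoch q q (n + t) / qPoch q q (n + 1) *
          (1 - q ^ (2 * n + 2 + t)) * ((1 - e₁ + e₂) * β 0) := by
  have h := baileyInv_recurrence_partial hq t hβ n (n + 1) le_rfl
  rw [Finset.sum_sub_distrib, ← Finset.mul_sum, ← Finset.mul_sum, sub_eq_iff_eq_add] at h
  simp only [baileyInv]
  -- The summand j = n + 1 occurs only in the transform at n + 1 and cancels the upper boundary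
  -- term.
  rw [Finset.sum_range_succ _ (n + 1), mul_add, h]
  have e1 : n + 2 - (n + 1) = 1 := by omega
  have e2 : n + 1 + (n + 1) + t = n + (n + 1) + t + 1 := by ring
  rw [e1, e2, qPoch_self_succ q (n + (n + 1) + t)]
  simp
  ring

theorem baileyInv_zero (q : ℂ) (t : ℕ) (β : ℕ → ℂ) : baileyInv q t β 0 = qPoch q q t * β 0 := by
  simp [baileyInv]

/-- The polynomials `∑_{0 ≤ j ≤ n} q^(n(n+1)/2 - j(j+1)/2)`. -/
noncomputable def triSum (q : ℂ) : ℕ → ℂ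
  | 0 => 1
  | n + 1 => 1 + q ^ (n + 1) * triSum q n

/-- The polynomials `∑_{-n ≤ j ≤ n} (-1)^(n+j) q^(n²-j²)`. -/
noncomputable def sqSum (q : ℂ) : ℕ → ℂ
  | 0 => 1
  | n + 1 => 2 - q ^ (2 * n + 1) * sqSum q n

/-! ### Explicit inverse Bailey transforms. -/

theorem norm_sq_lt_one {q : ℂ} (hq : ‖q‖ < 1) : ‖q ^ 2‖ < 1 := norm_pow_succ_lt_one hq 1

theorem qPoch_odd_ne_zero {q : ℂ} (hq : ‖q‖ < 1) (n : ℕ) : qPoch q (q ^ 2) n ≠ 0 :=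
  qPoch_ne_zero hq (norm_sq_lt_one hq) n

theorem qPoch_neg_self_ne_zero {q : ℂ} (hq : ‖q‖ < 1) (n : ℕ) : qPoch (-q) q n ≠ 0 :=
  qPoch_ne_zero (by rwa [norm_neg]) hq n

theorem one_sub_odd_pow_ne_zero {q : ℂ} (hq : ‖q‖ < 1) (n : ℕ) : 1 - q ^ (2 * n + 1) ≠ 0 :=
  one_sub_pow_succ_ne_zero hq (2 * n)

/-- The parameters are b, c = ±q^(1/2); only b + c = 0 and b c = -q enter, so no square root is
chosen. -/
theorem inv_qPoch_odd_rec {q : ℂ} (hq : ‖q‖ < 1) (j : ℕ) :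
    (qPoch q (q ^ 2) (j + 1))⁻¹ =
      (1 - 0 * q ^ (j + 1) + -q * q ^ (2 * (j + 1))) * (qPoch q (q ^ 2) (j + 1 + 1))⁻¹ := by
  have h := qPoch_odd_ne_zero hq (j + 1 + 1)
  rw [qPoch_succ _ _ (j + 1)] at h ⊢
  obtain ⟨h1, h2⟩ := mul_ne_zero_iff.1 h
  rw [mul_inv, mul_left_comm]
  have : 1 - 0 * q ^ (j + 1) + -q * q ^ (2 * (j + 1)) = 1 - q * (q ^ 2) ^ (j + 1) := by ring
  rw [this, mul_inv_cancel₀ h2, mul_one]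

/-- For t = 0 the recurrence has leading factor 1 - q^(2n+3) and previous factor -q (1 - q^(2n+1)),
so the transform multiplied by 1 - q^(2n+1) stays polynomial. -/
theorem baileyInv_odd_zero {q : ℂ} (hq : ‖q‖ < 1) (n : ℕ) :
    (1 - q ^ (2 * n + 1)) * baileyInv q 0 (fun j => (qPoch q (q ^ 2) (j + 1))⁻¹) n =
      (-1) ^ n * q ^ ((n + 1).choose 2) * (2 * triSum q n - 1) := by
  have h1q : 1 - q ≠ 0 := one_sub_ne_zero_of_norm_lt_one hq
  induction n with
  | zero =>
    rw [baileyInv_zero]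
    simp [qPoch, triSum, h1q]
    norm_num
  | succ n ih =>
    have h := baileyInv_recurrence hq 0 (inv_qPoch_odd_rec hq) n
    have h0 : (1 - 0 + -q) * (qPoch q (q ^ 2) (0 + 1))⁻¹ = 1 := by
      simp only [qPoch_succ, qPoch_zero]
      simp
      rw [← sub_eq_add_neg]
      exact mul_inv_cancel₀ h1q
    rw [h0] at h
    have hn := qPoch_self_ne_zero hq n
    have hn1 := one_sub_pow_succ_ne_zero hq n
    have e1 : (1 - q ^ (2 * (n + 1) + 1)) =
      (1 - 0 * q ^ (n + 1) + -q * q ^ (2 * (n + 1))) := by ring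
    have e2 : (-q - 0 * q ^ (0 + n + 1) + q ^ (2 * (0 + n + 1))) = -q * (1 - q ^ (2 * n + 1)) := by
      ring
    rw [e1, h, e2, triSum, qPoch_self_succ, choose_succ_two (n + 1)]
    have e3 : q ^ (2 * n + 1) * (-q * (1 - q ^ (2 * n + 1))) *
        baileyInv q 0 (fun j => (qPoch q (q ^ 2) (j + 1))⁻¹) n =
        q ^ (2 * n + 1) * (-q) * ((-1) ^ n * q ^ ((n + 1).choose 2) * (2 * triSum q n - 1)) := by
      rw [← ih]; ring
    rw [e3, add_zero]
    field_simp
    ring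

/-- For t = 1 the factor 1 - q^(2n+3) occurs in all three terms of the recurrence and cancels. -/
theorem baileyInv_odd_one {q : ℂ} (hq : ‖q‖ < 1) (n : ℕ) :
    baileyInv q 1 (fun j => (qPoch q (q ^ 2) (j + 1))⁻¹) n =
      (-1) ^ n * q ^ ((n + 1).choose 2) * triSum q n := by
  have h1q : 1 - q ≠ 0 := one_sub_ne_zero_of_norm_lt_one hq
  induction n with
  | zero =>
    rw [baileyInv_zero]
    simp [qPoch, triSum, h1q]
  | succ n ih =>
    have h := baileyInv_recurrence hq 1 (inv_qPoch_odd_rec hq) n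
    have h0 : (1 - 0 + -q) * (qPoch q (q ^ 2) (0 + 1))⁻¹ = 1 := by
      simp only [qPoch_succ, qPoch_zero]
      simp
      rw [← sub_eq_add_neg]
      exact mul_inv_cancel₀ h1q
    rw [h0, ih, mul_div_assoc _ (qPoch q q (n + 1)), div_self (qPoch_self_ne_zero hq _)] at h
    have hne := one_sub_odd_pow_ne_zero hq (n + 1)
    refine mul_left_cancel₀ hne ?_
    have e1 : (1 - q ^ (2 * (n + 1) + 1)) =
      (1 - 0 * q ^ (n + 1) + -q * q ^ (2 * (n + 1))) := by ring
    rw [e1, h, triSum, choose_succ_two (n + 1)]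
    ring

theorem inv_qPoch_neg_rec {q : ℂ} (hq : ‖q‖ < 1) (j : ℕ) :
    (qPoch (-q) q j)⁻¹ =
      (1 - (-1) * q ^ (j + 1) + 0 * q ^ (2 * (j + 1))) * (qPoch (-q) q (j + 1))⁻¹ := by
  have h := qPoch_neg_self_ne_zero hq (j + 1)
  rw [qPoch_succ] at h ⊢
  obtain ⟨h1, h2⟩ := mul_ne_zero_iff.1 h
  rw [mul_inv, mul_left_comm]
  have : 1 - (-1) * q ^ (j + 1) + 0 * q ^ (2 * (j + 1)) = 1 - -q * q ^ j := by ring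
  rw [this, mul_inv_cancel₀ h2, mul_one]

/-- Here b = -1 and c = 0; the factor 1 + q^(n+1) cancels from the recurrence, leaving that of
`sqSum`. -/
theorem baileyInv_neg {q : ℂ} (hq : ‖q‖ < 1) (n : ℕ) :
    baileyInv q 0 (fun j => (qPoch (-q) q j)⁻¹) n =
      (-1) ^ n * q ^ ((n + 1).choose 2) * sqSum q n := by
  induction n with
  | zero =>
    rw [baileyInv_zero]
    simp [sqSum]
  | succ n ih =>
    have h := baileyInv_recurrence hq 0 (inv_qPoch_neg_rec hq) n
    have hne := one_add_pow_succ_ne_zero hq n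
    refine mul_left_cancel₀ hne ?_
    have e1 : (1 + q ^ (n + 1)) =
      (1 - (-1) * q ^ (n + 1) + 0 * q ^ (2 * (n + 1))) := by ring
    have hn := qPoch_self_ne_zero hq n
    have hn1 := one_sub_pow_succ_ne_zero hq n
    rw [e1, h, ih, sqSum, choose_succ_two (n + 1), add_zero, qPoch_self_succ]
    simp only [qPoch_zero]
    field_simp
    ring

/-- In base q² the parameters are b = -1 and c = -q: two consecutive factors of (-q;q) make one
step. -/
theorem inv_qPoch_neg_odd_rec {q : ℂ} (hq : ‖q‖ < 1) (j : ℕ) :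
    (qPoch (-q) q (2 * j + 1))⁻¹ =
      (1 - (-(1 + q)) * (q ^ 2) ^ (j + 1) + q * (q ^ 2) ^ (2 * (j + 1))) *
        (qPoch (-q) q (2 * (j + 1) + 1))⁻¹ := by
  have e : 2 * (j + 1) + 1 = 2 * j + 1 + 1 + 1 := by ring
  have h := qPoch_neg_self_ne_zero hq (2 * j + 1 + 1 + 1)
  rw [qPoch_succ, qPoch_succ, mul_assoc] at h
  rw [e, qPoch_succ _ _ (2 * j + 1 + 1), qPoch_succ _ _ (2 * j + 1), mul_assoc]
  obtain ⟨h1, h2⟩ := mul_ne_zero_iff.1 h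
  rw [mul_inv, mul_left_comm]
  have : 1 - (-(1 + q)) * (q ^ 2) ^ (j + 1) + q * (q ^ 2) ^ (2 * (j + 1)) =
    (1 - -q * q ^ (2 * j + 1)) * (1 - -q * q ^ (2 * j + 1 + 1)) := by ring
  rw [this, mul_inv_cancel₀ h2, mul_one]

theorem baileyInv_neg_odd {q : ℂ} (hq : ‖q‖ < 1) (n : ℕ) :
    (1 + q ^ (2 * n + 1)) * baileyInv (q ^ 2) 0 (fun j => (qPoch (-q) q (2 * j + 1))⁻¹) n =
      (-1) ^ n * (q ^ 2) ^ ((n + 1).choose 2) * sqSum q n := by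
  have h1q : 1 + q ≠ 0 := by simpa using one_add_pow_succ_ne_zero hq 0
  induction n with
  | zero =>
    rw [baileyInv_zero]
    simp [sqSum, qPoch, h1q]
  | succ n ih =>
    have hq2 := norm_sq_lt_one hq
    have h := baileyInv_recurrence hq2 0 (inv_qPoch_neg_odd_rec hq) n
    have h0 : (1 - -(1 + q) + q) * (qPoch (-q) q (2 * 0 + 1))⁻¹ = 2 := by
      simp only [qPoch, mul_zero, zero_add, Finset.prod_range_one, pow_zero, mul_one]
      rw [← div_eq_mul_inv, sub_neg_eq_add, sub_neg_eq_add, div_eq_iff h1q]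
      ring
    rw [h0] at h
    have hne : 1 + q ^ (2 * n + 2) ≠ 0 := one_add_pow_succ_ne_zero hq (2 * n + 1)
    refine mul_left_cancel₀ hne ?_
    have hn := qPoch_self_ne_zero hq2 n
    have hn1 := one_sub_pow_succ_ne_zero hq2 n
    have e1 : (1 - -(1 + q) * (q ^ 2) ^ (n + 1) + q * (q ^ 2) ^ (2 * (n + 1))) =
      (1 + q ^ (2 * n + 2)) * (1 + q ^ (2 * (n + 1) + 1)) := by ring
    have e2 : (q - -(1 + q) * (q ^ 2) ^ (0 + n + 1) + (q ^ 2) ^ (2 * (0 + n + 1))) =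
      q * (1 + q ^ (2 * n + 2)) * (1 + q ^ (2 * n + 1)) := by ring
    rw [e1, e2] at h
    rw [← mul_assoc, h, sqSum, choose_succ_two (n + 1), add_zero, qPoch_self_succ]
    have e3 : (q ^ 2) ^ (2 * n + 1) * (q * (1 + q ^ (2 * n + 2)) * (1 + q ^ (2 * n + 1))) *
        baileyInv (q ^ 2) 0 (fun j => (qPoch (-q) q (2 * j + 1))⁻¹) n =
        (q ^ 2) ^ (2 * n + 1) * (q * (1 + q ^ (2 * n + 2))) *
          ((-1) ^ n * (q ^ 2) ^ ((n + 1).choose 2) * sqSum q n) := by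
      rw [← ih]; ring
    rw [e3]
    field_simp
    ring

/-- A Bailey pair relative to `q` in bilateral form yields a Bailey pair relative to `1`. -/
theorem bailey_pair_shift {q : ℂ} (hq : ‖q‖ < 1) (A s α : ℕ → ℂ) (h0 : α 0 = A 0)
    (h1 : ∀ r, α (r + 1) = A (r + 1) - s r * A r) (n : ℕ) :
    ∑ r ∈ Finset.range (n + 1), α r / (qPoch q q (n - r) * qPoch q q (n + r)) =
      ∑ r ∈ Finset.range (n + 1), A r * ((1 - q ^ (n + r + 1)) - s r * (1 - q ^ (n - r))) /
        (qPoch q q (n - r) * qPoch q q (n + r + 1)) := by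
  have hA : ∑ r ∈ Finset.range (n + 1), α r / (qPoch q q (n - r) * qPoch q q (n + r)) =
      ∑ r ∈ Finset.range (n + 1), A r / (qPoch q q (n - r) * qPoch q q (n + r)) -
      ∑ r ∈ Finset.range n, s r * A r / (qPoch q q (n - (r + 1)) * qPoch q q (n + (r + 1))) := by
    rw [Finset.sum_range_succ', Finset.sum_range_succ' _ n, h0, add_sub_right_comm,
      ← Finset.sum_sub_distrib]
    congr 1
    refine Finset.sum_congr rfl fun r _ => ?_
    rw [h1, sub_div]
  rw [hA, Finset.sum_range_succ, Finset.sum_range_succ _ n, add_sub_right_comm,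
    ← Finset.sum_sub_distrib]
  congr 1
  · refine Finset.sum_congr rfl fun r hr => ?_
    obtain ⟨d, rfl⟩ : ∃ d, n = r + d + 1 := ⟨n - r - 1, by simp at hr; omega⟩
    have e1 : r + d + 1 - r = d + 1 := by omega
    have e2 : r + d + 1 - (r + 1) = d := by omega
    have e3 : r + d + 1 + (r + 1) = r + d + 1 + r + 1 := by ring
    rw [e1, e2, e3, qPoch_self_succ q d, qPoch_self_succ q (r + d + 1 + r)]
    have g1 := qPoch_self_ne_zero hq d
    have g2 := qPoch_self_ne_zero hq (r + d + 1 + r)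
    have g3 := one_sub_pow_succ_ne_zero hq d
    have g4 := one_sub_pow_succ_ne_zero hq (r + d + 1 + r)
    field_simp
  -- At r = n the shifted family has no term, which agrees with the vanishing of 1 - q^(n - r).
  · rw [qPoch_self_succ q (n + n)]
    have g2 := qPoch_self_ne_zero hq (n + n)
    have g4 := one_sub_pow_succ_ne_zero hq (n + n)
    simp
    field_simp

/-! ### The `q`-Gauss sum -/

/-- The product `∏_{i < n} (z - w q^i + c q^(2i))`. -/
noncomputable def quadProd (z w c q : ℂ) (n : ℕ) : ℂ :=
  ∏ i ∈ Finset.range n, (z - w * q ^ i + c * q ^ (2 * i))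

@[simp] theorem quadProd_zero (z w c q : ℂ) : quadProd z w c q 0 = 1 := by simp [quadProd]

theorem quadProd_succ (z w c q : ℂ) (n : ℕ) :
    quadProd z w c q (n + 1) = quadProd z w c q n * (z - w * q ^ n + c * q ^ (2 * n)) := by
  simp [quadProd, Finset.prod_range_succ]

theorem quadProd_add (z w c q : ℂ) (r m : ℕ) :
    quadProd z w c q (r + m) =
      quadProd z w c q r * quadProd z (w * q ^ r) (c * q ^ (2 * r)) q m := by
  simp only [quadProd, Finset.prod_range_add]
  congr 1
  refine Finset.prod_congr rfl fun i _ => ?_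
  ring

/-- With k a power of q, this absorbs the shift of the q-Gauss parameters into a geometric factor.
-/
theorem quadProd_scale (z w c q k : ℂ) (n : ℕ) :
    quadProd (z * k) (w * k) (c * k) q n = k ^ n * quadProd z w c q n := by
  induction n with
  | zero => simp
  | succ n ih => rw [quadProd_succ, quadProd_succ, ih]; ring

theorem quadProd_one_zero (c q : ℂ) (n : ℕ) : quadProd 1 0 c q n = qPoch (-c) (q ^ 2) n := by
  simp only [quadProd, qPoch]
  refine Finset.prod_congr rfl fun i _ => ?_
  ring

theorem quadProd_one_right (w q : ℂ) (n : ℕ) : quadProd 1 w 0 q n = qPoch w q n := by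
  simp only [quadProd, qPoch]
  refine Finset.prod_congr rfl fun i _ => ?_
  ring

theorem summable_norm_quadProd {z q : ℂ} (w c : ℂ) (hz : ‖z‖ < 1) (hq : ‖q‖ < 1) :
    Summable fun n => ‖quadProd z w c q n‖ := by
  obtain ⟨r, hr1, hr2⟩ := exists_between hz
  have hlim : Tendsto (fun n : ℕ => ‖z - w * q ^ n + c * (q ^ 2) ^ n‖) atTop (𝓝 ‖z‖) := by
    have h1 := tendsto_pow_atTop_nhds_zero_of_norm_lt_one hq
    have h2 := tendsto_pow_atTop_nhds_zero_of_norm_lt_one (norm_sq_lt_one hq)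
    have h3 := (((h1.const_mul w).const_sub z).add (h2.const_mul c)).norm
    rwa [mul_zero, mul_zero, sub_zero, add_zero] at h3
  have h : ∀ᶠ n in atTop, ‖quadProd z w c q (n + 1)‖ ≤ r * ‖quadProd z w c q n‖ := by
    filter_upwards [hlim.eventually_le_const hr1] with n hn
    rw [quadProd_succ, norm_mul, mul_comm, pow_mul]
    exact mul_le_mul_of_nonneg_right hn (norm_nonneg _)
  exact (summable_of_ratio_norm_eventually_le hr2 h).norm

/-- For numerator parameters A, B and z = C/(AB), put w = z(A + B): then `quadProd z w C q m` is
(A)_m (B)_m z^m. This form stays polynomial at z = 0, that is for an infinite parameter. The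
contiguous relation from C to Cq telescopes, with the last term as certificate. -/
theorem gauss_partial_sum {q C : ℂ} (hq : ‖q‖ < 1) (hC : ‖C‖ < 1) (z w : ℂ) (N : ℕ) :
    (1 - C) * (1 - z) * ∑ m ∈ Finset.range N, quadProd z w C q m / (qPoch q q m * qPoch C q m) =
      (1 - w + C * z) *
        ∑ m ∈ Finset.range N, q ^ m * quadProd z w C q m / (qPoch q q m * qPoch (C * q) q m) -
      (1 - C) * (quadProd z w C q N * (1 - q ^ N) / (qPoch q q N * qPoch C q N)) := by
  induction N with
  | zero => simp
  | succ N ih =>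
    have hCq : ‖C * q‖ < 1 := by
      rw [norm_mul]; nlinarith [norm_nonneg C, norm_nonneg q]
    have g1 := qPoch_self_ne_zero hq N
    have g2 := one_sub_pow_succ_ne_zero hq N
    have g3 := qPoch_ne_zero hC hq N
    have g4 := qPoch_ne_zero hC hq (N + 1)
    have g5 := qPoch_ne_zero hCq hq N
    have g6 := one_sub_ne_zero_of_norm_lt_one hC
    have g7 : 1 - C * q ^ N ≠ 0 := by
      rw [qPoch_succ] at g4
      exact (mul_ne_zero_iff.1 g4).2
    have h : qPoch (C * q) q N = qPoch C q N * (1 - C * q ^ N) / (1 - C) := by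
      rw [eq_div_iff g6, ← qPoch_succ, qPoch_succ', mul_comm]
    rw [Finset.sum_range_succ, Finset.sum_range_succ, mul_add, mul_add, ih, h, quadProd_succ,
      qPoch_self_succ, qPoch_succ]
    field_simp
    ring

theorem norm_inv_mul_inv_le {q C : ℂ} {r : ℝ} (hq : ‖q‖ < 1) (hC : ‖C‖ ≤ r) (hr : r < 1) :
    ∃ K, ∀ (k m : ℕ), ‖(qPoch q q m * qPoch (C * q ^ k) q m)⁻¹‖ ≤ K := by
  refine ⟨Real.exp ((1 - ‖q‖)⁻¹ * (1 - ‖q‖)⁻¹) * Real.exp ((1 - r)⁻¹ * (1 - ‖q‖)⁻¹),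
    fun k m => ?_⟩
  rw [mul_inv, norm_mul]
  gcongr
  · exact norm_qPoch_inv_le le_rfl hq hq m
  · refine norm_qPoch_inv_le ?_ hr hq m
    rw [norm_mul, norm_pow]
    exact (mul_le_of_le_one_right (norm_nonneg C) (pow_le_one₀ (norm_nonneg q) hq.le)).trans hC

theorem summable_gauss {q C z : ℂ} (w : ℂ) (hq : ‖q‖ < 1) (hC : ‖C‖ < 1) (hz : ‖z‖ < 1) (k : ℕ) :
    Summable fun m => (q ^ k) ^ m * quadProd z w C q m / (qPoch q q m * qPoch (C * q ^ k) q m) := by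
  obtain ⟨K, hK⟩ := norm_inv_mul_inv_le hq le_rfl hC
  refine Summable.of_norm_bounded ((summable_norm_quadProd w C hz hq).mul_right K) fun m => ?_
  rw [div_eq_mul_inv, norm_mul, norm_mul]
  have h1 : ‖(q ^ k) ^ m‖ ≤ 1 := by
    rw [norm_pow, norm_pow]
    exact pow_le_one₀ (by positivity) (pow_le_one₀ (norm_nonneg q) hq.le)
  exact mul_le_mul (mul_le_of_le_one_left (norm_nonneg _) h1) (hK k m) (norm_nonneg _)
    (norm_nonneg _)

theorem gauss_recurrence {q C z : ℂ} (w : ℂ) (hq : ‖q‖ < 1) (hC : ‖C‖ < 1) (hz : ‖z‖ < 1) :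
    (1 - C) * (1 - z) * ∑' m, quadProd z w C q m / (qPoch q q m * qPoch C q m) =
      (1 - w + C * z) *
        ∑' m, q ^ m * quadProd z w C q m / (qPoch q q m * qPoch (C * q) q m) := by
  have s0 := summable_gauss w hq hC hz 0
  have s1 := summable_gauss w hq hC hz 1
  simp only [pow_zero, one_pow, one_mul, mul_one, pow_one] at s0 s1
  have t0 := (s0.hasSum.tendsto_sum_nat).const_mul ((1 - C) * (1 - z))
  have t1 := (s1.hasSum.tendsto_sum_nat).const_mul (1 - w + C * z)
  refine tendsto_nhds_unique t0 ?_
  have t2 : Tendsto (fun N => (1 - C) *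
      (quadProd z w C q N * (1 - q ^ N) / (qPoch q q N * qPoch C q N))) atTop (𝓝 0) := by
    have hp := (tendsto_pow_atTop_nhds_zero_of_norm_lt_one hq).const_sub 1
    have := (s0.tendsto_atTop_zero.mul hp).const_mul (1 - C)
    simp only [zero_mul, mul_zero] at this
    refine this.congr fun N => ?_
    ring
  have := t1.sub t2
  rw [sub_zero] at this
  exact this.congr fun N => (gauss_partial_sum hq hC z w N).symm

/-- The `q`-Gauss sum, with the two numerator symbols multiplied out. -/
theorem gauss_sum {q C z : ℂ} (w : ℂ) (hq : ‖q‖ < 1) (hC : ‖C‖ < 1) (hz : ‖z‖ < 1) {L : ℂ}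
    (hL : Tendsto (quadProd 1 w (C * z) q) atTop (𝓝 L)) :
    qPochInf C q * qPochInf z q * ∑' m, quadProd z w C q m / (qPoch q q m * qPoch C q m) = L := by
  set F : ℕ → ℂ := fun k => ∑' m, (q ^ k) ^ m * quadProd z w C q m /
    (qPoch q q m * qPoch (C * q ^ k) q m) with hF
  have hpow : ∀ k, ‖q ^ k‖ ≤ 1 := fun k => by
    rw [norm_pow]; exact pow_le_one₀ (norm_nonneg q) hq.le
  have hlt : ∀ (x : ℂ), ‖x‖ < 1 → ∀ k, ‖x * q ^ k‖ < 1 := fun x hx k => by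
    rw [norm_mul]
    exact lt_of_le_of_lt (mul_le_of_le_one_right (norm_nonneg x) (hpow k)) hx
  -- Iterating the contiguous relation moves (z, w, C) to (z q^k, w q^k, C q^k) and collects the
  -- product side.
  have hrec : ∀ k, qPoch C q k * qPoch z q k * F 0 = quadProd 1 w (C * z) q k * F k := by
    intro k
    induction k with
    | zero => simp
    | succ k ih =>
      have h := gauss_recurrence (w * q ^ k) hq (hlt C hC k) (hlt z hz k)
      simp only [quadProd_scale] at h
      have hF' : ∑' m, q ^ m * ((q ^ k) ^ m * quadProd z w C q m) /
          (qPoch q q m * qPoch (C * q ^ k * q) q m) = F (k + 1) := by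
        refine tsum_congr fun m => ?_
        rw [pow_succ q k, mul_pow, mul_assoc C, mul_left_comm, mul_assoc ((q ^ k) ^ m)]
      rw [hF'] at h
      rw [qPoch_succ, qPoch_succ, quadProd_succ]
      calc _ = (1 - C * q ^ k) * (1 - z * q ^ k) * (qPoch C q k * qPoch z q k * F 0) := by ring
        _ = quadProd 1 w (C * z) q k * ((1 - C * q ^ k) * (1 - z * q ^ k) * F k) := by
            rw [ih]; ring
        _ = _ := by rw [h]; ring
  -- As k grows, the factor (q^k)^m kills every term except m = 0.
  have hlim : Tendsto F atTop (𝓝 1) := by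
    obtain ⟨K, hK⟩ := norm_inv_mul_inv_le hq le_rfl hC
    have h1 : (1 : ℂ) = ∑' m : ℕ, if m = 0 then 1 else 0 := by simp
    rw [h1]
    refine tendsto_tsum_of_dominated_convergence
      ((summable_norm_quadProd w C hz hq).mul_right K) (fun m => ?_)
      (Eventually.of_forall fun k m => ?_)
    · rcases m with _ | m
      · simp
      · simp only [Nat.add_eq_zero_iff, one_ne_zero, and_false, if_false]
        have hp : Tendsto (fun k : ℕ => (q ^ k) ^ (m + 1)) atTop (𝓝 0) := by
          have := tendsto_pow_atTop_nhds_zero_of_norm_lt_one (norm_pow_succ_lt_one hq m)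
          refine this.congr fun k => ?_
          rw [← pow_mul, ← pow_mul, mul_comm]
        have := hp.zero_mul_isBoundedUnder_le (g := fun k => quadProd z w C q (m + 1) *
          (qPoch q q (m + 1) * qPoch (C * q ^ k) q (m + 1))⁻¹) ?_
        · refine this.congr fun k => ?_
          rw [div_eq_mul_inv, mul_assoc]
        · refine ⟨‖quadProd z w C q (m + 1)‖ * K, ?_⟩
          rw [eventually_map]
          refine Eventually.of_forall fun k => ?_
          simp only [Function.comp, norm_mul _ (_)⁻¹]
          gcongr
          exact hK k (m + 1)
    · rw [div_eq_mul_inv, norm_mul, norm_mul]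
      have h1 : ‖(q ^ k) ^ m‖ ≤ 1 := by
        rw [norm_pow]
        exact pow_le_one₀ (norm_nonneg _) (hpow k)
      exact mul_le_mul (mul_le_of_le_one_left (norm_nonneg _) h1) (hK k m) (norm_nonneg _)
        (norm_nonneg _)
  have hl := hL.mul hlim
  have hr := ((tendsto_qPoch C hq).mul (tendsto_qPoch z hq)).mul_const (F 0)
  have := tendsto_nhds_unique (hr.congr hrec) hl
  simpa [hF] using this

/-! ### The limiting form of Bailey's lemma -/

/-- Rearrangement of a truncated sum of a Bailey pair against a sequence of weights. -/
theorem bailey_partial_sum {q : ℂ} (t : ℕ) {α β : ℕ → ℂ}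
    (hβ : ∀ n, ∑ r ∈ Finset.range (n + 1), α r / (qPoch q q (n - r) * qPoch q q (n + r + t)) = β n)
    (δ : ℕ → ℂ) (N : ℕ) :
    ∑ n ∈ Finset.range N, δ n * β n = ∑' r, α r * ∑ m ∈ Finset.range (N - r),
      δ (r + m) / (qPoch q q m * qPoch q q (2 * r + t + m)) := by
  rw [tsum_eq_sum (s := Finset.range N)]
  · calc _ = ∑ n ∈ Finset.range N, ∑ r ∈ Finset.range (n + 1),
          α r * (δ n / (qPoch q q (n - r) * qPoch q q (n + r + t))) := by
          refine Finset.sum_congr rfl fun n _ => ?_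
          rw [← hβ, Finset.mul_sum]
          refine Finset.sum_congr rfl fun r _ => ?_
          ring
      _ = ∑ r ∈ Finset.range N, ∑ n ∈ Finset.Ico r N,
          α r * (δ n / (qPoch q q (n - r) * qPoch q q (n + r + t))) := by
          refine Finset.sum_comm' fun n r => ?_
          simp only [Finset.mem_range, Finset.mem_Ico]
          omega
      _ = _ := by
          refine Finset.sum_congr rfl fun r _ => ?_
          rw [Finset.sum_Ico_eq_sum_range, Finset.mul_sum]
          refine Finset.sum_congr rfl fun m _ => ?_
          rw [Nat.add_sub_cancel_left]
          congr 4
          ring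
  -- For r ≥ N the truncated difference N - r is 0, so the inner sum is empty and the series over r
  -- is finite.
  · intro r hr
    rw [Finset.mem_range, not_lt] at hr
    simp [Nat.sub_eq_zero_of_le hr]

theorem qPoch_self_split (q : ℂ) (a m : ℕ) :
    qPoch q q (a + m) = qPoch q q a * qPoch (q ^ (a + 1)) q m := by
  rw [qPoch_add, pow_succ']

theorem norm_pow_le_one {q : ℂ} (hq : ‖q‖ < 1) (n : ℕ) : ‖q ^ n‖ ≤ 1 := by
  rw [norm_pow]; exact pow_le_one₀ (norm_nonneg q) hq.le

theorem qPochInf_self_split {q : ℂ} (hq : ‖q‖ < 1) (a : ℕ) :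
    qPochInf q q = qPoch q q a * qPochInf (q ^ (a + 1)) q := by
  rw [qPochInf_eq_qPoch_mul q hq a, pow_succ']

/-- The limiting form of Bailey's lemma, relative to `a = q ^ t`. -/
theorem bailey_limit {q z : ℂ} (w : ℂ) (hq : ‖q‖ < 1) (hz : ‖z‖ < 1) (t : ℕ) {α β : ℕ → ℂ}
    (hβ : ∀ n, ∑ r ∈ Finset.range (n + 1), α r / (qPoch q q (n - r) * qPoch q q (n + r + t)) = β n)
    (hα : Summable fun r => ‖α r‖) {L : ℂ}
    (hL : Tendsto (quadProd 1 w (q ^ (t + 1) * z) q) atTop (𝓝 L))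
    (hne : ∀ r, quadProd 1 w (q ^ (t + 1) * z) q r ≠ 0) :
    Tendsto (fun N => ∑ n ∈ Finset.range N, quadProd z w (q ^ (t + 1)) q n * β n) atTop
      (𝓝 (∑' r, α r * (quadProd z w (q ^ (t + 1)) q r / quadProd 1 w (q ^ (t + 1) * z) q r *
        (L / (qPochInf q q * qPochInf z q))))) := by
  simp only [bailey_partial_sum t hβ]
  set δ := quadProd z w (q ^ (t + 1)) q with hδ
  set K := Real.exp ((1 - ‖q‖)⁻¹ * (1 - ‖q‖)⁻¹) with hK
  have hδs : Summable fun n => ‖δ n‖ := summable_norm_quadProd w (q ^ (t + 1)) hz hq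
  refine tendsto_tsum_of_dominated_convergence
    (hα.mul_right ((∑' n, ‖δ n‖) * (K * K))) (fun r => ?_) (Eventually.of_forall fun N r => ?_)
  · refine Tendsto.const_mul _ ?_
    set C := q ^ (2 * r + t + 1) with hCdef
    have hC : ‖C‖ < 1 := norm_pow_succ_lt_one hq (2 * r + t)
    have hCr : q ^ (t + 1) * q ^ (2 * r) = C := by rw [hCdef]; ring
    -- After removing the part depending on r alone, the inner sum is a q-Gauss sum with C =
    -- q^(2r+t+1) and w replaced by w q^r.
    have hterm : ∀ m, δ (r + m) / (qPoch q q m * qPoch q q (2 * r + t + m)) =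
        δ r / qPoch q q (2 * r + t) *
          (quadProd z (w * q ^ r) C q m / (qPoch q q m * qPoch C q m)) := by
      intro m
      rw [hδ, quadProd_add, hCr, qPoch_self_split, ← hCdef]
      have g1 := qPoch_self_ne_zero hq m
      have g2 := qPoch_self_ne_zero hq (2 * r + t)
      have g3 := qPoch_ne_zero hC hq m
      field_simp
    simp only [hterm, ← Finset.mul_sum]
    have hLr : Tendsto (quadProd 1 (w * q ^ r) (C * z) q) atTop
        (𝓝 (L / quadProd 1 w (q ^ (t + 1) * z) q r)) := by
      have h := ((tendsto_add_atTop_iff_nat r).2 hL).div_const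
        (quadProd 1 w (q ^ (t + 1) * z) q r)
      refine h.congr fun m => ?_
      rw [add_comm m r, quadProd_add, mul_div_cancel_left₀ _ (hne r), mul_right_comm, hCr]
    have hG := gauss_sum (w * q ^ r) hq hC hz hLr
    have hs := summable_gauss (w * q ^ r) hq hC hz 0
    simp only [pow_zero, one_pow, one_mul, mul_one] at hs
    have ht := (hs.hasSum.tendsto_sum_nat.comp (tendsto_sub_atTop_nat r)).const_mul
      (δ r / qPoch q q (2 * r + t))
    have hval : δ r / qPoch q q (2 * r + t) *
        ∑' m, quadProd z (w * q ^ r) C q m / (qPoch q q m * qPoch C q m) =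
        δ r / quadProd 1 w (q ^ (t + 1) * z) q r * (L / (qPochInf q q * qPochInf z q)) := by
      have g1 := qPochInf_ne_zero hC hq
      have g2 := qPochInf_ne_zero hz hq
      have g3 := qPoch_self_ne_zero hq (2 * r + t)
      rw [qPochInf_self_split hq (2 * r + t), ← hCdef]
      have hX : ∑' m, quadProd z (w * q ^ r) C q m / (qPoch q q m * qPoch C q m) =
          L / quadProd 1 w (q ^ (t + 1) * z) q r / (qPochInf C q * qPochInf z q) := by
        rw [← hG, mul_div_cancel_left₀ _ (mul_ne_zero g1 g2)]
      rw [hX]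
      have g4 := hne r
      field_simp
    rw [← hval]
    exact ht
  · rw [norm_mul]
    refine mul_le_mul_of_nonneg_left ?_ (norm_nonneg _)
    calc _ ≤ ∑ m ∈ Finset.range (N - r),
          ‖δ (r + m) / (qPoch q q m * qPoch q q (2 * r + t + m))‖ := norm_sum_le _ _
      _ ≤ ∑ m ∈ Finset.range (N - r), ‖δ (r + m)‖ * (K * K) := by
          refine Finset.sum_le_sum fun m _ => ?_
          rw [div_eq_mul_inv, norm_mul, mul_inv, norm_mul]
          gcongr
          · exact norm_qPoch_inv_le le_rfl hq hq _
          · exact norm_qPoch_inv_le le_rfl hq hq _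
      _ = (∑ m ∈ Finset.range (N - r), ‖δ (r + m)‖) * (K * K) := by rw [Finset.sum_mul]
      _ ≤ _ := by
          gcongr
          have hinj : Function.Injective (fun m : ℕ => r + m) := add_right_injective r
          calc _ = ∑ n ∈ (Finset.range (N - r)).map ⟨_, hinj⟩, ‖δ n‖ := by
                rw [Finset.sum_map]; rfl
            _ ≤ _ := hδs.sum_le_tsum _ fun _ _ => norm_nonneg _

/-! ### The q-Gauss sum and Bailey's lemma on the boundary z = -1. -/

theorem quadProd_neg_one (C q : ℂ) (m : ℕ) :
    quadProd (-1) 0 C q m = (-1) ^ m * qPoch C (q ^ 2) m := by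
  induction m with
  | zero => simp
  | succ m ih => rw [quadProd_succ, qPoch_succ, ih]; ring

/-- The contiguous relation holds for finite N even at z = -1. It separates an absolutely convergent
sum from an oscillating boundary term. -/
theorem gauss_partial_sum_neg_one {q C : ℂ} (hq : ‖q‖ < 1) (hC : ‖C‖ < 1) (N : ℕ) :
    ∑ m ∈ Finset.range N, (-1) ^ m * qPoch C (q ^ 2) m / (qPoch q q m * qPoch C q m) =
      (∑ m ∈ Finset.range N, q ^ m * ((-1) ^ m * qPoch C (q ^ 2) m) /
        (qPoch q q m * qPoch (C * q) q m)) / 2 -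
      (-1) ^ N * qPoch C (q ^ 2) N / (qPoch q q N * qPoch C q N) * (1 - q ^ N) / 2 := by
  have h1C := one_sub_ne_zero_of_norm_lt_one hC
  have h := gauss_partial_sum hq hC (-1) 0 N
  simp only [quadProd_neg_one] at h
  have h2 : (1 - C) * (2 * ∑ m ∈ Finset.range N,
        (-1) ^ m * qPoch C (q ^ 2) m / (qPoch q q m * qPoch C q m)) = (1 - C) *
      (∑ m ∈ Finset.range N, q ^ m * ((-1) ^ m * qPoch C (q ^ 2) m) /
        (qPoch q q m * qPoch (C * q) q m) -
        (-1) ^ N * qPoch C (q ^ 2) N / (qPoch q q N * qPoch C q N) * (1 - q ^ N)) := by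
    linear_combination h
  have h3 := mul_left_cancel₀ h1C h2
  linear_combination h3 / 2

theorem quadProd_neg_eq (q C : ℂ) (m : ℕ) :
    quadProd (-q) 0 (C * q) q m = q ^ m * ((-1) ^ m * qPoch C (q ^ 2) m) := by
  rw [← quadProd_neg_one, ← quadProd_scale]
  simp

/-- The borderline case of the `q`-Gauss sum: the averages of consecutive partial sums. -/
theorem gauss_sum_average {q C : ℂ} (hq : ‖q‖ < 1) (hC : ‖C‖ < 1) :
    Tendsto (fun N => (∑ m ∈ Finset.range N,
        (-1) ^ m * qPoch C (q ^ 2) m / (qPoch q q m * qPoch C q m) +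
      ∑ m ∈ Finset.range (N + 1),
        (-1) ^ m * qPoch C (q ^ 2) m / (qPoch q q m * qPoch C q m)) / 2) atTop
      (𝓝 (qPochInf C (q ^ 2) / (qPochInf C q * qPochInf (-1) q))) := by
  have hq2 := norm_sq_lt_one hq
  have h1C := one_sub_ne_zero_of_norm_lt_one hC
  set t : ℕ → ℂ := fun m => (-1) ^ m * qPoch C (q ^ 2) m / (qPoch q q m * qPoch C q m) with ht
  have hCq : ‖C * q‖ < 1 := by
    rw [norm_mul]; nlinarith [norm_nonneg C, norm_nonneg q]
  have hnq : ‖-q‖ < 1 := by rwa [norm_neg]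
  have hpart : ∀ N, ∑ m ∈ Finset.range N, t m =
      (∑ m ∈ Finset.range N, quadProd (-q) 0 (C * q) q m / (qPoch q q m * qPoch (C * q) q m)) / 2
        - t N * (1 - q ^ N) / 2 := by
    intro N
    simp only [quadProd_neg_eq]
    exact gauss_partial_sum_neg_one hq hC N
  have hs := summable_gauss 0 hq hCq hnq 0
  simp only [pow_zero, one_pow, one_mul, mul_one] at hs
  have hL : Tendsto (quadProd 1 0 (C * q * -q) q) atTop (𝓝 (qPochInf (C * q ^ 2) (q ^ 2))) := by
    have := tendsto_qPoch (C * q ^ 2) hq2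
    refine this.congr fun n => ?_
    rw [quadProd_one_zero]
    congr 1
    ring
  have hG := gauss_sum 0 hq hCq hnq hL
  set X := ∑' m, quadProd (-q) 0 (C * q) q m / (qPoch q q m * qPoch (C * q) q m) with hX
  have hval : qPochInf C (q ^ 2) / (qPochInf C q * qPochInf (-1) q) = X / 2 := by
    have g1 := qPochInf_ne_zero hCq hq
    have g2 := qPochInf_ne_zero hnq hq
    rw [qPochInf_succ C hq2, qPochInf_succ C hq, qPochInf_succ (-1) hq, ← hG]
    have e : -1 * q = -q := by ring
    rw [e]
    field_simp
    ring
  rw [hval]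
  have hlim : Tendsto (fun N => ∑ m ∈ Finset.range N,
      quadProd (-q) 0 (C * q) q m / (qPoch q q m * qPoch (C * q) q m)) atTop (𝓝 X) :=
    hs.hasSum.tendsto_sum_nat
  have hpw := tendsto_pow_atTop_nhds_zero_of_norm_lt_one hq
  have hq2pw : Tendsto (fun N : ℕ => (q ^ 2) ^ N) atTop (𝓝 0) :=
    tendsto_pow_atTop_nhds_zero_of_norm_lt_one hq2
  -- Consecutive boundary terms have opposite signs and asymptotically equal size, so averaging
  -- removes them.
  have htt : Tendsto (fun N => t N * (1 - q ^ N) + t (N + 1) * (1 - q ^ (N + 1))) atTop (𝓝 0) := by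
    have hb : ∀ N, t N * (1 - q ^ N) + t (N + 1) * (1 - q ^ (N + 1)) =
        (-q ^ N * (1 + C) + 2 * C * (q ^ 2) ^ N) *
          ((-1) ^ N * qPoch C (q ^ 2) N * (qPoch q q N)⁻¹ * (qPoch C q (N + 1))⁻¹) := by
      intro N
      have g1 := qPoch_self_ne_zero hq N
      have g2 := one_sub_pow_succ_ne_zero hq N
      have g3 := qPoch_ne_zero hC hq N
      have g4 := qPoch_ne_zero hC hq (N + 1)
      have g7 : 1 - C * q ^ N ≠ 0 := by
        rw [qPoch_succ] at g4
        exact (mul_ne_zero_iff.1 g4).2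
      have e1 : t N = (-1) ^ N * qPoch C (q ^ 2) N * (qPoch q q N)⁻¹ *
          ((qPoch C q (N + 1))⁻¹ * (1 - C * q ^ N)) := by
        rw [ht, qPoch_succ]
        field_simp
      have e2 : t (N + 1) * (1 - q ^ (N + 1)) = -(-1) ^ N * qPoch C (q ^ 2) N *
          (1 - C * (q ^ 2) ^ N) * (qPoch q q N)⁻¹ * (qPoch C q (N + 1))⁻¹ := by
        simp only [ht]
        rw [qPoch_succ C (q ^ 2), qPoch_self_succ]
        field_simp
        ring
      rw [e1, e2]
      ring
    simp only [hb]
    have h0 : Tendsto (fun N : ℕ => -q ^ N * (1 + C) + 2 * C * (q ^ 2) ^ N) atTop (𝓝 0) := by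
      simpa using (hpw.neg.mul_const (1 + C)).add (hq2pw.const_mul (2 * C))
    refine h0.zero_mul_isBoundedUnder_le ?_
    refine ⟨Real.exp (‖C‖ * (1 - ‖q ^ 2‖)⁻¹) * Real.exp ((1 - ‖q‖)⁻¹ * (1 - ‖q‖)⁻¹) *
      Real.exp ((1 - ‖C‖)⁻¹ * (1 - ‖q‖)⁻¹), ?_⟩
    rw [eventually_map]
    refine Eventually.of_forall fun N => ?_
    simp only [Function.comp, norm_mul, norm_pow (-1 : ℂ), norm_neg, norm_one, one_pow, one_mul]
    gcongr
    · exact norm_qPoch_le le_rfl hq2 N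
    · exact norm_qPoch_inv_le le_rfl hq hq N
    · exact norm_qPoch_inv_le le_rfl hC hq _
  have h1 := ((hlim.add ((tendsto_add_atTop_iff_nat 1).2 hlim)).sub htt).div_const 4
  have e : (X + X - 0) / 4 = X / 2 := by ring
  rw [e] at h1
  refine h1.congr fun N => ?_
  rw [hpart N, hpart (N + 1)]
  ring

/-- The bound must be uniform in C because dominated convergence below uses C = q^(2r+1) for all r
at once. -/
theorem gauss_partial_sum_neg_one_bounded {q : ℂ} (hq : ‖q‖ < 1) :
    ∃ K, 0 ≤ K ∧ ∀ C : ℂ, ‖C‖ ≤ ‖q‖ → ∀ N, ‖∑ m ∈ Finset.range N,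
      (-1) ^ m * qPoch C (q ^ 2) m / (qPoch q q m * qPoch C q m)‖ ≤ K := by
  have hq2 := norm_sq_lt_one hq
  set A := Real.exp (1 * (1 - ‖q ^ 2‖)⁻¹)
  set B := Real.exp ((1 - ‖q‖)⁻¹ * (1 - ‖q‖)⁻¹)
  have h1q : 0 ≤ (1 - ‖q‖)⁻¹ := inv_nonneg.2 (by linarith)
  refine ⟨(A * (B * B)) * (1 - ‖q‖)⁻¹ + A * (B * B) * 2, by positivity, fun C hC N => ?_⟩
  have hC1 : ‖C‖ < 1 := lt_of_le_of_lt hC hq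
  have hCq : ‖C * q‖ ≤ ‖q‖ := by
    rw [norm_mul]
    exact mul_le_of_le_one_left (norm_nonneg q) hC1.le
  have hA : ∀ m, ‖(-1) ^ m * qPoch C (q ^ 2) m‖ ≤ A := fun m => by
    rw [norm_mul, norm_pow, norm_neg, norm_one, one_pow, one_mul]
    exact norm_qPoch_le hC1.le hq2 m
  have hB : ∀ D : ℂ, ‖D‖ ≤ ‖q‖ → ∀ m, ‖(qPoch q q m * qPoch D q m)⁻¹‖ ≤ B * B := fun D hD m => by
    rw [mul_inv, norm_mul]
    gcongr
    · exact norm_qPoch_inv_le le_rfl hq hq m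
    · exact norm_qPoch_inv_le hD hq hq m
  rw [gauss_partial_sum_neg_one hq hC1]
  refine (norm_sub_le _ _).trans (add_le_add ?_ ?_)
  · rw [norm_div, Complex.norm_ofNat]
    refine (half_le_self (norm_nonneg _)).trans ((norm_sum_le _ _).trans ?_)
    calc _ ≤ ∑ m ∈ Finset.range N, (A * (B * B)) * ‖q‖ ^ m := by
          refine Finset.sum_le_sum fun m _ => ?_
          rw [div_eq_mul_inv, norm_mul, norm_mul, norm_pow]
          calc ‖q‖ ^ m * ‖(-1) ^ m * qPoch C (q ^ 2) m‖ *
                ‖(qPoch q q m * qPoch (C * q) q m)⁻¹‖ ≤ ‖q‖ ^ m * A * (B * B) := by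
                gcongr
                · exact hA m
                · exact hB _ hCq m
            _ = _ := by ring
      _ = (A * (B * B)) * ∑ m ∈ Finset.range N, ‖q‖ ^ m := by rw [Finset.mul_sum]
      _ ≤ _ := by
          gcongr
          exact geom_sum_le_inv (norm_nonneg q) hq N
  · rw [norm_div, Complex.norm_ofNat]
    refine (half_le_self (norm_nonneg _)).trans ?_
    rw [norm_mul, div_eq_mul_inv, norm_mul]
    gcongr
    · exact hA N
    · exact hB _ hC N
    · refine (norm_sub_le _ _).trans ?_
      rw [norm_one]
      linarith [norm_pow_le_one hq N]

/-- The borderline case of the limiting Bailey lemma, relative to `a = 1`, for averages of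
consecutive partial sums. -/
theorem bailey_limit_average {q : ℂ} (hq : ‖q‖ < 1) {α β : ℕ → ℂ}
    (hβ : ∀ n, ∑ r ∈ Finset.range (n + 1), α r / (qPoch q q (n - r) * qPoch q q (n + r)) = β n)
    (hα : Summable fun r => ‖α r‖) :
    Tendsto (fun N => (∑ n ∈ Finset.range N, (-1) ^ n * qPoch q (q ^ 2) n * β n +
      ∑ n ∈ Finset.range (N + 1), (-1) ^ n * qPoch q (q ^ 2) n * β n) / 2) atTop
      (𝓝 (∑' r, α r * ((-1) ^ r *
        (qPochInf q (q ^ 2) / (qPochInf q q * qPochInf (-1) q))))) := by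
  have hq2 := norm_sq_lt_one hq
  have hP := fun N => bailey_partial_sum (q := q) 0 hβ (fun n => (-1) ^ n * qPoch q (q ^ 2) n) N
  obtain ⟨K, hK0, hK⟩ := gauss_partial_sum_neg_one_bounded hq
  have hterm : ∀ r m, (-1) ^ (r + m) * qPoch q (q ^ 2) (r + m) /
      (qPoch q q m * qPoch q q (2 * r + 0 + m)) =
      (-1) ^ r * qPoch q (q ^ 2) r / qPoch q q (2 * r) *
        ((-1) ^ m * qPoch (q ^ (2 * r + 1)) (q ^ 2) m /
          (qPoch q q m * qPoch (q ^ (2 * r + 1)) q m)) := by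
    intro r m
    have e : q * (q ^ 2) ^ r = q ^ (2 * r + 1) := by ring
    rw [add_zero, qPoch_self_split, qPoch_add q (q ^ 2), e, pow_add]
    have g1 := qPoch_self_ne_zero hq m
    have g2 := qPoch_self_ne_zero hq (2 * r)
    have g3 := qPoch_ne_zero (norm_pow_succ_lt_one hq (2 * r)) hq m
    field_simp
  simp only [hterm, ← Finset.mul_sum] at hP
  set A := Real.exp (1 * (1 - ‖q ^ 2‖)⁻¹)
  set B := Real.exp ((1 - ‖q‖)⁻¹ * (1 - ‖q‖)⁻¹)
  set c : ℕ → ℂ := fun r => (-1) ^ r * qPoch q (q ^ 2) r / qPoch q q (2 * r) with hc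
  set G : ℕ → ℕ → ℂ := fun r N => ∑ m ∈ Finset.range N,
    (-1) ^ m * qPoch (q ^ (2 * r + 1)) (q ^ 2) m /
      (qPoch q q m * qPoch (q ^ (2 * r + 1)) q m) with hG
  have hcb : ∀ r, ‖c r‖ ≤ A * B := by
    intro r
    rw [hc]
    simp only
    rw [div_eq_mul_inv, norm_mul, norm_mul, norm_pow, norm_neg, norm_one, one_pow, one_mul]
    gcongr
    · exact norm_qPoch_le hq.le hq2 r
    · exact norm_qPoch_inv_le le_rfl hq hq _
  have hGb : ∀ r N, ‖G r N‖ ≤ K := fun r N => hK _ (by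
    rw [pow_succ, norm_mul]
    exact mul_le_of_le_one_left (norm_nonneg q) (norm_pow_le_one hq _)) N
  have hbd : ∀ N r, ‖α r * (c r * G r (N - r))‖ ≤ ‖α r‖ * (A * B * K) := by
    intro N r
    rw [norm_mul, norm_mul]
    gcongr
    · exact hcb r
    · exact hGb r _
  have hsum : ∀ N, Summable fun r => α r * (c r * G r (N - r)) := fun N =>
    Summable.of_norm_bounded (hα.mul_right _) (hbd N)
  have hcomb : ∀ N, (∑ n ∈ Finset.range N, (-1) ^ n * qPoch q (q ^ 2) n * β n +
      ∑ n ∈ Finset.range (N + 1), (-1) ^ n * qPoch q (q ^ 2) n * β n) / 2 =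
      ∑' r, α r * (c r * ((G r (N - r) + G r (N + 1 - r)) / 2)) := by
    intro N
    rw [hP N, hP (N + 1), ← (hsum N).tsum_add (hsum (N + 1)), ← tsum_div_const]
    refine tsum_congr fun r => ?_
    ring
  simp only [hcomb]
  refine tendsto_tsum_of_dominated_convergence (hα.mul_right (A * B * K)) (fun r => ?_)
    (Eventually.of_forall fun N r => ?_)
  · refine Tendsto.const_mul _ ?_
    have hC := norm_pow_succ_lt_one hq (2 * r)
    have h1 := (gauss_sum_average hq hC).const_mul (c r)
    have hval : c r * (qPochInf (q ^ (2 * r + 1)) (q ^ 2) /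
        (qPochInf (q ^ (2 * r + 1)) q * qPochInf (-1) q)) =
        (-1) ^ r * (qPochInf q (q ^ 2) / (qPochInf q q * qPochInf (-1) q)) := by
      have e : q * (q ^ 2) ^ r = q ^ (2 * r + 1) := by ring
      rw [qPochInf_eq_qPoch_mul q hq2 r, e, qPochInf_self_split hq (2 * r), hc]
      have g1 := qPoch_self_ne_zero hq (2 * r)
      have g2 := qPochInf_ne_zero hC hq
      have g3 : qPochInf (-1) q ≠ 0 := by
        rw [qPochInf_succ (-1) hq]
        refine mul_ne_zero (by norm_num) (qPochInf_ne_zero ?_ hq)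
        simpa using hq
      field_simp
    rw [hval] at h1
    -- Only for N ≥ r are N - r and N + 1 - r consecutive.
    refine ((h1.comp (tendsto_sub_atTop_nat r))).congr' ?_
    filter_upwards [eventually_ge_atTop r] with N hN
    have e : N + 1 - r = N - r + 1 := by omega
    simp only [Function.comp, e, hG]
  · rw [norm_mul, norm_mul]
    gcongr
    · exact hcb r
    · rw [norm_div, Complex.norm_ofNat]
      have := norm_add_le (G r (N - r)) (G r (N + 1 - r))
      linarith [hGb r (N - r), hGb r (N + 1 - r)]

/-! ### Convergence of the defining series -/

theorem summable_norm_pow_mul {q : ℂ} (hq : ‖q‖ < 1) {f : ℕ → ℕ} (hf : ∀ n, n ≤ f n)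
    {c : ℕ → ℂ} {K : ℝ} (hc : ∀ n, ‖c n‖ ≤ K) : Summable fun n => ‖q ^ f n * c n‖ := by
  refine Summable.of_nonneg_of_le (fun _ => norm_nonneg _) (fun n => ?_)
    ((summable_geometric_of_lt_one (norm_nonneg q) hq).mul_right K)
  rw [norm_mul, norm_pow]
  exact mul_le_mul (pow_le_pow_of_le_one (norm_nonneg q) hq.le (hf n)) (hc n) (norm_nonneg _)
    (by positivity)

theorem le_choose_succ_two (n : ℕ) : n ≤ (n + 1).choose 2 := by
  rw [choose_succ_two]; omega

theorem choose_two_add_self (n : ℕ) : (n + 1).choose 2 + (n + 1).choose 2 = n * (n + 1) := by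
  induction n with
  | zero => rfl
  | succ n ih =>
    rw [choose_succ_two (n + 1)]
    linarith

theorem mul_succ_div_two (n : ℕ) : n * (n + 1) / 2 = (n + 1).choose 2 := by
  have := choose_two_add_self n
  omega

theorem norm_triSum_le {q : ℂ} (hq : ‖q‖ < 1) (n : ℕ) : ‖triSum q n‖ ≤ (1 - ‖q‖)⁻¹ := by
  have h0 : 0 < 1 - ‖q‖ := by linarith
  induction n with
  | zero =>
    simp only [triSum, norm_one]
    rw [one_le_inv₀ h0]
    linarith [norm_nonneg q]
  | succ n ih =>
    calc ‖triSum q (n + 1)‖ ≤ ‖(1 : ℂ)‖ + ‖q ^ (n + 1) * triSum q n‖ := norm_add_le _ _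
      _ ≤ 1 + ‖q‖ * (1 - ‖q‖)⁻¹ := by
          rw [norm_one, norm_mul]
          gcongr
          rw [pow_succ, norm_mul]
          exact mul_le_of_le_one_left (norm_nonneg q) (norm_pow_le_one hq n)
      _ = (1 - ‖q‖)⁻¹ := by field_simp; ring

theorem norm_sqSum_le {q : ℂ} (hq : ‖q‖ < 1) (n : ℕ) : ‖sqSum q n‖ ≤ 2 * (1 - ‖q‖)⁻¹ := by
  have h0 : 0 < 1 - ‖q‖ := by linarith
  induction n with
  | zero =>
    simp only [sqSum, norm_one]
    have : 1 ≤ (1 - ‖q‖)⁻¹ := by rw [one_le_inv₀ h0]; linarith [norm_nonneg q]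
    linarith
  | succ n ih =>
    calc ‖sqSum q (n + 1)‖ ≤ ‖(2 : ℂ)‖ + ‖q ^ (2 * n + 1) * sqSum q n‖ := norm_sub_le _ _
      _ ≤ 2 + ‖q‖ * (2 * (1 - ‖q‖)⁻¹) := by
          rw [Complex.norm_ofNat, norm_mul]
          gcongr
          rw [pow_succ, norm_mul]
          exact mul_le_of_le_one_left (norm_nonneg q) (norm_pow_le_one hq _)
      _ = 2 * (1 - ‖q‖)⁻¹ := by field_simp; ring

theorem norm_qPoch_div_le {a b q r : ℂ} (hb : ‖b‖ < 1) (hq : ‖q‖ < 1) (hr : ‖r‖ < 1) :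
    ∃ K, ∀ m n, ‖qPoch a q m / qPoch b r n‖ ≤ K := by
  refine ⟨Real.exp (‖a‖ * (1 - ‖q‖)⁻¹) * Real.exp ((1 - ‖b‖)⁻¹ * (1 - ‖r‖)⁻¹), fun m n => ?_⟩
  rw [div_eq_mul_inv, norm_mul]
  exact mul_le_mul (norm_qPoch_le le_rfl hq m) (norm_qPoch_inv_le le_rfl hb hr n) (norm_nonneg _)
    (Real.exp_nonneg _)

theorem norm_neg_one_pow (n : ℕ) : ‖(-1 : ℂ) ^ n‖ = 1 := by simp

theorem summable_phiTerm {q : ℂ} (hq : ‖q‖ < 1) : Summable (phiTerm q) := by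
  obtain ⟨K, hK⟩ := norm_qPoch_div_le (a := q) (b := -q) (by rwa [norm_neg]) (norm_sq_lt_one hq) hq
  refine Summable.of_norm ((summable_norm_pow_mul hq (K := K) (f := fun n => n ^ 2)
    (c := fun n => (-1) ^ n * (qPoch q (q ^ 2) n / qPoch (-q) q (2 * n)))
    (fun n => Nat.le_self_pow two_ne_zero n) fun n => ?_).congr fun n => ?_)
  · rw [norm_mul, norm_neg_one_pow, one_mul]; exact hK _ _
  · rw [phiTerm]; congr 1; ring

theorem summable_psiTerm {q : ℂ} (hq : ‖q‖ < 1) : Summable (psiTerm q) := by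
  obtain ⟨K, hK⟩ := norm_qPoch_div_le (a := q) (b := -q) (by rwa [norm_neg]) (norm_sq_lt_one hq) hq
  refine Summable.of_norm ((summable_norm_pow_mul hq (K := K) (f := fun n => (n + 1) ^ 2)
    (c := fun n => (-1) ^ n * (qPoch q (q ^ 2) n / qPoch (-q) q (2 * n + 1)))
    (fun n => by nlinarith) fun n => ?_).congr fun n => ?_)
  · rw [norm_mul, norm_neg_one_pow, one_mul]; exact hK _ _
  · rw [psiTerm]; congr 1; ring

theorem summable_rhoTerm {q : ℂ} (hq : ‖q‖ < 1) : Summable (rhoTerm q) := by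
  obtain ⟨K, hK⟩ := norm_qPoch_div_le (a := -q) hq hq (norm_sq_lt_one hq)
  refine Summable.of_norm ((summable_norm_pow_mul hq (K := K) (f := fun n => n * (n + 1) / 2)
    (c := fun n => qPoch (-q) q n / qPoch q (q ^ 2) (n + 1))
    (fun n => by rw [mul_succ_div_two]; exact le_choose_succ_two n)
    fun n => hK _ _).congr fun n => ?_)
  rw [rhoTerm, mul_div_assoc]

theorem summable_sigmaTerm {q : ℂ} (hq : ‖q‖ < 1) : Summable (sigmaTerm q) := by
  obtain ⟨K, hK⟩ := norm_qPoch_div_le (a := -q) hq hq (norm_sq_lt_one hq)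
  refine Summable.of_norm ((summable_norm_pow_mul hq (K := K) (f := fun n => (n + 1) * (n + 2) / 2)
    (c := fun n => qPoch (-q) q n / qPoch q (q ^ 2) (n + 1))
    (fun n => by rw [mul_succ_div_two (n + 1)]; exact (Nat.le_succ n).trans (le_choose_succ_two _))
    fun n => hK _ _).congr fun n => ?_)
  rw [sigmaTerm, mul_div_assoc]

theorem summable_lambdaTerm {q : ℂ} (hq : ‖q‖ < 1) : Summable (lambdaTerm q) := by
  obtain ⟨K, hK⟩ := norm_qPoch_div_le (a := q) (b := -q) (by rwa [norm_neg]) (norm_sq_lt_one hq) hq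
  refine Summable.of_norm ((summable_norm_pow_mul hq (K := K) (f := fun n => n)
    (c := fun n => (-1) ^ n * (qPoch q (q ^ 2) n / qPoch (-q) q n))
    (fun n => le_rfl) fun n => ?_).congr fun n => ?_)
  · rw [norm_mul, norm_neg_one_pow, one_mul]; exact hK _ _
  · rw [lambdaTerm, neg_pow]; congr 1; ring

/-! ### Hecke-type series -/

theorem qPochInf_zero (q : ℂ) : qPochInf 0 q = 1 := by simp [qPochInf]

/-- Bailey's lemma is stated for limits of partial sums, since μ is not summable; this passes to
`tsum` where summability is known. -/
theorem tsum_eq_of_tendsto_partial {f : ℕ → ℂ} (hf : Summable f) {g : ℕ → ℂ} {c s : ℂ}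
    (h : Tendsto (fun N => ∑ n ∈ Finset.range N, g n) atTop (𝓝 s)) (hfg : ∀ n, f n = c * g n) :
    ∑' n, f n = c * s := by
  refine tendsto_nhds_unique hf.hasSum.tendsto_sum_nat ((h.const_mul c).congr fun N => ?_)
  rw [Finset.mul_sum]
  exact Finset.sum_congr rfl fun n _ => (hfg n).symm

theorem tendsto_quadProd_one_right (w z : ℂ) (hz : z = 0) {q : ℂ} (hq : ‖q‖ < 1) :
    Tendsto (quadProd 1 w z q) atTop (𝓝 (qPochInf w q)) := by
  subst hz
  exact (tendsto_qPoch w hq).congr fun n => (quadProd_one_right w q n).symm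

theorem quadProd_rho (q : ℂ) (n : ℕ) :
    quadProd 0 (-q) (q ^ (1 + 1)) q n = q ^ ((n + 1).choose 2) * qPoch (-q) q n := by
  induction n with
  | zero => simp
  | succ n ih => rw [quadProd_succ, ih, choose_succ_two (n + 1), qPoch_succ]; ring

/-- Bailey's lemma with a = q and numerator parameters -q and ∞, that is z = 0 and w = aq/(-q) = -q.
The t = 0 of `baileyInv` corresponds to t = 1 in `bailey_limit`. -/
theorem rho_hecke {q : ℂ} (hq : ‖q‖ < 1) :
    rho q * qPochInf q q = qPochInf (-q) q *
      ∑' n : ℕ, q ^ (n * (n + 1)) * ((-1) ^ n * (2 * triSum q n - 1)) := by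
  have hpair := bailey_inversion hq 0 (fun j => (qPoch q (q ^ 2) (j + 1))⁻¹)
  simp only [add_zero, baileyInv_odd_zero hq] at hpair
  have hα : Summable fun r =>
      ‖(-1) ^ r * q ^ ((r + 1).choose 2) * (2 * triSum q r - 1)‖ := by
    refine (summable_norm_pow_mul hq (c := fun r => (-1) ^ r * (2 * triSum q r - 1))
      (K := 2 * (1 - ‖q‖)⁻¹ + 1) le_choose_succ_two fun r => ?_).congr fun r => ?_
    · rw [norm_mul, norm_neg_one_pow, one_mul]
      refine (norm_sub_le _ _).trans ?_
      rw [norm_mul, Complex.norm_ofNat, norm_one]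
      linarith [norm_triSum_le hq r]
    · congr 1; ring
  have hlim := bailey_limit (-q) hq (z := 0) (by simp) 1 hpair hα
    (tendsto_quadProd_one_right (-q) _ (mul_zero _) hq)
    (fun r => by rw [mul_zero, quadProd_one_right]; exact qPoch_neg_self_ne_zero hq r)
  rw [rho, tsum_eq_of_tendsto_partial (c := 1) (summable_rhoTerm hq) hlim, one_mul,
    ← tsum_mul_right, ← tsum_mul_left]
  · refine tsum_congr fun r => ?_
    have g1 := qPoch_neg_self_ne_zero hq r
    have g2 := qPochInf_ne_zero hq hq
    rw [mul_zero, quadProd_one_right, quadProd_rho, qPochInf_zero, ← choose_two_add_self, pow_add]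
    field_simp
  · intro n
    rw [quadProd_rho, rhoTerm, mul_succ_div_two, one_mul, div_eq_mul_inv]

theorem quadProd_sigma (q : ℂ) (n : ℕ) :
    q * quadProd 0 (-q ^ 2) (q ^ (2 + 1)) q n = q ^ ((n + 2).choose 2) * qPoch (-q) q n := by
  induction n with
  | zero => simp
  | succ n ih =>
    rw [quadProd_succ, ← mul_assoc, ih, choose_succ_two (n + 2), qPoch_succ]; ring

/-- The same parameters -q and ∞, now with a = q², so that w = -q². -/
theorem sigma_hecke {q : ℂ} (hq : ‖q‖ < 1) :
    sigma q * qPochInf q q = qPochInf (-q) q *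
      ∑' n : ℕ, q ^ ((n + 1) ^ 2) * ((-1) ^ n * (1 - q ^ (n + 1)) * triSum q n) := by
  have hpair := bailey_inversion hq 1 (fun j => (qPoch q (q ^ 2) (j + 1))⁻¹)
  simp only [baileyInv_odd_one hq] at hpair
  have hα : Summable fun r =>
      ‖(1 - q ^ (2 * r + 1 + 1)) * ((-1) ^ r * q ^ ((r + 1).choose 2) * triSum q r)‖ := by
    refine (summable_norm_pow_mul hq
      (c := fun r => (-1) ^ r * ((1 - q ^ (2 * r + 1 + 1)) * triSum q r))
      (K := 2 * (1 - ‖q‖)⁻¹) le_choose_succ_two fun r => ?_).congr fun r => ?_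
    · rw [norm_mul, norm_neg_one_pow, one_mul, norm_mul]
      have h := norm_sub_le 1 (q ^ (2 * r + 1 + 1))
      rw [norm_one] at h
      have := norm_pow_le_one hq (2 * r + 1 + 1)
      exact mul_le_mul (by linarith) (norm_triSum_le hq r) (norm_nonneg _) (by norm_num)
    · congr 1; ring
  have hq2 : ‖-q ^ 2‖ < 1 := by rw [norm_neg]; exact norm_sq_lt_one hq
  have hlim := bailey_limit (-q ^ 2) hq (z := 0) (by simp) 2 hpair hα
    (tendsto_quadProd_one_right (-q ^ 2) _ (mul_zero _) hq)
    (fun r => by rw [mul_zero, quadProd_one_right]; exact qPoch_ne_zero hq2 hq r)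
  rw [sigma, tsum_eq_of_tendsto_partial (c := q) (summable_sigmaTerm hq) hlim, ← tsum_mul_left,
    ← tsum_mul_right, ← tsum_mul_left]
  · refine tsum_congr fun r => ?_
    have g2 := qPochInf_ne_zero hq hq
    have g3 := qPoch_ne_zero hq2 hq r
    have g4 : 1 + q ≠ 0 := by simpa using one_add_pow_succ_ne_zero hq 0
    have g5 := one_add_pow_succ_ne_zero hq r
    have g6 := qPoch_neg_self_ne_zero hq r
    have e1 : qPochInf (-q) q = (1 + q) * qPochInf (-q ^ 2) q := by
      rw [qPochInf_succ (-q) hq]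
      congr 2 <;> ring
    have e2 : qPoch (-q ^ 2) q r = qPoch (-q) q r * (1 + q ^ (r + 1)) / (1 + q) := by
      have h := qPoch_succ (-q) q r
      rw [qPoch_succ'] at h
      have h3 : -q * q = -q ^ 2 := by ring
      rw [h3] at h
      rw [eq_div_iff g4]
      linear_combination h
    have e3 : (r + 1) ^ 2 = (r + 1).choose 2 + (r + 2).choose 2 := by
      have := choose_two_add_self r
      rw [choose_succ_two (r + 1)]
      linarith
    rw [mul_zero, quadProd_one_right, qPochInf_zero, e1, e3, e2, pow_add]
    calc _ = (1 - q ^ (2 * r + 1 + 1)) * ((-1) ^ r * q ^ (r + 1).choose 2 * triSum q r) *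
          ((q * quadProd 0 (-q ^ 2) (q ^ (2 + 1)) q r) /
            (qPoch (-q) q r * (1 + q ^ (r + 1)) / (1 + q)) *
          (qPochInf (-q ^ 2) q / (qPochInf q q * 1))) * qPochInf q q := by ring
      _ = _ := by
          rw [quadProd_sigma]
          field_simp
          ring
  · intro n
    rw [← mul_assoc, quadProd_sigma, sigmaTerm, mul_succ_div_two (n + 1), div_eq_mul_inv]

theorem quadProd_psi (q : ℂ) (n : ℕ) :
    quadProd 0 (q ^ 3) ((q ^ 2) ^ (1 + 1)) (q ^ 2) n =
      (-1) ^ n * q ^ (n ^ 2 + 2 * n) * qPoch q (q ^ 2) n := by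
  induction n with
  | zero => simp
  | succ n ih => rw [quadProd_succ, ih, qPoch_succ]; ring

theorem sq_pow_choose (q : ℂ) (n : ℕ) : (q ^ 2) ^ ((n + 1).choose 2) = q ^ (n ^ 2 + n) := by
  rw [← pow_mul]
  congr 1
  have := choose_two_add_self n
  linarith

theorem psi_pair {q : ℂ} (hq : ‖q‖ < 1) (n : ℕ) :
    ∑ r ∈ Finset.range (n + 1), ((1 - q ^ (2 * r + 1)) * ((-1) ^ r * q ^ (r ^ 2 + r) * sqSum q r)) /
      (qPoch (q ^ 2) (q ^ 2) (n - r) * qPoch (q ^ 2) (q ^ 2) (n + r + 1)) =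
      (qPoch (-q) q (2 * n + 1))⁻¹ := by
  rw [← bailey_inversion (norm_sq_lt_one hq) 0 (fun j => (qPoch (-q) q (2 * j + 1))⁻¹) n]
  refine Finset.sum_congr rfl fun r _ => ?_
  have h := baileyInv_neg_odd hq r
  rw [sq_pow_choose] at h
  rw [← h]
  simp only [add_zero]
  ring

theorem one_sub_pow_mul_norm_le {q : ℂ} (hq : ‖q‖ < 1) (r k : ℕ) :
    ‖(-1) ^ r * ((1 - q ^ k) * sqSum q r)‖ ≤ 2 * (2 * (1 - ‖q‖)⁻¹) := by
  rw [norm_mul, norm_neg_one_pow, one_mul, norm_mul]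
  have h := norm_sub_le 1 (q ^ k)
  rw [norm_one] at h
  have := norm_pow_le_one hq k
  exact mul_le_mul (by linarith) (norm_sqSum_le hq r) (norm_nonneg _) (by norm_num)

/-- Bailey's lemma in base q² with a = q² and numerator parameters q and ∞. -/
theorem psi_hecke {q : ℂ} (hq : ‖q‖ < 1) :
    psi q * qPochInf (q ^ 2) (q ^ 2) = qPochInf q (q ^ 2) *
      ∑' n : ℕ, q ^ (2 * n ^ 2 + 3 * n + 1) * sqSum q n := by
  have hq2 := norm_sq_lt_one hq
  have hα : Summable fun r =>
      ‖(1 - q ^ (2 * r + 1)) * ((-1) ^ r * q ^ (r ^ 2 + r) * sqSum q r)‖ := by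
    refine (summable_norm_pow_mul hq (f := fun r => r ^ 2 + r)
      (c := fun r => (-1) ^ r * ((1 - q ^ (2 * r + 1)) * sqSum q r))
      (fun r => by omega) fun r => one_sub_pow_mul_norm_le hq r _).congr fun r => ?_
    congr 1; ring
  have hq3 : ‖q ^ 3‖ < 1 := norm_pow_succ_lt_one hq 2
  have hlim := bailey_limit (q ^ 3) hq2 (z := 0) (by simp) 1 (psi_pair hq) hα
    (tendsto_quadProd_one_right (q ^ 3) _ (mul_zero _) hq2)
    (fun r => by rw [mul_zero, quadProd_one_right]; exact qPoch_ne_zero hq3 hq2 r)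
  rw [psi, tsum_eq_of_tendsto_partial (c := q) (summable_psiTerm hq) hlim, ← tsum_mul_left,
    ← tsum_mul_right, ← tsum_mul_left]
  · refine tsum_congr fun r => ?_
    have g2 := qPochInf_ne_zero hq2 hq2
    have g4 : 1 - q ≠ 0 := one_sub_ne_zero_of_norm_lt_one hq
    have g5 := one_sub_odd_pow_ne_zero hq r
    have g6 := qPoch_odd_ne_zero hq r
    have e1 : qPochInf q (q ^ 2) = (1 - q) * qPochInf (q ^ 3) (q ^ 2) := by
      rw [qPochInf_succ q hq2]
      congr 2; ring
    have e2 : qPoch (q ^ 3) (q ^ 2) r = qPoch q (q ^ 2) r * (1 - q ^ (2 * r + 1)) / (1 - q) := by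
      have h := qPoch_succ q (q ^ 2) r
      rw [qPoch_succ'] at h
      have h3 : q * q ^ 2 = q ^ 3 := by ring
      rw [h3] at h
      rw [eq_div_iff g4]
      linear_combination h
    have e3 : q ^ (2 * r ^ 2 + 3 * r + 1) = q * q ^ (r ^ 2 + r) * q ^ (r ^ 2 + 2 * r) := by ring
    have e4 : ((-1) ^ r * (-1) ^ r : ℂ) = 1 := by rw [← mul_pow]; simp
    rw [mul_zero, quadProd_one_right, qPochInf_zero, e1, e2, quadProd_psi, e3]
    field_simp
    linear_combination
      (q * q ^ (r * 3) * q ^ (r ^ 2 * 2) * sqSum q r * qPochInf (q ^ 3) (q ^ 2)) * e4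
  · intro n
    rw [quadProd_psi, psiTerm, div_eq_mul_inv]
    ring

theorem quadProd_phi (q : ℂ) (n : ℕ) :
    quadProd 0 q ((q ^ 2) ^ (0 + 1)) (q ^ 2) n = (-1) ^ n * q ^ (n ^ 2) * qPoch q (q ^ 2) n := by
  induction n with
  | zero => simp
  | succ n ih => rw [quadProd_succ, ih, qPoch_succ]; ring

/-- The `α`-part of a Bailey pair relative to `1` with bilateral symmetry. -/
noncomputable def shiftAlpha (q : ℂ) (A : ℕ → ℂ) : ℕ → ℂ
  | 0 => A 0
  | r + 1 => A (r + 1) - q ^ (2 * r + 1) * A r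

theorem phi_pair {q : ℂ} (hq : ‖q‖ < 1) (n : ℕ) :
    ∑ r ∈ Finset.range (n + 1), shiftAlpha q (fun r => (-1) ^ r * q ^ (r ^ 2 + r) * sqSum q r) r /
      (qPoch (q ^ 2) (q ^ 2) (n - r) * qPoch (q ^ 2) (q ^ 2) (n + r)) =
      (qPoch (-q) q (2 * n))⁻¹ := by
  rw [bailey_pair_shift (norm_sq_lt_one hq) (fun r => (-1) ^ r * q ^ (r ^ 2 + r) * sqSum q r)
    (fun r => q ^ (2 * r + 1)) _ rfl fun r => rfl]
  have h := psi_pair hq n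
  have g := qPoch_neg_self_ne_zero hq (2 * n + 1)
  rw [qPoch_succ] at g h
  obtain ⟨g1, g2⟩ := mul_ne_zero_iff.1 g
  have e : (qPoch (-q) q (2 * n))⁻¹ = (1 + q ^ (2 * n + 1)) *
      (qPoch (-q) q (2 * n) * (1 - -q * q ^ (2 * n)))⁻¹ := by
    have e' : 1 + q ^ (2 * n + 1) = 1 - -q * q ^ (2 * n) := by ring
    rw [e', mul_inv, mul_left_comm, mul_inv_cancel₀ g2, mul_one]
  -- Termwise, (1 - q^(2n+2r+2)) - q^(2r+1) (1 - q^(2n-2r)) = (1 + q^(2n+1)) (1 - q^(2r+1)).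
  rw [e, ← h, Finset.mul_sum]
  refine Finset.sum_congr rfl fun r hr => ?_
  obtain ⟨d, rfl⟩ : ∃ d, n = r + d := ⟨n - r, by simp at hr; omega⟩
  rw [Nat.add_sub_cancel_left]
  ring

theorem summable_norm_shiftAlpha {q : ℂ} (hq : ‖q‖ < 1) {A : ℕ → ℂ}
    (hA : Summable fun r => ‖A r‖) : Summable fun r => ‖shiftAlpha q A r‖ := by
  rw [← summable_nat_add_iff 1]
  refine Summable.of_nonneg_of_le (fun _ => norm_nonneg _) (fun r => ?_)
    (((summable_nat_add_iff 1).2 hA).add hA)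
  refine (norm_sub_le _ _).trans (add_le_add le_rfl ?_)
  rw [norm_mul]
  exact mul_le_of_le_one_left (norm_nonneg _) (norm_pow_le_one hq _)

/-- Summation of a shifted sequence against weights. -/
theorem tsum_shiftAlpha_mul {q : ℂ} (hq : ‖q‖ < 1) {A c : ℕ → ℂ} (hA : Summable fun r => ‖A r‖)
    (hc : ∀ r, ‖c r‖ ≤ 1) :
    ∑' r, shiftAlpha q A r * c r = ∑' r, A r * (c r - q ^ (2 * r + 1) * c (r + 1)) := by
  have s1 : Summable fun r => A r * c r := Summable.of_norm_bounded hA fun r => by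
    rw [norm_mul]; exact mul_le_of_le_one_right (norm_nonneg _) (hc r)
  have s2 : Summable fun r => A r * (q ^ (2 * r + 1) * c (r + 1)) :=
    Summable.of_norm_bounded hA fun r => by
      rw [norm_mul, norm_mul]
      exact mul_le_of_le_one_right (norm_nonneg _)
        (mul_le_one₀ (norm_pow_le_one hq _) (norm_nonneg _) (hc _))
  have s3 : Summable fun r => shiftAlpha q A r * c r :=
    Summable.of_norm_bounded (summable_norm_shiftAlpha hq hA) fun r => by
      rw [norm_mul]; exact mul_le_of_le_one_right (norm_nonneg _) (hc r)
  simp only [mul_sub]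
  rw [s1.tsum_sub s2, s3.tsum_eq_zero_add, s1.tsum_eq_zero_add, add_sub_assoc,
    ← ((summable_nat_add_iff 1).2 s1).tsum_sub s2]
  congr 1
  refine tsum_congr fun r => ?_
  simp only [shiftAlpha]
  ring

theorem summable_norm_sqSum {q : ℂ} (hq : ‖q‖ < 1) {f : ℕ → ℕ} (hf : ∀ n, n ≤ f n) :
    Summable fun r => ‖(-1) ^ r * q ^ f r * sqSum q r‖ := by
  refine (summable_norm_pow_mul hq hf (c := fun r => (-1) ^ r * sqSum q r)
    (K := 2 * (1 - ‖q‖)⁻¹) fun r => ?_).congr fun r => ?_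
  · rw [norm_mul, norm_neg_one_pow, one_mul]; exact norm_sqSum_le hq r
  · congr 1; ring

/-- Base q², a = 1, numerator parameters q and ∞. Summation by parts moves the difference in
`shiftAlpha` onto the weights, whence two powers of q. -/
theorem phi_hecke {q : ℂ} (hq : ‖q‖ < 1) :
    phi q * qPochInf (q ^ 2) (q ^ 2) = qPochInf q (q ^ 2) *
      ∑' n : ℕ, (q ^ (2 * n ^ 2 + n) + q ^ (2 * n ^ 2 + 5 * n + 2)) * sqSum q n := by
  have hq2 := norm_sq_lt_one hq
  have hA := summable_norm_sqSum hq (f := fun r => r ^ 2 + r) (fun r => by omega)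
  have hlim := bailey_limit q hq2 (z := 0) (by simp) 0 (phi_pair hq)
    (summable_norm_shiftAlpha hq hA)
    (tendsto_quadProd_one_right q _ (mul_zero _) hq2)
    (fun r => by rw [mul_zero, quadProd_one_right]; exact qPoch_odd_ne_zero hq r)
  have hval : ∀ r, quadProd 0 q ((q ^ 2) ^ (0 + 1)) (q ^ 2) r /
      quadProd 1 q ((q ^ 2) ^ (0 + 1) * 0) (q ^ 2) r = (-1) ^ r * q ^ (r ^ 2) := fun r => by
    rw [mul_zero, quadProd_one_right, quadProd_phi, mul_div_cancel_right₀ _ (qPoch_odd_ne_zero hq r)]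
  simp only [hval, ← mul_assoc] at hlim
  rw [phi, tsum_eq_of_tendsto_partial (c := 1) (summable_phiTerm hq) hlim, tsum_mul_right]
  · simp only [mul_assoc (shiftAlpha q _ _)]
    rw [tsum_shiftAlpha_mul hq hA]
    · have g2 := qPochInf_ne_zero hq2 hq2
      rw [qPochInf_zero]
      have e4 : ∀ r : ℕ, ((-1) ^ r * (-1) ^ r : ℂ) = 1 := fun r => by rw [← mul_pow]; simp
      have e : ∀ r : ℕ, (-1) ^ r * q ^ (r ^ 2 + r) * sqSum q r * ((-1) ^ r * q ^ r ^ 2 -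
          q ^ (2 * r + 1) * ((-1) ^ (r + 1) * q ^ (r + 1) ^ 2)) =
          (q ^ (2 * r ^ 2 + r) + q ^ (2 * r ^ 2 + 5 * r + 2)) * sqSum q r := fun r => by
        linear_combination
          ((q ^ (2 * r ^ 2 + r) + q ^ (2 * r ^ 2 + 5 * r + 2)) * sqSum q r) * e4 r
      simp only [e]
      field_simp
    · intro r
      rw [norm_mul, norm_neg_one_pow, one_mul]
      exact norm_pow_le_one hq _
  · intro n
    rw [quadProd_phi, phiTerm, one_mul, div_eq_mul_inv]

theorem quadProd_lambda (q : ℂ) (n : ℕ) :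
    quadProd (-q) 0 (q ^ (1 + 1)) q n = (-q) ^ n * qPoch q (q ^ 2) n := by
  induction n with
  | zero => simp
  | succ n ih => rw [quadProd_succ, ih, qPoch_succ]; ring

theorem lambda_pair {q : ℂ} (hq : ‖q‖ < 1) (n : ℕ) :
    ∑ r ∈ Finset.range (n + 1),
      ((1 - q ^ (2 * r + 1)) * ((-1) ^ r * q ^ ((r + 1).choose 2) * sqSum q r)) /
      (qPoch q q (n - r) * qPoch q q (n + r + 1)) = (qPoch (-q) q n)⁻¹ := by
  rw [← bailey_inversion hq 0 (fun j => (qPoch (-q) q j)⁻¹) n]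
  refine Finset.sum_congr rfl fun r _ => ?_
  rw [baileyInv_neg hq r]

/-- Here a = q and the numerator parameters are ±q^(1/2), of sum 0 and product -q; hence w = 0 and z
= -q. -/
theorem lambda_hecke {q : ℂ} (hq : ‖q‖ < 1) :
    lambda q * (qPochInf q q * qPochInf (-q) q) = qPochInf q (q ^ 2) *
      ∑' n : ℕ, q ^ ((n + 1).choose 2 + n) * sqSum q n := by
  have hq2 := norm_sq_lt_one hq
  have hnq : ‖-q‖ < 1 := by rwa [norm_neg]
  have hα : Summable fun r =>
      ‖(1 - q ^ (2 * r + 1)) * ((-1) ^ r * q ^ ((r + 1).choose 2) * sqSum q r)‖ := by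
    refine (summable_norm_pow_mul hq
      (c := fun r => (-1) ^ r * ((1 - q ^ (2 * r + 1)) * sqSum q r))
      le_choose_succ_two fun r => one_sub_pow_mul_norm_le hq r _).congr fun r => ?_
    congr 1; ring
  have hq3 : ‖q ^ 3‖ < 1 := norm_pow_succ_lt_one hq 2
  have hprod : ∀ r, quadProd 1 0 (q ^ (1 + 1) * -q) q r = qPoch (q ^ 3) (q ^ 2) r := fun r => by
    rw [quadProd_one_zero]
    congr 1; ring
  have hlim := bailey_limit 0 hq hnq 1 (lambda_pair hq) hα
    (L := qPochInf (q ^ 3) (q ^ 2))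
    ((tendsto_qPoch (q ^ 3) hq2).congr fun r => (hprod r).symm)
    (fun r => by rw [hprod]; exact qPoch_ne_zero hq3 hq2 r)
  simp only [hprod] at hlim
  rw [lambda, tsum_eq_of_tendsto_partial (c := 1) (summable_lambdaTerm hq) hlim, one_mul,
    ← tsum_mul_right, ← tsum_mul_left]
  · refine tsum_congr fun r => ?_
    have g1 := qPochInf_ne_zero hnq hq
    have g2 := qPochInf_ne_zero hq hq
    have g4 : 1 - q ≠ 0 := one_sub_ne_zero_of_norm_lt_one hq
    have g5 := one_sub_odd_pow_ne_zero hq r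
    have g6 := qPoch_odd_ne_zero hq r
    have e1 : qPochInf q (q ^ 2) = (1 - q) * qPochInf (q ^ 3) (q ^ 2) := by
      rw [qPochInf_succ q hq2]
      congr 2; ring
    have e2 : qPoch (q ^ 3) (q ^ 2) r = qPoch q (q ^ 2) r * (1 - q ^ (2 * r + 1)) / (1 - q) := by
      have h := qPoch_succ q (q ^ 2) r
      rw [qPoch_succ'] at h
      have h3 : q * q ^ 2 = q ^ 3 := by ring
      rw [h3] at h
      rw [eq_div_iff g4]
      linear_combination h
    have e4 : ((-1) ^ r * (-1) ^ r : ℂ) = 1 := by rw [← mul_pow]; simp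
    rw [e1, e2, quadProd_lambda, pow_add q ((r + 1).choose 2), neg_pow]
    field_simp
    linear_combination (q ^ r * q ^ (r + 1).choose 2 * sqSum q r * qPochInf (q ^ 3) (q ^ 2)) * e4
  · intro n
    rw [quadProd_lambda, lambdaTerm, one_mul, div_eq_mul_inv]

/-- The shift from a = q to a = 1 is exact since (1 - q^(n+r+1)) - q^(2r+1) (1 - q^(n-r)) = 1 -
q^(2r+1). -/
theorem mu_pair {q : ℂ} (hq : ‖q‖ < 1) (n : ℕ) :
    ∑ r ∈ Finset.range (n + 1),
      shiftAlpha q (fun r => (-1) ^ r * q ^ ((r + 1).choose 2) * sqSum q r) r /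
      (qPoch q q (n - r) * qPoch q q (n + r)) = (qPoch (-q) q n)⁻¹ := by
  rw [bailey_pair_shift hq (fun r => (-1) ^ r * q ^ ((r + 1).choose 2) * sqSum q r)
    (fun r => q ^ (2 * r + 1)) _ rfl fun r => rfl, ← lambda_pair hq n]
  refine Finset.sum_congr rfl fun r hr => ?_
  obtain ⟨d, rfl⟩ : ∃ d, n = r + d := ⟨n - r, by simp at hr; omega⟩
  rw [Nat.add_sub_cancel_left]
  ring

theorem muTerm_average_tendsto {q : ℂ} (hq : ‖q‖ < 1) :
    Tendsto (fun N => (∑ n ∈ Finset.range N, muTerm q n +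
      ∑ n ∈ Finset.range (N + 1), muTerm q n) / 2) atTop
      (𝓝 (qPochInf q (q ^ 2) / (2 * (qPochInf q q * qPochInf (-q) q)) *
        ∑' n : ℕ, (q ^ ((n + 1).choose 2) + q ^ ((n + 1).choose 2 + (2 * n + 1))) * sqSum q n)) := by
  have hA := summable_norm_sqSum hq le_choose_succ_two
  have h := bailey_limit_average hq (mu_pair hq) (summable_norm_shiftAlpha hq hA)
  simp only [← mul_assoc] at h
  rw [tsum_mul_right, tsum_shiftAlpha_mul hq hA (fun r => (norm_neg_one_pow r).le)] at h
  have e4 : ∀ r : ℕ, ((-1) ^ r * (-1) ^ r : ℂ) = 1 := fun r => by rw [← mul_pow]; simp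
  have e : ∀ r : ℕ, (-1) ^ r * q ^ ((r + 1).choose 2) * sqSum q r * ((-1) ^ r -
      q ^ (2 * r + 1) * (-1) ^ (r + 1)) =
      (q ^ ((r + 1).choose 2) + q ^ ((r + 1).choose 2 + (2 * r + 1))) * sqSum q r := fun r => by
    linear_combination
      ((q ^ ((r + 1).choose 2) + q ^ ((r + 1).choose 2 + (2 * r + 1))) * sqSum q r) * e4 r
  simp only [e] at h
  have e1 : qPochInf (-1) q = 2 * qPochInf (-q) q := by
    rw [qPochInf_succ (-1) hq]
    norm_num
  rw [e1, mul_comm] at h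
  have e2 : qPochInf q q * (2 * qPochInf (-q) q) = 2 * (qPochInf q q * qPochInf (-q) q) := by ring
  rw [e2] at h
  refine h.congr fun N => ?_
  simp only [muTerm, div_eq_mul_inv]

theorem mu_cesaro {q : ℂ} (hq : ‖q‖ < 1) :
    HasCesaroSum (muTerm q) (mu q) ∧ mu q * (2 * (qPochInf q q * qPochInf (-q) q)) =
      qPochInf q (q ^ 2) *
        ∑' n : ℕ, (q ^ ((n + 1).choose 2) + q ^ ((n + 1).choose 2 + (2 * n + 1))) * sqSum q n := by
  have hq2 := norm_sq_lt_one hq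
  have hnq : ‖-q‖ < 1 := by rwa [norm_neg]
  have hav := muTerm_average_tendsto hq
  set M := qPochInf q (q ^ 2) / (2 * (qPochInf q q * qPochInf (-q) q)) *
    ∑' n : ℕ, (q ^ ((n + 1).choose 2) + q ^ ((n + 1).choose 2 + (2 * n + 1))) * sqSum q n with hM
  have h2 : Tendsto (fun N : ℕ => 2 * N) atTop atTop := tendsto_id.const_mul_atTop' two_pos
  have hterm : Tendsto (fun N : ℕ => muTerm q (2 * N)) atTop
      (𝓝 (qPochInf q (q ^ 2) / qPochInf (-q) q)) := by
    have := ((tendsto_qPoch q hq2).div (tendsto_qPoch (-q) hq) (qPochInf_ne_zero hnq hq)).comp h2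
    refine this.congr fun N => ?_
    simp [muTerm, pow_mul]
  have hav2 := hav.comp h2
  -- The average of two consecutive partial sums is the first plus half a term, and the terms of
  -- even index converge.
  have he : Tendsto (fun N : ℕ => ∑ n ∈ Finset.range (2 * N), muTerm q n) atTop
      (𝓝 (M - qPochInf q (q ^ 2) / qPochInf (-q) q / 2)) := by
    refine (hav2.sub (hterm.div_const 2)).congr fun N => ?_
    simp only [Function.comp, Finset.sum_range_succ]
    ring
  have ho : Tendsto (fun N : ℕ => ∑ n ∈ Finset.range (2 * N + 1), muTerm q n) atTop
      (𝓝 (M + qPochInf q (q ^ 2) / qPochInf (-q) q / 2)) := by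
    refine (hav2.add (hterm.div_const 2)).congr fun N => ?_
    simp only [Function.comp, Finset.sum_range_succ]
    ring
  have hmu : mu q = M := by
    rw [mu, he.limUnder_eq, ho.limUnder_eq]
    ring
  refine ⟨⟨_, _, he, ho, ?_⟩, ?_⟩
  · rw [hmu]; ring
  · have g1 := qPochInf_ne_zero hnq hq
    have g2 := qPochInf_ne_zero hq hq
    rw [hmu, hM]
    field_simp

/-! ### Theta series and the triple product -/

/-- The triangular number `l (l - 1) / 2` of an integer. -/
def tri (l : ℤ) : ℤ := l * (l - 1) / 2

theorem two_mul_tri (l : ℤ) : 2 * tri l = l * (l - 1) :=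
  Int.mul_ediv_cancel' (Int.even_mul_pred_self l).two_dvd

theorem tri_add_one (l : ℤ) : tri (l + 1) = tri l + l := by
  have h1 := two_mul_tri l
  have h2 := two_mul_tri (l + 1)
  linarith

theorem tri_one_sub (l : ℤ) : tri (1 - l) = tri l := by
  have h1 := two_mul_tri l
  have h2 := two_mul_tri (1 - l)
  linarith

theorem tri_natCast (n : ℕ) : tri n = n.choose 2 := by
  induction n with
  | zero => rfl
  | succ n ih => rw [Nat.cast_succ, tri_add_one, ih, choose_succ_two]; push_cast; rfl

theorem summable_of_ratio_le_half {f : ℕ → ℂ} (h : ∀ᶠ n in atTop, ‖f (n + 1)‖ ≤ 1 / 2 * ‖f n‖) :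
    Summable fun n => ‖f n‖ :=
  (summable_of_ratio_norm_eventually_le (r := 1 / 2) (by norm_num) h).norm

/-- The weight is needed for Jacobi's cube (j = 1); the offset i = 1 serves the negative half of the
bilateral series. -/
theorem summable_norm_theta_nat {q : ℂ} (hq : ‖q‖ < 1) (u : ℂ) (i j : ℕ) :
    Summable fun n : ℕ => ‖((n + i : ℕ) : ℂ) ^ j * (q ^ (n.choose 2) * u ^ n)‖ := by
  have hlim : Tendsto (fun n : ℕ => q ^ n * u * 2 ^ j) atTop (𝓝 0) := by
    simpa using ((tendsto_pow_atTop_nhds_zero_of_norm_lt_one hq).mul_const u).mul_const (2 ^ j)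
  apply summable_of_ratio_le_half
  filter_upwards [(tendsto_zero_iff_norm_tendsto_zero.1 hlim).eventually_le_const
    (show (0 : ℝ) < 1 / 2 by norm_num), eventually_ge_atTop 1] with n hn hn1
  have e : ‖((n + 1 + i : ℕ) : ℂ)‖ ≤ 2 * ‖((n + i : ℕ) : ℂ)‖ := by
    rw [Complex.norm_natCast, Complex.norm_natCast]
    have : n + 1 + i ≤ 2 * (n + i) := by omega
    exact_mod_cast this
  rw [choose_succ_two, pow_add, pow_succ, norm_mul, norm_pow]
  generalize ((n + i : ℕ) : ℂ) = x at *
  generalize ((n + 1 + i : ℕ) : ℂ) = y at *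
  calc ‖y‖ ^ j * ‖q ^ n.choose 2 * q ^ n * (u ^ n * u)‖
      ≤ (2 * ‖x‖) ^ j * ‖q ^ n.choose 2 * q ^ n * (u ^ n * u)‖ := by gcongr
    _ = ‖q ^ n * u * 2 ^ j‖ * ‖x ^ j * (q ^ (n.choose 2) * u ^ n)‖ := by
        simp only [norm_mul, norm_pow, mul_pow, Complex.norm_ofNat]
        ring
    _ ≤ _ := by gcongr

theorem summable_norm_mul_theta {q : ℂ} (hq : ‖q‖ < 1) (u : ℂ) (j : ℕ) :
    Summable fun l : ℤ => ‖(l : ℂ) ^ j * (q ^ tri l * u ^ l)‖ := by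
  refine Summable.of_nat_of_neg_add_one ((summable_norm_theta_nat hq u 0 j).congr fun n => ?_)
    ((summable_norm_theta_nat hq (u⁻¹ * q ^ 2) 1 j).mul_right ‖u⁻¹ * q‖ |>.congr fun n => ?_)
  · rw [tri_natCast, zpow_natCast, zpow_natCast]
    simp
  · have h : tri (-((n : ℤ) + 1)) = (n.choose 2 + 2 * n + 1 : ℕ) := by
      have h1 := two_mul_tri (-((n : ℤ) + 1))
      have h2 := two_mul_tri n
      rw [tri_natCast] at h2
      push_cast
      linarith
    rw [h, zpow_natCast, zpow_neg, ← inv_zpow, ← Nat.cast_succ, zpow_natCast, ← norm_mul,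
      Nat.succ_eq_add_one, Int.cast_neg, Int.cast_natCast]
    generalize ((n + 1 : ℕ) : ℂ) = x
    simp only [norm_mul, norm_pow, norm_neg, pow_succ, pow_add, mul_pow, pow_mul]
    ring

/-- Induction by the q-Pascal rule, in the form 1 - q^(n+1) = (1 - q^(n+1-k)) + q^(n+1-k) (1 - q^k).
-/
theorem q_binomial {q : ℂ} (hq : ‖q‖ < 1) (x : ℂ) (n : ℕ) :
    ∑ k ∈ Finset.range (n + 1), (-x) ^ k * q ^ k.choose 2 / (qPoch q q k * qPoch q q (n - k)) =
      qPoch x q n / qPoch q q n := by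
  induction n with
  | zero => simp
  | succ n ih =>
    have hn := one_sub_pow_succ_ne_zero hq n
    have hp := qPoch_self_ne_zero hq
    set f : ℕ → ℕ → ℂ := fun n k =>
      (-x) ^ k * q ^ k.choose 2 / (qPoch q q k * qPoch q q (n - k)) with hf
    have h1 : ∀ k ∈ Finset.range (n + 1), (1 - q ^ (n + 1 - k)) * f (n + 1) k = f n k := by
      intro k hk
      have hk : k ≤ n := by simpa [Nat.lt_succ_iff] using hk
      have e : n + 1 - k = (n - k) + 1 := by omega
      simp only [hf, e, qPoch_self_succ q (n - k)]
      have := one_sub_pow_succ_ne_zero hq (n - k)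
      have h2 := hp k
      have h3 := hp (n - k)
      field_simp
    have h2 : ∀ k ∈ Finset.range (n + 1),
        q ^ (n + 1 - (k + 1)) * (1 - q ^ (k + 1)) * f (n + 1) (k + 1) = -x * q ^ n * f n k := by
      intro k hk
      have hk : k ≤ n := by simpa [Nat.lt_succ_iff] using hk
      have e : n + 1 - (k + 1) = n - k := by omega
      have e2 : q ^ n = q ^ (n - k) * q ^ k := by rw [← pow_add]; congr 1; omega
      simp only [hf, e, qPoch_self_succ q k, e2, choose_succ_two, pow_add _ (k.choose 2)]
      have := one_sub_pow_succ_ne_zero hq k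
      have h2 := hp k
      have h3 := hp (n - k)
      field_simp
      ring
    have h3 : (1 - q ^ (n + 1)) * ∑ k ∈ Finset.range (n + 2), f (n + 1) k =
        (1 - x * q ^ n) * ∑ k ∈ Finset.range (n + 1), f n k := by
      have : ∀ k ∈ Finset.range (n + 2), (1 - q ^ (n + 1)) * f (n + 1) k =
          (1 - q ^ (n + 1 - k)) * f (n + 1) k +
            q ^ (n + 1 - k) * (1 - q ^ k) * f (n + 1) k := by
        intro k hk
        have hk : k ≤ n + 1 := by simpa [Nat.lt_succ_iff] using hk
        have e2 : q ^ (n + 1) = q ^ (n + 1 - k) * q ^ k := by rw [← pow_add]; congr 1; omega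
        rw [e2]; ring
      rw [Finset.mul_sum, Finset.sum_congr rfl this, Finset.sum_add_distrib,
        Finset.sum_range_succ, Finset.sum_congr rfl h1, Finset.sum_range_succ' _ (n + 1),
        Finset.sum_congr rfl h2, ← Finset.mul_sum]
      simp
      ring
    rw [ih] at h3
    have h4 := hp n
    rw [qPoch_self_succ, qPoch_succ]
    apply mul_left_cancel₀ hn
    rw [h3]
    field_simp

theorem qPoch_div_pow {q u : ℂ} (hq0 : q ≠ 0) (hu : u ≠ 0) (N : ℕ) :
    qPoch (u / q ^ N) q N = (-u) ^ N / q ^ (N + 1).choose 2 * qPoch (q / u) q N := by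
  induction N with
  | zero => simp
  | succ N ih =>
    have e : u / q ^ (N + 1) * q = u / q ^ N := by rw [pow_succ]; field_simp
    rw [qPoch_succ', e, ih, qPoch_succ, choose_succ_two (N + 1), pow_add q]
    field_simp
    ring

/-- The q-binomial theorem of order 2N at x = u/q^N: half of the factors are reflected to (q/u;q)_N,
and recentring k at N makes the exponent triangular. -/
theorem finite_triple_product {q u : ℂ} (hq : ‖q‖ < 1) (hq0 : q ≠ 0) (hu : u ≠ 0) (N : ℕ) :
    ∑ k ∈ Finset.range (2 * N + 1), q ^ tri (k - N) * (-u) ^ ((k : ℤ) - N) /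
      (qPoch q q k * qPoch q q (2 * N - k)) =
      qPoch u q N * qPoch (q / u) q N / qPoch q q (2 * N) := by
  have h := q_binomial hq (u / q ^ N) (2 * N)
  rw [two_mul, qPoch_add, ← two_mul, div_mul_cancel₀ _ (pow_ne_zero _ hq0),
    qPoch_div_pow hq0 hu] at h
  have hu' : (-u) ≠ 0 := neg_ne_zero.2 hu
  have h2 : qPoch u q N * qPoch (q / u) q N / qPoch q q (2 * N) =
      q ^ (N + 1).choose 2 / (-u) ^ N * ((-u) ^ N / q ^ (N + 1).choose 2 * qPoch (q / u) q N *
        qPoch u q N / qPoch q q (2 * N)) := by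
    field_simp
  rw [h2, ← h, Finset.mul_sum]
  refine Finset.sum_congr rfl fun k _ => ?_
  have e : tri (k - N) = (N + 1).choose 2 + k.choose 2 - (N * k : ℕ) := by
    have h1 := two_mul_tri ((k : ℤ) - N)
    have h2 := two_mul_tri k
    have h3 := two_mul_tri (N + 1 : ℕ)
    rw [tri_natCast] at h2 h3
    push_cast at *
    linarith
  rw [e, zpow_sub₀ hq0, zpow_add₀ hq0, zpow_sub₀ hu']
  simp only [zpow_natCast]
  rw [← neg_div, div_pow, ← pow_mul]
  ring

/-- The reciprocal of `(q;q)_m`, with the value `0` for `m < 0`. -/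
noncomputable def qPochRecip (q : ℂ) (m : ℤ) : ℂ := if 0 ≤ m then (qPoch q q m.toNat)⁻¹ else 0

theorem norm_qPochRecip_le {q : ℂ} (hq : ‖q‖ < 1) : ∃ C : ℝ, 0 ≤ C ∧ ∀ m, ‖qPochRecip q m‖ ≤ C := by
  obtain ⟨C, hC⟩ : ∃ C : ℝ, ∀ n, ‖(qPoch q q n)⁻¹‖ ≤ C :=
    ⟨_, fun n => norm_qPoch_inv_le le_rfl hq hq n⟩
  refine ⟨C, (norm_nonneg _).trans (hC 0), fun m => ?_⟩
  unfold qPochRecip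
  split_ifs
  · exact hC _
  · rw [norm_zero]; exact (norm_nonneg _).trans (hC 0)

theorem tendsto_qPochRecip {q : ℂ} (hq : ‖q‖ < 1) :
    Tendsto (qPochRecip q) atTop (𝓝 (qPochInf q q)⁻¹) := by
  have h := ((tendsto_qPoch q hq).inv₀ (qPochInf_ne_zero hq hq)).comp (tendsto_atTop.2 fun n =>
    (eventually_ge_atTop (n : ℤ)).mono fun m hm => show n ≤ m.toNat by omega)
  refine h.congr' ?_
  filter_upwards [eventually_ge_atTop 0] with m hm
  simp [qPochRecip, hm]

/-- Extended by zero, the coefficients are bounded and each tends to 1/(q;q)_∞², so dominated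
convergence applies. -/
theorem tendsto_sum_div_qPoch {q : ℂ} (hq : ‖q‖ < 1) {x : ℤ → ℂ} (hx : Summable fun l => ‖x l‖) :
    Tendsto (fun N : ℕ => ∑ k ∈ Finset.range (2 * N + 1),
      x (k - N) / (qPoch q q k * qPoch q q (2 * N - k))) atTop
      (𝓝 ((∑' l, x l) / qPochInf q q ^ 2)) := by
  obtain ⟨C, hC0, hC⟩ := norm_qPochRecip_le hq
  have h1 : ∀ N : ℕ, ∑ k ∈ Finset.range (2 * N + 1),
      x (k - N) / (qPoch q q k * qPoch q q (2 * N - k)) =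
      ∑' l : ℤ, x l * (qPochRecip q (N + l) * qPochRecip q (N - l)) := by
    intro N
    rw [tsum_eq_sum (s := Finset.Icc (-(N : ℤ)) N)]
    · refine Finset.sum_bij (fun k _ => (k : ℤ) - N) ?_ ?_ ?_ ?_
      · intro k hk; simp at hk ⊢; omega
      · intro k _ k' _ h; simpa using h
      · intro l hl
        simp at hl
        exact ⟨(l + N).toNat, by simp; omega, by omega⟩
      · intro k hk
        simp at hk
        have e1 : (N : ℤ) + (k - N) = k := by ring
        have e2 : (N : ℤ) - (k - N) = (2 * N - k : ℕ) := by omega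
        rw [e1, e2, qPochRecip, qPochRecip, if_pos (by positivity), if_pos (by positivity),
          Int.toNat_natCast, Int.toNat_natCast, div_eq_mul_inv, mul_inv]
    · intro l hl
      have : ¬ (0 ≤ N + l ∧ 0 ≤ N - l) := by simp at hl ⊢; omega
      rw [not_and_or] at this
      rcases this with h | h <;> simp only [qPochRecip, if_neg h, zero_mul, mul_zero]
  simp_rw [h1]
  have h2 : (∑' l, x l) / qPochInf q q ^ 2 =
      ∑' l, x l * ((qPochInf q q)⁻¹ * (qPochInf q q)⁻¹) := by
    rw [tsum_mul_right, div_eq_mul_inv, sq, mul_inv]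
  rw [h2]
  refine tendsto_tsum_of_dominated_convergence (bound := fun l => ‖x l‖ * (C * C))
    (hx.mul_right _) (fun l => ?_) (Eventually.of_forall fun N l => ?_)
  · refine Tendsto.const_mul _ (Tendsto.mul ?_ ?_)
    · exact (tendsto_qPochRecip hq).comp
        (tendsto_atTop_add_const_right _ _ tendsto_natCast_atTop_atTop)
    · exact (tendsto_qPochRecip hq).comp
        (tendsto_atTop_add_const_right _ (-l) tendsto_natCast_atTop_atTop)
  · rw [norm_mul, norm_mul]
    gcongr
    · exact hC _
    · exact hC _

theorem tendsto_two_mul_atTop : Tendsto (fun N : ℕ => 2 * N) atTop atTop :=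
  tendsto_id.const_mul_atTop' (by norm_num)

/-- **Jacobi's triple product identity.** -/
theorem triple_product {q u : ℂ} (hq : ‖q‖ < 1) (hq0 : q ≠ 0) (hu : u ≠ 0) :
    ∑' l : ℤ, q ^ tri l * (-u) ^ l = qPochInf u q * qPochInf (q / u) q * qPochInf q q := by
  have hs : Summable fun l : ℤ => ‖q ^ tri l * (-u) ^ l‖ := by
    simpa using summable_norm_mul_theta hq (-u) 0
  have h1 := tendsto_sum_div_qPoch hq hs
  simp_rw [finite_triple_product hq hq0 hu] at h1
  have hI := qPochInf_ne_zero hq hq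
  have h2 := ((tendsto_qPoch u hq).mul (tendsto_qPoch (q / u) hq)).div
    ((tendsto_qPoch q hq).comp tendsto_two_mul_atTop) hI
  have h3 := tendsto_nhds_unique h1 h2
  rw [div_eq_div_iff (pow_ne_zero _ hI) hI] at h3
  apply mul_right_cancel₀ hI
  rw [h3]
  ring

/-- Differentiate the finite triple product at u = 1, where it has a simple zero from the factor 1 -
u; only continuity of the cofactor is needed. -/
theorem finite_jacobi {q : ℂ} (hq : ‖q‖ < 1) (hq0 : q ≠ 0) (N : ℕ) :
    ∑ k ∈ Finset.range (2 * (N + 1) + 1),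
      (((k : ℤ) - (N + 1 : ℕ) : ℤ) : ℂ) * (q ^ tri (k - (N + 1 : ℕ)) *
        (-1) ^ ((k : ℤ) - (N + 1 : ℕ))) / (qPoch q q k * qPoch q q (2 * (N + 1) - k)) =
      - (qPoch q q N * qPoch q q (N + 1) / qPoch q q (2 * (N + 1))) := by
  set g : ℂ → ℂ := fun u => qPoch (u * q) q N * qPoch (q / u) q (N + 1) / qPoch q q (2 * (N + 1))
  have hg : ContinuousAt g 1 := by
    have h0 := qPoch_self_ne_zero hq (2 * (N + 1))
    simp only [g, qPoch]
    simp only [qPoch] at h0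
    fun_prop (disch := simp_all)
  have h1 : HasDerivAt (fun u : ℂ => (1 - u) * g u) (- g 1) 1 := by
    rw [hasDerivAt_iff_tendsto_slope]
    refine (hg.tendsto.neg.mono_left nhdsWithin_le_nhds).congr' ?_
    filter_upwards [self_mem_nhdsWithin] with u hu
    have : u - 1 ≠ 0 := sub_ne_zero.2 hu
    rw [slope_def_field]
    field_simp
    ring
  have h2 : HasDerivAt (fun u : ℂ => ∑ k ∈ Finset.range (2 * (N + 1) + 1),
      (q ^ tri (k - (N + 1 : ℕ)) * (-1) ^ ((k : ℤ) - (N + 1 : ℕ)) /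
        (qPoch q q k * qPoch q q (2 * (N + 1) - k))) * u ^ ((k : ℤ) - (N + 1 : ℕ)))
      (∑ k ∈ Finset.range (2 * (N + 1) + 1),
      (q ^ tri (k - (N + 1 : ℕ)) * (-1) ^ ((k : ℤ) - (N + 1 : ℕ)) /
        (qPoch q q k * qPoch q q (2 * (N + 1) - k))) *
        ((((k : ℤ) - (N + 1 : ℕ) : ℤ) : ℂ) * (1 : ℂ) ^ ((k : ℤ) - (N + 1 : ℕ) - 1))) 1 :=
    HasDerivAt.fun_sum fun k _ => (hasDerivAt_zpow _ _ (Or.inl one_ne_zero)).const_mul _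
  have h3 : (fun u : ℂ => (1 - u) * g u) =ᶠ[𝓝 1] fun u : ℂ => ∑ k ∈ Finset.range (2 * (N + 1) + 1),
      (q ^ tri (k - (N + 1 : ℕ)) * (-1) ^ ((k : ℤ) - (N + 1 : ℕ)) /
        (qPoch q q k * qPoch q q (2 * (N + 1) - k))) * u ^ ((k : ℤ) - (N + 1 : ℕ)) := by
    filter_upwards [isOpen_ne.mem_nhds (one_ne_zero : (1 : ℂ) ≠ 0)] with u hu
    have h := finite_triple_product hq hq0 hu (N + 1)
    rw [qPoch_succ' u] at h
    simp only [g]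
    rw [← mul_div_assoc, ← mul_assoc, ← h]
    refine Finset.sum_congr rfl fun k _ => ?_
    rw [neg_eq_neg_one_mul u, mul_zpow]
    ring
  have h4 := (h2.congr_of_eventuallyEq h3).unique h1
  have h5 : g 1 = qPoch q q N * qPoch q q (N + 1) / qPoch q q (2 * (N + 1)) := by
    simp only [g, one_mul, div_one]
  rw [← h5, ← h4]
  refine Finset.sum_congr rfl fun k _ => ?_
  rw [one_zpow]
  ring

/-- **Jacobi's identity** for the cube of the Euler product. -/
theorem jacobi_cube {q : ℂ} (hq : ‖q‖ < 1) (hq0 : q ≠ 0) :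
    ∑' l : ℤ, (l : ℂ) * (q ^ tri l * (-1) ^ l) = - qPochInf q q ^ 3 := by
  have hs : Summable fun l : ℤ => ‖(l : ℂ) * (q ^ tri l * (-1) ^ l)‖ := by
    simpa using summable_norm_mul_theta hq (-1) 1
  have h1 := (tendsto_sum_div_qPoch hq hs).comp (tendsto_add_atTop_nat 1)
  have hI := qPochInf_ne_zero hq hq
  have h2 := (((tendsto_qPoch q hq).mul ((tendsto_qPoch q hq).comp (tendsto_add_atTop_nat 1))).div
    ((tendsto_qPoch q hq).comp (tendsto_two_mul_atTop.comp (tendsto_add_atTop_nat 1))) hI).neg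
  have h3 := tendsto_nhds_unique (h1.congr fun N => finite_jacobi hq hq0 N) h2
  rw [← neg_div, div_eq_div_iff (pow_ne_zero _ hI) hI] at h3
  apply mul_right_cancel₀ hI
  rw [h3]
  ring

/-! ### Partial theta series and their convolution with theta series -/

/-- The partial theta series `∑_{k ≥ 0} (-1)^k q^(k(k+1)+2km)`. -/
noncomputable def partTheta (q : ℂ) (m : ℕ) : ℂ :=
  ∑' k : ℕ, (-1) ^ k * q ^ (k * (k + 1) + 2 * k * m)

theorem norm_partTheta_term_le {q : ℂ} (hq : ‖q‖ < 1) (m k : ℕ) :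
    ‖(-1) ^ k * q ^ (k * (k + 1) + 2 * k * m)‖ ≤ ‖q‖ ^ k := by
  rw [norm_mul, norm_neg_one_pow, one_mul, norm_pow]
  exact pow_le_pow_of_le_one (norm_nonneg _) hq.le (by nlinarith [Nat.zero_le (k * k + 2 * k * m)])

theorem summable_partTheta {q : ℂ} (hq : ‖q‖ < 1) (m : ℕ) :
    Summable fun k : ℕ => (-1) ^ k * q ^ (k * (k + 1) + 2 * k * m) :=
  Summable.of_norm_bounded (summable_geometric_of_lt_one (norm_nonneg _) hq)
    (norm_partTheta_term_le hq m)

theorem norm_partTheta_le {q : ℂ} (hq : ‖q‖ < 1) (m : ℕ) :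
    ‖partTheta q m‖ ≤ (1 - ‖q‖)⁻¹ :=
  tsum_of_norm_bounded (hasSum_geometric_of_lt_one (norm_nonneg _) hq)
    (norm_partTheta_term_le hq m)

theorem partTheta_eq {q : ℂ} (hq : ‖q‖ < 1) (m : ℕ) :
    partTheta q m = 1 - q ^ (2 * m + 2) * partTheta q (m + 1) := by
  rw [partTheta, (summable_partTheta hq m).tsum_eq_zero_add, partTheta, ← tsum_mul_left,
    sub_eq_add_neg, ← tsum_neg]
  congr 1
  · simp
  · refine tsum_congr fun k => ?_
    ring

/-- The extension of `partTheta` to all integers determined by `partThetaInt_reflect`. -/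
noncomputable def partThetaInt (q : ℂ) : ℤ → ℂ
  | Int.ofNat n => partTheta q n
  | Int.negSucc n => 1 - partTheta q n

theorem partThetaInt_natCast (q : ℂ) (n : ℕ) : partThetaInt q n = partTheta q n := rfl

theorem partThetaInt_neg_succ (q : ℂ) (n : ℕ) : partThetaInt q (-(n + 1)) = 1 - partTheta q n := by
  rw [← Int.negSucc_eq]
  rfl

theorem partThetaInt_neg {q : ℂ} (hq : ‖q‖ < 1) (n : ℕ) :
    partThetaInt q (-n) = q ^ (2 * n) * partTheta q n := by
  cases n with
  | zero => simpa using partThetaInt_natCast q 0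
  | succ n => rw [Nat.cast_succ, partThetaInt_neg_succ, partTheta_eq hq n]; ring

theorem partThetaInt_reflect (q : ℂ) (m : ℤ) :
    partThetaInt q (-1 - m) = 1 - partThetaInt q m := by
  obtain ⟨n, rfl | rfl⟩ : ∃ n : ℕ, m = n ∨ m = -(n + 1) := by
    by_cases h : 0 ≤ m
    · exact ⟨m.toNat, Or.inl (by omega)⟩
    · exact ⟨(-m - 1).toNat, Or.inr (by omega)⟩
  · rw [partThetaInt_natCast, ← partThetaInt_neg_succ]
    congr 1
    ring
  · rw [partThetaInt_neg_succ, show (-1 - -((n : ℤ) + 1)) = n by ring, partThetaInt_natCast]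
    ring

/-- The reflection rule is compatible with the functional equation, which therefore holds on all
integers. -/
theorem partThetaInt_eq {q : ℂ} (hq : ‖q‖ < 1) (hq0 : q ≠ 0) (m : ℤ) :
    partThetaInt q m = 1 - q ^ (2 * m + 2) * partThetaInt q (m + 1) := by
  by_cases h : 0 ≤ m
  · obtain ⟨n, rfl⟩ := Int.eq_ofNat_of_zero_le h
    rw [← Nat.cast_succ, partThetaInt_natCast, partThetaInt_natCast, partTheta_eq hq]
    norm_cast
  · obtain ⟨n, rfl⟩ : ∃ n : ℕ, m = -(n + 1) := ⟨(-m - 1).toNat, by omega⟩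
    rw [partThetaInt_neg_succ, show -((n : ℤ) + 1) + 1 = -n by ring, partThetaInt_neg hq,
      ← mul_assoc, show 2 * (-((n : ℤ) + 1)) + 2 = -((2 * n : ℕ) : ℤ) by push_cast; ring, zpow_neg,
      zpow_natCast, inv_mul_cancel₀ (pow_ne_zero _ hq0), one_mul]

theorem exists_norm_partThetaInt_le {q : ℂ} (hq : ‖q‖ < 1) :
    ∃ C : ℝ, 0 ≤ C ∧ ∀ m, ‖partThetaInt q m‖ ≤ C := by
  have hC : 0 ≤ (1 - ‖q‖)⁻¹ := inv_nonneg.2 (sub_nonneg.2 hq.le)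
  refine ⟨1 + (1 - ‖q‖)⁻¹, by positivity, fun m => ?_⟩
  rcases m with n | n
  · exact (norm_partTheta_le hq n).trans (by linarith)
  · refine (norm_sub_le _ _).trans ?_
    rw [norm_one]
    linarith [norm_partTheta_le hq n]

theorem tendsto_partThetaInt {q : ℂ} (hq : ‖q‖ < 1) :
    Tendsto (fun n : ℕ => partThetaInt q n) atTop (𝓝 1) := by
  obtain ⟨C, hC0, hC⟩ := exists_norm_partThetaInt_le hq
  have h : Tendsto (fun n : ℕ => q ^ (2 * n + 2) * partTheta q (n + 1)) atTop (𝓝 0) := by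
    refine squeeze_zero_norm (fun n => ?_) (?_ : Tendsto (fun n : ℕ => ‖q‖ ^ n * C) atTop (𝓝 0))
    · rw [norm_mul, norm_pow]
      exact mul_le_mul (pow_le_pow_of_le_one (norm_nonneg _) hq.le (by omega))
        (hC (n + 1 : ℕ)) (norm_nonneg _) (by positivity)
    · simpa using (tendsto_pow_atTop_nhds_zero_of_lt_one (norm_nonneg q) hq).mul_const C
  have h2 := h.const_sub 1
  rw [sub_zero] at h2
  exact h2.congr fun n => by rw [partThetaInt_natCast, ← partTheta_eq hq]

theorem summable_norm_mul_bounded {f g : ℤ → ℂ} (hf : Summable fun l => ‖f l‖) {C : ℝ}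
    (hg : ∀ l, ‖g l‖ ≤ C) : Summable fun l => ‖f l * g l‖ := by
  refine Summable.of_nonneg_of_le (fun _ => norm_nonneg _) (fun l => ?_) (hf.mul_right C)
  rw [norm_mul]
  exact mul_le_mul_of_nonneg_left (hg l) (norm_nonneg _)

theorem tsum_comp_sub_right (f : ℤ → ℂ) (k : ℤ) : ∑' l, f (l - k) = ∑' l, f l :=
  (Equiv.subRight k).tsum_eq f

theorem tsum_comp_sub_left (f : ℤ → ℂ) (k : ℤ) : ∑' l, f (k - l) = ∑' l, f l :=
  (Equiv.subLeft k).tsum_eq f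

theorem summable_comp_sub_right {f : ℤ → ℂ} (hf : Summable f) (k : ℤ) :
    Summable fun l => f (l - k) :=
  hf.comp_injective (Equiv.subRight k).injective

theorem summable_comp_sub_left {f : ℤ → ℂ} (hf : Summable f) (k : ℤ) :
    Summable fun l => f (k - l) :=
  hf.comp_injective (Equiv.subLeft k).injective

/-- The general term of the theta series with signs `ε^l`. -/
noncomputable def thetaTerm (ε q : ℂ) (l : ℤ) : ℂ := q ^ tri l * ε ^ l

theorem summable_norm_thetaTerm (ε : ℂ) {q : ℂ} (hq : ‖q‖ < 1) :
    Summable fun l => ‖thetaTerm ε q l‖ := by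
  simpa [thetaTerm] using summable_norm_mul_theta hq ε 0

/-- The convolution of a theta series in `-q` with the partial theta series. -/
noncomputable def thetaConv (ε q : ℂ) (m : ℤ) : ℂ :=
  ∑' l : ℤ, thetaTerm ε (-q) l * partThetaInt q (m - l)

theorem summable_thetaConv (ε : ℂ) {q : ℂ} (hq : ‖q‖ < 1) (m : ℤ) :
    Summable fun l : ℤ => thetaTerm ε (-q) l * partThetaInt q (m - l) := by
  obtain ⟨C, -, hC⟩ := exists_norm_partThetaInt_le hq
  exact (summable_norm_mul_bounded (summable_norm_thetaTerm ε (by rwa [norm_neg]))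
    fun l => hC (m - l)).of_norm

theorem exists_norm_thetaConv_le (ε : ℂ) {q : ℂ} (hq : ‖q‖ < 1) :
    ∃ C : ℝ, ∀ m, ‖thetaConv ε q m‖ ≤ C := by
  obtain ⟨C, -, hC⟩ := exists_norm_partThetaInt_le hq
  have hs : Summable fun l => ‖thetaTerm ε (-q) l‖ * C :=
    (summable_norm_thetaTerm ε (by rwa [norm_neg])).mul_right C
  refine ⟨_, fun m => tsum_of_norm_bounded hs.hasSum fun l => ?_⟩
  rw [norm_mul]
  exact mul_le_mul_of_nonneg_left (hC _) (norm_nonneg _)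

/-- Apply the functional equation of `partThetaInt` in each term; its power of q completes the
triangular exponent to that of l - 2, and ε² = 1 absorbs the shift. -/
theorem thetaConv_eq {ε q : ℂ} (hε : ε ^ 2 = 1) (hq : ‖q‖ < 1) (hq0 : q ≠ 0) (m : ℤ) :
    thetaConv ε q m =
      ∑' l, thetaTerm ε (-q) l - (-q) ^ (2 * m - 1) * thetaConv ε q (m - 1) := by
  have hε0 : ε ≠ 0 := by rintro rfl; norm_num at hε
  have hs := (summable_norm_thetaTerm ε (q := -q) (by rwa [norm_neg])).of_norm
  have h := tsum_comp_sub_right (fun l => thetaTerm ε (-q) l * partThetaInt q (m - 1 - l)) 2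
  have hs2 := summable_comp_sub_right (summable_thetaConv ε hq (m - 1)) 2
  rw [thetaConv, thetaConv, ← h, ← tsum_mul_left, ← hs.tsum_sub (hs2.mul_left _)]
  refine tsum_congr fun l => ?_
  have e1 : tri l + 2 * (m - l) + 2 = 2 * m - 1 + tri (l - 2) := by
    have h1 := two_mul_tri l
    have h2 := two_mul_tri (l - 2)
    linarith
  have e2 : q ^ (2 * (m - l) + 2) = (-q) ^ (2 * (m - l) + 2) := by
    rw [Even.neg_zpow (by simp [parity_simps])]
  rw [partThetaInt_eq hq hq0 (m - l), show m - l + 1 = m - 1 - (l - 2) by ring, e2, thetaTerm,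
    thetaTerm, zpow_sub₀ hε0 l 2, zpow_ofNat, hε, div_one]
  have hq' : -q ≠ 0 := neg_ne_zero.2 hq0
  have e3 : (-q) ^ tri l * (-q) ^ (2 * (m - l) + 2) = (-q) ^ (2 * m - 1) * (-q) ^ tri (l - 2) := by
    rw [← zpow_add₀ hq', ← zpow_add₀ hq', ← e1]
    ring_nf
  linear_combination (-ε ^ l * partThetaInt q (m - 1 - (l - 2))) * e3

/-! #### Trivial signs -/

/-- The substitution l ↦ 1 - l fixes the theta term and triggers the reflection rule. At m = 0 this
gives the initial value, half the theta series. -/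
theorem thetaConv_one_neg {q : ℂ} (hq : ‖q‖ < 1) (m : ℤ) :
    thetaConv 1 q (-m) = ∑' l, thetaTerm 1 (-q) l - thetaConv 1 q m := by
  have hs := (summable_norm_thetaTerm 1 (q := -q) (by rwa [norm_neg])).of_norm
  have h := tsum_comp_sub_left (fun l => thetaTerm 1 (-q) l * partThetaInt q (m - l)) 1
  have hs2 := summable_comp_sub_left (summable_thetaConv 1 hq m) 1
  rw [thetaConv, thetaConv, ← h, ← hs.tsum_sub hs2]
  refine tsum_congr fun l => ?_
  rw [show -m - l = -1 - (m - (1 - l)) by ring, partThetaInt_reflect, thetaTerm, thetaTerm,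
    tri_one_sub, one_zpow, one_zpow]
  ring

theorem thetaConv_one_natCast {q : ℂ} (hq : ‖q‖ < 1) (hq0 : q ≠ 0) (n : ℕ) :
    thetaConv 1 q n = (∑' l, thetaTerm 1 (-q) l) / 2 * sqSum (-q) n := by
  induction n with
  | zero =>
    have h := thetaConv_one_neg hq 0
    rw [neg_zero] at h
    rw [sqSum, Nat.cast_zero]
    linear_combination h / 2
  | succ n ih =>
    rw [Nat.cast_succ, thetaConv_eq (one_pow 2) hq hq0, add_sub_cancel_right, ih, sqSum,
      show 2 * ((n : ℤ) + 1) - 1 = (2 * n + 1 : ℕ) by push_cast; ring, zpow_natCast]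
    ring

theorem thetaConv_one_neg_succ {q : ℂ} (hq : ‖q‖ < 1) (hq0 : q ≠ 0) (n : ℕ) :
    thetaConv 1 q (-(n + 1)) =
      (∑' l, thetaTerm 1 (-q) l) / 2 * ((-q) ^ (2 * n + 1) * sqSum (-q) n) := by
  rw [thetaConv_one_neg hq, ← Nat.cast_succ, thetaConv_one_natCast hq hq0, sqSum]
  ring

/-! #### Alternating signs -/

theorem tsum_thetaTerm_neg_one (q : ℂ) : ∑' l, thetaTerm (-1) q l = 0 := by
  have h := tsum_comp_sub_left (thetaTerm (-1) q) 1
  have h2 : ∀ l, thetaTerm (-1) q (1 - l) = - thetaTerm (-1) q l := by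
    intro l
    rw [thetaTerm, thetaTerm, tri_one_sub, zpow_sub₀ (by norm_num), zpow_one,
      div_eq_mul_inv, ← zpow_neg, zpow_neg, ← inv_zpow, inv_neg, inv_one]
    ring
  simp_rw [h2, tsum_neg] at h
  linear_combination -h / 2

/-- The alternating theta series vanishes, so the recurrence is homogeneous with ratio q^(2m-1). -/
theorem thetaConv_neg_one {q : ℂ} (hq : ‖q‖ < 1) (hq0 : q ≠ 0) (m : ℤ) :
    thetaConv (-1) q m = thetaConv (-1) q 0 * q ^ (m ^ 2) := by
  have h : ∀ m, thetaConv (-1) q m = q ^ (2 * m - 1) * thetaConv (-1) q (m - 1) := by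
    intro m
    rw [thetaConv_eq (by norm_num) hq hq0, tsum_thetaTerm_neg_one,
      Odd.neg_zpow (⟨m - 1, by ring⟩ : Odd (2 * m - 1))]
    ring
  induction m using Int.induction_on with
  | zero => simp
  | succ n ih =>
    rw [h, add_sub_cancel_right, ih, mul_left_comm, ← zpow_add₀ hq0]
    ring_nf
  | pred n ih =>
    have h1 := h (-n)
    rw [ih] at h1
    have h2 : q ^ (2 * (-(n : ℤ)) - 1) ≠ 0 := zpow_ne_zero _ hq0
    apply mul_left_cancel₀ h2
    rw [← h1, mul_left_comm, ← zpow_add₀ hq0]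
    ring_nf

/-! ### The constant in the alternating convolution. -/

theorem tendsto_sum_range_sub {f : ℤ → ℂ} (hf : Summable f) :
    Tendsto (fun M : ℕ => ∑ j ∈ Finset.range (2 * M), f (j - M)) atTop (𝓝 (∑' m, f m)) := by
  have h1 : Summable fun n : ℕ => f n := hf.comp_injective Nat.cast_injective
  have h2 : Summable fun n : ℕ => f (-(n + 1)) :=
    hf.comp_injective (i := fun n : ℕ => (-(n + 1) : ℤ)) fun a b h => by simpa using h
  rw [tsum_of_nat_of_neg_add_one h1 h2]
  refine (h1.hasSum.tendsto_sum_nat.add h2.hasSum.tendsto_sum_nat).congr fun M => ?_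
  rw [two_mul, Finset.sum_range_add, add_comm, ← Finset.sum_range_reflect]
  congr 1
  · refine Finset.sum_congr rfl fun j hj => ?_
    have := Finset.mem_range.1 hj
    congr 1
    omega
  · refine Finset.sum_congr rfl fun j _ => ?_
    congr 1
    push_cast
    ring

/-- The symmetric partial sums of the shifts of `partThetaInt`, normalised to vanish at `l = 0`. -/
noncomputable def partThetaSum (q : ℂ) (M : ℕ) (l : ℤ) : ℂ :=
  ∑ j ∈ Finset.range (2 * M), partThetaInt q (j - M - l) - M

/-- The window -M ≤ m < M is stable under m ↦ -1 - m, which exchanges each value with its complement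
to 1. -/
theorem partThetaSum_zero (q : ℂ) (M : ℕ) : partThetaSum q M 0 = 0 := by
  have h : ∑ j ∈ Finset.range (2 * M), partThetaInt q (j - M) =
      ∑ j ∈ Finset.range (2 * M), (1 - partThetaInt q (j - M)) := by
    rw [← Finset.sum_range_reflect]
    refine Finset.sum_congr rfl fun j hj => ?_
    have := Finset.mem_range.1 hj
    rw [← partThetaInt_reflect]
    congr 1
    omega
  rw [Finset.sum_sub_distrib] at h
  simp only [Finset.sum_const, Finset.card_range, nsmul_eq_mul, Nat.cast_mul, Nat.cast_ofNat,
    mul_one] at h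
  simp only [partThetaSum, sub_zero]
  linear_combination h / 2

theorem partThetaSum_add_one (q : ℂ) (M : ℕ) (l : ℤ) :
    partThetaSum q M (l + 1) =
      partThetaSum q M l + (partThetaInt q (-1 - M - l) - partThetaInt q (M - 1 - l)) := by
  have h := Finset.sum_range_sub' (fun j : ℕ => partThetaInt q (j - M - (l + 1))) (2 * M)
  rw [Finset.sum_sub_distrib] at h
  have e : ∀ j : ℕ, ((j + 1 : ℕ) : ℤ) - M - (l + 1) = j - M - l := fun j => by push_cast; ring
  simp only [e] at h
  rw [show ((0 : ℕ) : ℤ) - M - (l + 1) = -1 - M - l by push_cast; ring,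
    show ((2 * M : ℕ) : ℤ) - M - (l + 1) = M - 1 - l by push_cast; ring] at h
  rw [partThetaSum, partThetaSum, ← h]
  ring

theorem tendsto_partThetaInt_shift {q : ℂ} (hq : ‖q‖ < 1) (l : ℤ) :
    Tendsto (fun M : ℕ => partThetaInt q (-1 - M - l) - partThetaInt q (M - 1 - l)) atTop
      (𝓝 (-1)) := by
  have h : ∀ k : ℤ, Tendsto (fun M : ℕ => partThetaInt q (M + k)) atTop (𝓝 1) := by
    intro k
    have h1 : Tendsto (fun M : ℕ => ((M : ℤ) + k).toNat) atTop atTop :=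
      tendsto_atTop.2 fun n => (eventually_ge_atTop (n + k.natAbs)).mono fun m hm => by omega
    refine ((tendsto_partThetaInt hq).comp h1).congr' ?_
    filter_upwards [eventually_ge_atTop k.natAbs] with M hM
    simp only [Function.comp]
    congr 1
    omega
  have h2 := ((h l).const_sub 1).sub (h (-1 - l))
  rw [sub_self, zero_sub] at h2
  refine h2.congr fun M => ?_
  rw [← partThetaInt_reflect, show -1 - ((M : ℤ) + l) = -1 - M - l by ring,
    show (M : ℤ) + (-1 - l) = M - 1 - l by ring]

/-- Raising l by one adds a value near -M and drops one near M, and `partThetaInt` tends to 0 and 1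
there. -/
theorem tendsto_partThetaSum {q : ℂ} (hq : ‖q‖ < 1) (l : ℤ) :
    Tendsto (fun M : ℕ => partThetaSum q M l) atTop (𝓝 (-l)) := by
  induction l using Int.induction_on with
  | zero => simp [partThetaSum_zero]
  | succ n ih =>
    have h := ih.add (tendsto_partThetaInt_shift hq n)
    refine (h.congr fun M => (partThetaSum_add_one q M n).symm).trans_eq ?_
    push_cast
    ring_nf
  | pred n ih =>
    have h := ih.sub (tendsto_partThetaInt_shift hq (-n - 1))
    refine (h.congr fun M => ?_).trans_eq ?_
    · have := partThetaSum_add_one q M (-n - 1)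
      rw [sub_add_cancel] at this
      rw [this]
      ring
    · push_cast
      ring_nf

theorem norm_partThetaSum_le {q : ℂ} {C : ℝ} (hC : ∀ m, ‖partThetaInt q m‖ ≤ C)
    (M : ℕ) (l : ℤ) : ‖partThetaSum q M l‖ ≤ ‖(l : ℂ)‖ * (2 * C) := by
  have hd : ∀ l : ℤ, ‖partThetaInt q (-1 - M - l) - partThetaInt q (M - 1 - l)‖ ≤ 2 * C := by
    intro l
    refine (norm_sub_le _ _).trans ?_
    linarith [hC (-1 - M - l), hC (M - 1 - l)]
  have h1 : ∀ n : ℕ, ‖partThetaSum q M n‖ ≤ n * (2 * C) := by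
    intro n
    induction n with
    | zero => simp [partThetaSum_zero]
    | succ n ih =>
      rw [Nat.cast_succ, partThetaSum_add_one]
      refine (norm_add_le _ _).trans ?_
      push_cast
      linarith [hd n]
  have h2 : ∀ n : ℕ, ‖partThetaSum q M (-n)‖ ≤ n * (2 * C) := by
    intro n
    induction n with
    | zero => simp [partThetaSum_zero]
    | succ n ih =>
      have h := partThetaSum_add_one q M (-(n + 1))
      rw [show (-((n : ℤ) + 1) + 1) = -n by ring] at h
      rw [Nat.cast_succ, ← sub_eq_of_eq_add h]
      refine (norm_sub_le _ _).trans ?_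
      push_cast
      linarith [hd (-(n + 1))]
  rcases Int.eq_nat_or_neg l with ⟨n, rfl | rfl⟩
  · simpa using h1 n
  · simpa using h2 n

theorem summable_zpow_sq {q : ℂ} (hq : ‖q‖ < 1) (hq0 : q ≠ 0) :
    Summable fun m : ℤ => q ^ (m ^ 2) := by
  have h := (summable_norm_thetaTerm q (norm_sq_lt_one hq)).of_norm
  refine h.congr fun m => ?_
  rw [thetaTerm, ← zpow_natCast q 2, ← zpow_mul, ← zpow_add₀ hq0]
  congr 1
  have := two_mul_tri m
  push_cast
  linarith

/-- Sum the convolution over a symmetric window of m. One evaluation gives the constant times Σ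
q^(m²); exchanging sums gives in the limit the theta terms weighted by -l, which is Jacobi's cube.
-/
theorem thetaConv_neg_one_zero_mul {q : ℂ} (hq : ‖q‖ < 1) (hq0 : q ≠ 0) :
    thetaConv (-1) q 0 * ∑' m : ℤ, q ^ (m ^ 2) = qPochInf (-q) (-q) ^ 3 := by
  have hq' : ‖-q‖ < 1 := by rwa [norm_neg]
  obtain ⟨C, -, hC⟩ := exists_norm_partThetaInt_le hq
  have hs := (summable_norm_thetaTerm (-1) hq').of_norm
  have h1 : Tendsto (fun M : ℕ => ∑' l : ℤ, thetaTerm (-1) (-q) l * partThetaSum q M l) atTop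
      (𝓝 (∑' l : ℤ, thetaTerm (-1) (-q) l * -l)) := by
    refine tendsto_tsum_of_dominated_convergence
      (bound := fun l : ℤ => ‖(l : ℂ) ^ 1 * ((-q) ^ tri l * (-1) ^ l)‖ * (2 * C))
      ((summable_norm_mul_theta hq' (-1) 1).mul_right _)
      (fun l => (tendsto_partThetaSum hq l).const_mul _) (Eventually.of_forall fun M l => ?_)
    rw [norm_mul, norm_mul, pow_one, thetaTerm, mul_comm ‖(l : ℂ)‖, mul_assoc]
    exact mul_le_mul_of_nonneg_left (norm_partThetaSum_le hC M l) (norm_nonneg _)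
  have h2 : ∀ M : ℕ, ∑' l : ℤ, thetaTerm (-1) (-q) l * partThetaSum q M l =
      thetaConv (-1) q 0 * ∑ j ∈ Finset.range (2 * M), q ^ (((j : ℤ) - M) ^ 2) := by
    intro M
    -- The normalising M costs nothing because the alternating theta series sums to zero.
    have e : ∀ l : ℤ, thetaTerm (-1) (-q) l * partThetaSum q M l =
        ∑ j ∈ Finset.range (2 * M), thetaTerm (-1) (-q) l * partThetaInt q (j - M - l) -
          thetaTerm (-1) (-q) l * M := by
      intro l
      rw [partThetaSum, mul_sub, Finset.mul_sum]
    simp_rw [e]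
    rw [Summable.tsum_sub (summable_sum fun j _ => summable_thetaConv (-1) hq _) (hs.mul_right _),
      Summable.tsum_finsetSum fun j _ => summable_thetaConv (-1) hq _, tsum_mul_right,
      tsum_thetaTerm_neg_one, zero_mul, sub_zero, Finset.mul_sum]
    exact Finset.sum_congr rfl fun j _ => thetaConv_neg_one hq hq0 _
  simp_rw [h2] at h1
  have h3 := tendsto_nhds_unique h1
    ((tendsto_sum_range_sub (summable_zpow_sq hq hq0)).const_mul (thetaConv (-1) q 0))
  rw [← h3, ← neg_eq_iff_eq_neg.2 (jacobi_cube hq' (neg_ne_zero.2 hq0)), ← tsum_neg]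
  refine tsum_congr fun l => ?_
  rw [thetaTerm]
  ring

/-! ### Squares of theta series -/

theorem tsum_prod_parity {F : ℤ × ℤ → ℂ} (hF : Summable F) :
    ∑' x, F x = ∑' x : ℤ × ℤ, F (x.1 + x.2, x.1 - x.2) +
      ∑' x : ℤ × ℤ, F (x.1 + x.2, x.1 + 1 - x.2) := by
  have h1 : Function.Injective fun x : ℤ × ℤ => (x.1 + x.2, x.1 - x.2) := by
    rintro ⟨a, b⟩ ⟨c, d⟩ h
    simp only [Prod.mk.injEq] at h ⊢
    omega
  have h2 : Function.Injective fun x : ℤ × ℤ => (x.1 + x.2, x.1 + 1 - x.2) := by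
    rintro ⟨a, b⟩ ⟨c, d⟩ h
    simp only [Prod.mk.injEq] at h ⊢
    omega
  refine (HasSum.add_isCompl ?_ (h1.hasSum_range_iff.2 (hF.comp_injective h1).hasSum)
    (h2.hasSum_range_iff.2 (hF.comp_injective h2).hasSum)).tsum_eq
  refine ⟨Set.disjoint_left.2 ?_, codisjoint_iff_le_sup.2 ?_⟩
  · rintro _ ⟨⟨a, b⟩, rfl⟩ ⟨⟨c, d⟩, h⟩
    simp only [Prod.mk.injEq] at h
    omega
  · rintro ⟨i, j⟩ -
    rcases Int.emod_two_eq_zero_or_one (i + j) with h | h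
    · refine Or.inl ⟨((i + j) / 2, (i - j) / 2), ?_⟩
      simp only [Prod.mk.injEq]
      omega
    · refine Or.inr ⟨((i + j) / 2, i - (i + j) / 2), ?_⟩
      simp only [Prod.mk.injEq]
      omega

theorem sq_zpow_eq (q : ℂ) (m : ℤ) : (q ^ 2) ^ m = (-q) ^ (2 * m) := by
  rw [zpow_mul, zpow_ofNat, neg_sq]

/-- The triangular numbers of l + s and l - s add up to l(l-1) + s², which separates l from s. -/
theorem thetaTerm_mul_even {ε q : ℂ} (hε : ε ^ 2 = 1) (hq0 : q ≠ 0) (l s : ℤ) :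
    thetaTerm ε (-q) (l + s) * thetaTerm ε (-q) (l - s) =
      thetaTerm 1 (q ^ 2) l * thetaTerm (-q) (q ^ 2) s := by
  have hε0 : ε ≠ 0 := by rintro rfl; norm_num at hε
  have hq' : -q ≠ 0 := neg_ne_zero.2 hq0
  have e1 : ε ^ (l + s) * ε ^ (l - s) = 1 := by
    rw [← zpow_add₀ hε0, show l + s + (l - s) = 2 * l by ring, zpow_mul, zpow_ofNat, hε, one_zpow]
  have e2 : (-q) ^ tri (l + s) * (-q) ^ tri (l - s) =
      (-q) ^ (2 * tri l) * ((-q) ^ (2 * tri s) * (-q) ^ s) := by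
    rw [← zpow_add₀ hq', ← zpow_add₀ hq', ← zpow_add₀ hq']
    congr 1
    have h1 := two_mul_tri l
    have h2 := two_mul_tri s
    have h3 := two_mul_tri (l + s)
    have h4 := two_mul_tri (l - s)
    linarith
  simp only [thetaTerm, sq_zpow_eq, one_zpow]
  linear_combination (-q) ^ tri (l + s) * (-q) ^ tri (l - s) * e1 + e2

theorem thetaTerm_mul_odd {ε q : ℂ} (hε : ε ^ 2 = 1) (hq0 : q ≠ 0) (l s : ℤ) :
    thetaTerm ε (-q) (l + s) * thetaTerm ε (-q) (l + 1 - s) =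
      ε * (thetaTerm (-q) (q ^ 2) l * thetaTerm 1 (q ^ 2) s) := by
  have hε0 : ε ≠ 0 := by rintro rfl; norm_num at hε
  have hq' : -q ≠ 0 := neg_ne_zero.2 hq0
  have e1 : ε ^ (l + s) * ε ^ (l + 1 - s) = ε := by
    rw [← zpow_add₀ hε0, show l + s + (l + 1 - s) = 2 * l + 1 by ring, zpow_add₀ hε0, zpow_mul,
      zpow_ofNat, hε, one_zpow, one_mul, zpow_one]
  have e2 : (-q) ^ tri (l + s) * (-q) ^ tri (l + 1 - s) =
      (-q) ^ (2 * tri l) * (-q) ^ l * (-q) ^ (2 * tri s) := by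
    rw [← zpow_add₀ hq', ← zpow_add₀ hq', ← zpow_add₀ hq']
    congr 1
    have h1 := two_mul_tri l
    have h2 := two_mul_tri s
    have h3 := two_mul_tri (l + s)
    have h4 := two_mul_tri (l + 1 - s)
    linarith
  simp only [thetaTerm, sq_zpow_eq, one_zpow]
  linear_combination (-q) ^ tri (l + s) * (-q) ^ tri (l + 1 - s) * e1 + ε * e2

theorem tsum_prod_mul_shift {f g : ℤ → ℂ} {a : ℤ → ℂ} (hf : Summable fun l => ‖f l‖)
    (hg : Summable fun l => ‖g l‖) {C : ℝ} (ha : ∀ l, ‖a l‖ ≤ C) :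
    ∑' x : ℤ × ℤ, f x.1 * g x.2 * a x.1 = (∑' s, g s) * ∑' l, f l * a l := by
  rw [mul_comm, tsum_mul_tsum_of_summable_norm (summable_norm_mul_bounded hf ha) hg]
  exact tsum_congr fun x => by ring

/-- Associativity of the convolution θ * θ * P. The argument of P depends only on i + j, equal to 2l
or 2l + 1, so within each parity class the sum over s factors out as a theta constant. -/
theorem tsum_thetaTerm_mul_thetaConv {ε q : ℂ} (hε : ε ^ 2 = 1) (hq : ‖q‖ < 1) (hq0 : q ≠ 0)
    (m : ℤ) :
    ∑' i, thetaTerm ε (-q) i * thetaConv ε q (m - i) =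
      (∑' s, thetaTerm (-q) (q ^ 2) s) *
          ∑' l, thetaTerm 1 (q ^ 2) l * partThetaInt q (m - 2 * l) +
        ε * ((∑' s, thetaTerm 1 (q ^ 2) s) *
          ∑' l, thetaTerm (-q) (q ^ 2) l * partThetaInt q (m - 2 * l - 1)) := by
  obtain ⟨C, -, hC⟩ := exists_norm_partThetaInt_le hq
  have hs : ∀ δ, Summable fun l => ‖thetaTerm δ (-q) l‖ := fun δ =>
    summable_norm_thetaTerm δ (by rwa [norm_neg])
  have hs2 : ∀ δ, Summable fun l => ‖thetaTerm δ (q ^ 2) l‖ := fun δ =>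
    summable_norm_thetaTerm δ (norm_sq_lt_one hq)
  set F : ℤ × ℤ → ℂ := fun x =>
    thetaTerm ε (-q) x.1 * thetaTerm ε (-q) x.2 * partThetaInt q (m - x.1 - x.2) with hFdef
  have hF : Summable F := by
    refine Summable.of_norm_bounded (((hs ε).mul_norm (hs ε)).mul_right C) fun x => ?_
    rw [norm_mul]
    exact mul_le_mul_of_nonneg_left (hC _) (norm_nonneg _)
  have h1 : ∑' i, thetaTerm ε (-q) i * thetaConv ε q (m - i) = ∑' x, F x := by
    rw [hF.tsum_prod]
    refine tsum_congr fun i => ?_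
    rw [thetaConv, ← tsum_mul_left]
    exact tsum_congr fun j => by rw [hFdef]; ring
  rw [h1, tsum_prod_parity hF,
    ← tsum_prod_mul_shift (a := fun l => partThetaInt q (m - 2 * l)) (hs2 1) (hs2 (-q))
      fun l => hC _,
    ← tsum_prod_mul_shift (a := fun l => partThetaInt q (m - 2 * l - 1)) (hs2 (-q)) (hs2 1)
      fun l => hC _, ← tsum_mul_left]
  congr 1
  · refine tsum_congr fun x => ?_
    rw [hFdef]
    simp only
    rw [thetaTerm_mul_even hε hq0, show m - (x.1 + x.2) - (x.1 - x.2) = m - 2 * x.1 by ring]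
  · refine tsum_congr fun x => ?_
    rw [hFdef]
    simp only
    rw [thetaTerm_mul_odd hε hq0, show m - (x.1 + x.2) - (x.1 + 1 - x.2) = m - 2 * x.1 - 1 by ring]
    ring

/-! ### Hecke-type double sums -/

theorem hasSum_antidiagonal {F : ℕ × ℕ → ℂ} (hF : Summable F) :
    HasSum (fun N => ∑ x ∈ antidiagonal N, F x) (∑' n, ∑' k, F (n, k)) := by
  rw [← hF.tsum_prod]
  have h := (Finset.HasAntidiagonal.sigmaAntidiagonalEquivProd (A := ℕ)).hasSum_iff.2 hF.hasSum
  exact h.sigma fun N => (antidiagonal N).hasSum F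

/-- Expand the partial theta series and collect by N = n + k; then n² + k² + 4nk = N² + 2nk leaves a
finite inner sum. -/
theorem hasSum_partTheta_double {q : ℂ} (hq : ‖q‖ < 1) {s : ℂ} (hs : ‖s‖ ≤ 1) (α β γ : ℕ) :
    HasSum (fun N => q ^ (N ^ 2 + β) * ∑ x ∈ antidiagonal N,
        s ^ x.1 * (-1) ^ x.2 * q ^ (2 * x.1 * x.2 + α * x.1 + (1 + 2 * γ) * x.2))
      (∑' n : ℕ, s ^ n * q ^ (n ^ 2 + α * n + β) * partTheta q (2 * n + γ)) := by
  have hg : Summable fun k : ℕ => ‖q‖ ^ k := summable_geometric_of_lt_one (norm_nonneg _) hq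
  set F : ℕ × ℕ → ℂ := fun x => s ^ x.1 * q ^ (x.1 ^ 2 + α * x.1 + β) *
    ((-1) ^ x.2 * q ^ (x.2 * (x.2 + 1) + 2 * x.2 * (2 * x.1 + γ))) with hFdef
  have hF : Summable F := by
    refine Summable.of_norm_bounded (hg.mul_of_nonneg hg (fun _ => by positivity)
      fun _ => by positivity) fun x => ?_
    rw [norm_mul, norm_mul, norm_pow, norm_pow q]
    refine mul_le_mul ?_ (norm_partTheta_term_le hq _ _) (norm_nonneg _) (by positivity)
    refine (mul_le_of_le_one_left (by positivity) (pow_le_one₀ (norm_nonneg _) hs)).trans ?_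
    exact pow_le_pow_of_le_one (norm_nonneg _) hq.le
      ((Nat.le_self_pow two_ne_zero x.1).trans (by omega))
  have h := hasSum_antidiagonal hF
  have e : ∑' n, ∑' k, F (n, k) =
      ∑' n : ℕ, s ^ n * q ^ (n ^ 2 + α * n + β) * partTheta q (2 * n + γ) :=
    tsum_congr fun n => by rw [partTheta, ← tsum_mul_left]
  rw [← e]
  convert h using 2 with N
  rw [Finset.mul_sum]
  refine Finset.sum_congr rfl fun x hx => ?_
  rw [hFdef, ← mem_antidiagonal.1 hx]
  ring

/-- The polynomials `∑_{n+k=N} (-1)^k q^(nk)`. -/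
noncomputable def altProdSum (q : ℂ) (N : ℕ) : ℂ :=
  ∑ x ∈ antidiagonal N, (-1) ^ x.2 * q ^ (x.1 * x.2)

/-- Peel off both ends of the antidiagonal and use (n+1)(k+1) = nk + N + 1. -/
theorem altProdSum_add_two (q : ℂ) (N : ℕ) :
    altProdSum q (N + 2) = 1 + (-1) ^ N - q ^ (N + 1) * altProdSum q N := by
  rw [altProdSum, Finset.Nat.sum_antidiagonal_succ, Finset.Nat.sum_antidiagonal_succ', altProdSum,
    Finset.mul_sum, sub_eq_add_neg, ← Finset.sum_neg_distrib, ← add_assoc]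
  congr 1
  · simp [pow_add]
    ring
  · refine Finset.sum_congr rfl fun x hx => ?_
    rw [← mem_antidiagonal.1 hx]
    ring

theorem altProdSum_two_mul (q : ℂ) (n : ℕ) : altProdSum q (2 * n) = sqSum q n := by
  induction n with
  | zero => simp [altProdSum, sqSum]
  | succ n ih =>
    rw [Nat.mul_succ, altProdSum_add_two, ih, sqSum, pow_mul (-1 : ℂ)]
    norm_num

theorem altProdSum_two_mul_add_one (q : ℂ) (n : ℕ) : altProdSum q (2 * n + 1) = 0 := by
  induction n with
  | zero => simp [altProdSum, Finset.Nat.sum_antidiagonal_succ]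
  | succ n ih =>
    rw [show 2 * (n + 1) + 1 = 2 * n + 1 + 2 by ring, altProdSum_add_two, ih, pow_succ, pow_mul]
    norm_num

theorem sum_antidiagonal_shift_right (q : ℂ) (N : ℕ) :
    ∑ x ∈ antidiagonal N, (-1) ^ x.2 * q ^ (x.1 * x.2 + x.1) = 1 - altProdSum q (N + 1) := by
  rw [altProdSum, Finset.Nat.sum_antidiagonal_succ']
  simp only [mul_zero, pow_zero, mul_one, sub_add_cancel_left, ← Finset.sum_neg_distrib]
  exact Finset.sum_congr rfl fun x _ => by ring

theorem sum_antidiagonal_shift_left (q : ℂ) (N : ℕ) :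
    ∑ x ∈ antidiagonal N, (-1) ^ x.2 * q ^ (x.1 * x.2 + x.2) =
      altProdSum q (N + 1) + (-1) ^ N := by
  rw [altProdSum, Finset.Nat.sum_antidiagonal_succ]
  simp only [zero_mul, pow_zero, mul_one, pow_succ (-1 : ℂ) N]
  rw [mul_neg_one, add_right_comm, neg_add_cancel, zero_add]
  exact Finset.sum_congr rfl fun x _ => by ring

/-- Peeling off the end where the first index is 0 leaves q^(N+1) times the same sum with the
indices exchanged. -/
theorem sum_antidiagonal_eq_triSum (q : ℂ) (N : ℕ) :
    ∑ x ∈ antidiagonal N, q ^ (2 * x.1 * x.2 + x.1) = triSum q N := by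
  induction N with
  | zero => simp [triSum]
  | succ N ih =>
    rw [Finset.Nat.sum_antidiagonal_succ, triSum, ← ih, Finset.mul_sum,
      ← Finset.Nat.sum_antidiagonal_swap]
    congr 1
    · simp
    · refine Finset.sum_congr rfl fun x hx => ?_
      rw [← mem_antidiagonal.1 hx]
      simp only [Prod.fst_swap, Prod.snd_swap]
      ring

theorem sum_antidiagonal_eq_triSum' (q : ℂ) (N : ℕ) :
    ∑ x ∈ antidiagonal N, q ^ (2 * x.1 * x.2 + x.2) = triSum q N := by
  rw [← sum_antidiagonal_eq_triSum, ← Finset.Nat.sum_antidiagonal_swap]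
  refine Finset.sum_congr rfl fun x _ => ?_
  simp only [Prod.fst_swap, Prod.snd_swap]
  ring

theorem tsum_int_eq {f : ℤ → ℂ} (hf : Summable f) :
    ∑' l, f l = ∑' n : ℕ, f n + ∑' n : ℕ, f (-(n + 1)) :=
  tsum_of_nat_of_neg_add_one (hf.comp_injective Nat.cast_injective)
    (hf.comp_injective (i := fun n : ℕ => (-(n + 1) : ℤ)) fun a b h => by simpa using h)

theorem summable_thetaTerm_mul_partThetaInt (δ : ℂ) {q : ℂ} (hq : ‖q‖ < 1) (m : ℤ → ℤ) :
    Summable fun l => thetaTerm δ (q ^ 2) l * partThetaInt q (m l) := by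
  obtain ⟨C, -, hC⟩ := exists_norm_partThetaInt_le hq
  exact (summable_norm_mul_bounded (summable_norm_thetaTerm δ (norm_sq_lt_one hq))
    fun l => hC (m l)).of_norm

theorem thetaTerm_one_sq_natCast (q : ℂ) (n : ℕ) :
    thetaTerm 1 (q ^ 2) n * q ^ (4 * n) = q ^ (n ^ 2 + 3 * n) := by
  have h := two_mul_tri n
  rw [tri_natCast] at h
  rw [thetaTerm, tri_natCast, one_zpow, mul_one, zpow_natCast, ← pow_mul, ← pow_add]
  congr 1
  zify
  linarith

theorem thetaTerm_one_sq_neg_succ (q : ℂ) (n : ℕ) :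
    thetaTerm 1 (q ^ 2) (-(n + 1)) = q ^ (n ^ 2 + 3 * n + 2) := by
  have h : tri (-((n : ℤ) + 1)) = ((n + 2).choose 2 : ℕ) := by
    rw [← tri_natCast, ← tri_one_sub]
    congr 1
    push_cast
    ring
  have h2 := two_mul_tri (n + 2 : ℕ)
  rw [tri_natCast] at h2
  rw [thetaTerm, h, one_zpow, mul_one, zpow_natCast, ← pow_mul]
  congr 1
  zify
  push_cast at h2
  linarith

theorem thetaTerm_neg_sq {q : ℂ} (hq0 : q ≠ 0) (l : ℤ) :
    thetaTerm (-q) (q ^ 2) l = (-q) ^ (l ^ 2) := by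
  rw [thetaTerm, sq_zpow_eq, ← zpow_add₀ (neg_ne_zero.2 hq0), two_mul_tri]
  congr 1
  ring

theorem neg_pow_sq (q : ℂ) (n : ℕ) : (-q) ^ (n ^ 2) = (-1) ^ n * q ^ (n ^ 2) := by
  rw [neg_pow, sq n, pow_mul]
  rcases n.even_or_odd with h | h
  · simp [h.neg_one_pow]
  · simp [h.neg_one_pow]

theorem thetaTerm_neg_sq_natCast {q : ℂ} (hq0 : q ≠ 0) (n : ℕ) :
    thetaTerm (-q) (q ^ 2) n = (-1) ^ n * q ^ (n ^ 2) := by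
  rw [thetaTerm_neg_sq hq0, ← neg_pow_sq]
  norm_cast

theorem thetaTerm_neg_sq_neg_succ {q : ℂ} (hq0 : q ≠ 0) (n : ℕ) :
    thetaTerm (-q) (q ^ 2) (-(n + 1)) = -((-1) ^ n * q ^ (n ^ 2 + 2 * n + 1)) := by
  rw [thetaTerm_neg_sq hq0, neg_sq, ← Nat.cast_succ, ← Nat.cast_pow, zpow_natCast, neg_pow_sq,
    Nat.succ_eq_add_one]
  ring

theorem tsum_nat_eq_even_add_odd {f : ℕ → ℂ} (hf : Summable f) :
    ∑' n, f n = ∑' n, f (2 * n) + ∑' n, f (2 * n + 1) :=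
  (tsum_even_add_odd (hf.comp_injective fun a b h => by simpa using h)
    (hf.comp_injective (i := fun n => 2 * n + 1) fun a b h => by simpa using h)).symm

/-- The Hecke series of ψ(q²): the halves l ≥ 0 and l < 0 agree, and only even N survive. -/
theorem tsum_even_neg_one {q : ℂ} (hq : ‖q‖ < 1) :
    ∑' l, thetaTerm 1 (q ^ 2) l * partThetaInt q (-1 - 2 * l) =
      2 * ∑' n : ℕ, (q ^ 2) ^ (2 * n ^ 2 + 3 * n + 1) * sqSum (q ^ 2) n := by
  have hD := hasSum_partTheta_double hq (s := 1) (by simp) 3 2 1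
  have h1 : ∀ n : ℕ, thetaTerm 1 (q ^ 2) n * partThetaInt q (-1 - 2 * n) =
      1 ^ n * q ^ (n ^ 2 + 3 * n + 2) * partTheta q (2 * n + 1) := by
    intro n
    have := thetaTerm_one_sq_natCast q n
    rw [show (-1 - 2 * (n : ℤ)) = -((2 * n + 1 : ℕ) : ℤ) by push_cast; ring, partThetaInt_neg hq,
      pow_add q (n ^ 2 + 3 * n) 2, ← this]
    ring
  have h2 : ∀ n : ℕ, thetaTerm 1 (q ^ 2) (-(n + 1)) * partThetaInt q (-1 - 2 * (-(n + 1))) =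
      1 ^ n * q ^ (n ^ 2 + 3 * n + 2) * partTheta q (2 * n + 1) := by
    intro n
    rw [show (-1 - 2 * (-((n : ℤ) + 1))) = ((2 * n + 1 : ℕ) : ℤ) by push_cast; ring,
      partThetaInt_natCast, thetaTerm_one_sq_neg_succ, one_pow, one_mul]
  have h3 : ∀ N : ℕ, q ^ (N ^ 2 + 2) * ∑ x ∈ antidiagonal N,
        1 ^ x.1 * (-1) ^ x.2 * q ^ (2 * x.1 * x.2 + 3 * x.1 + (1 + 2 * 1) * x.2) =
      q ^ (N ^ 2 + 3 * N + 2) * altProdSum (q ^ 2) N := by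
    intro N
    rw [altProdSum, Finset.mul_sum, Finset.mul_sum]
    refine Finset.sum_congr rfl fun x hx => ?_
    rw [← mem_antidiagonal.1 hx]
    ring
  rw [tsum_int_eq (summable_thetaTerm_mul_partThetaInt 1 hq _)]
  simp_rw [h1, h2]
  rw [← two_mul, ← hD.tsum_eq]
  have hS := hD.summable
  simp_rw [h3] at hS ⊢
  congr 1
  rw [tsum_nat_eq_even_add_odd hS]
  simp_rw [altProdSum_two_mul_add_one, altProdSum_two_mul, mul_zero, tsum_zero, add_zero]
  exact tsum_congr fun n => by ring

theorem tsum_succ_eq_of_zero {g : ℕ → ℂ} (hg : Summable g) (h0 : g 0 = 0) :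
    ∑' n, g (n + 1) = ∑' n, g n := by
  rw [hg.tsum_eq_zero_add, h0, zero_add]

/-- Grouping N = 2n with N = 2n + 1 gives the Hecke term of φ(q²) up to a telescoping difference. -/
theorem altProdSum_shift_even_add_odd (q : ℂ) (n : ℕ) :
    q ^ ((2 * n) ^ 2 + 2 * n) * (1 - altProdSum (q ^ 2) (2 * n + 1)) +
        q ^ ((2 * n) ^ 2 + 3 * (2 * n) + 2) * (altProdSum (q ^ 2) (2 * n + 1) + (-1) ^ (2 * n)) +
      (q ^ ((2 * n + 1) ^ 2 + (2 * n + 1)) * (1 - altProdSum (q ^ 2) (2 * n + 1 + 1)) +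
        q ^ ((2 * n + 1) ^ 2 + 3 * (2 * n + 1) + 2) *
          (altProdSum (q ^ 2) (2 * n + 1 + 1) + (-1) ^ (2 * n + 1))) =
      ((q ^ 2) ^ (2 * n ^ 2 + n) + (q ^ 2) ^ (2 * n ^ 2 + 5 * n + 2)) * sqSum (q ^ 2) n -
        q ^ (4 * n ^ 2 + 2 * n) * (sqSum (q ^ 2) n - 1) +
        q ^ (4 * (n + 1) ^ 2 + 2 * (n + 1)) * (sqSum (q ^ 2) (n + 1) - 1) := by
  have e2 := altProdSum_two_mul (q ^ 2) (n + 1)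
  rw [show 2 * (n + 1) = 2 * n + 1 + 1 by ring] at e2
  have e3 : (-1 : ℂ) ^ (2 * n) = 1 := by rw [pow_mul]; norm_num
  rw [altProdSum_two_mul_add_one, e2, pow_succ (-1 : ℂ) (2 * n), e3, sqSum]
  ring

theorem tsum_altProdSum_shift {q : ℂ} (hq : ‖q‖ < 1)
    (hS : Summable fun N => q ^ (N ^ 2 + N) * (1 - altProdSum (q ^ 2) (N + 1)) +
      q ^ (N ^ 2 + 3 * N + 2) * (altProdSum (q ^ 2) (N + 1) + (-1) ^ N)) :
    ∑' N, (q ^ (N ^ 2 + N) * (1 - altProdSum (q ^ 2) (N + 1)) +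
      q ^ (N ^ 2 + 3 * N + 2) * (altProdSum (q ^ 2) (N + 1) + (-1) ^ N)) =
      ∑' n : ℕ, ((q ^ 2) ^ (2 * n ^ 2 + n) + (q ^ 2) ^ (2 * n ^ 2 + 5 * n + 2)) *
        sqSum (q ^ 2) n := by
  set f : ℕ → ℂ := fun N => q ^ (N ^ 2 + N) * (1 - altProdSum (q ^ 2) (N + 1)) +
      q ^ (N ^ 2 + 3 * N + 2) * (altProdSum (q ^ 2) (N + 1) + (-1) ^ N) with hfdef
  set h : ℕ → ℂ := fun n => ((q ^ 2) ^ (2 * n ^ 2 + n) + (q ^ 2) ^ (2 * n ^ 2 + 5 * n + 2)) *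
        sqSum (q ^ 2) n with hhdef
  set g : ℕ → ℂ := fun n => q ^ (4 * n ^ 2 + 2 * n) * (sqSum (q ^ 2) n - 1) with hgdef
  have hg : Summable g := by
    refine (summable_norm_pow_mul hq (f := fun n => 4 * n ^ 2 + 2 * n) (fun n => by omega)
      (c := fun n => sqSum (q ^ 2) n - 1) (K := 2 * (1 - ‖q ^ 2‖)⁻¹ + 1) fun n => ?_).of_norm
    refine (norm_sub_le _ _).trans ?_
    rw [norm_one]
    linarith [norm_sqSum_le (norm_sq_lt_one hq) n]
  have hg0 : g 0 = 0 := by simp [hgdef, sqSum]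
  have he : Summable fun n => f (2 * n) := hS.comp_injective fun a b h => by simpa using h
  have ho : Summable fun n => f (2 * n + 1) :=
    hS.comp_injective (i := fun n => 2 * n + 1) fun a b h => by simpa using h
  have e : ∀ n, f (2 * n) + f (2 * n + 1) = h n - g n + g (n + 1) :=
    altProdSum_shift_even_add_odd q
  have hT := he.add ho
  rw [tsum_nat_eq_even_add_odd hS, ← he.tsum_add ho]
  simp_rw [e] at hT ⊢
  have hg1 : Summable fun n => g (n + 1) := (summable_nat_add_iff 1).2 hg
  have hU : Summable fun n => h n - g n := (hT.sub hg1).congr fun n => by ring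
  have hV : Summable h := (hU.add hg).congr fun n => by ring
  rw [hU.tsum_add hg1, hV.tsum_sub hg, tsum_succ_eq_of_zero hg hg0, sub_add_cancel]

/-- The Hecke series of φ(q²). The two halves now differ, and their sum matches only after
telescoping. -/
theorem tsum_even_zero {q : ℂ} (hq : ‖q‖ < 1) :
    ∑' l, thetaTerm 1 (q ^ 2) l * partThetaInt q (0 - 2 * l) =
      ∑' n : ℕ, ((q ^ 2) ^ (2 * n ^ 2 + n) + (q ^ 2) ^ (2 * n ^ 2 + 5 * n + 2)) *
        sqSum (q ^ 2) n := by
  have hD1 := hasSum_partTheta_double hq (s := 1) (by simp) 3 0 0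
  have hD2 := hasSum_partTheta_double hq (s := 1) (by simp) 3 2 2
  have h1 : ∀ n : ℕ, thetaTerm 1 (q ^ 2) n * partThetaInt q (0 - 2 * n) =
      1 ^ n * q ^ (n ^ 2 + 3 * n + 0) * partTheta q (2 * n + 0) := by
    intro n
    have := thetaTerm_one_sq_natCast q n
    rw [show (0 - 2 * (n : ℤ)) = -((2 * n : ℕ) : ℤ) by push_cast; ring, partThetaInt_neg hq,
      add_zero, add_zero, ← this]
    ring
  have h2 : ∀ n : ℕ, thetaTerm 1 (q ^ 2) (-(n + 1)) * partThetaInt q (0 - 2 * (-(n + 1))) =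
      1 ^ n * q ^ (n ^ 2 + 3 * n + 2) * partTheta q (2 * n + 2) := by
    intro n
    rw [show (0 - 2 * (-((n : ℤ) + 1))) = ((2 * n + 2 : ℕ) : ℤ) by push_cast; ring,
      partThetaInt_natCast, thetaTerm_one_sq_neg_succ, one_pow, one_mul]
  have h3 : ∀ N : ℕ, q ^ (N ^ 2 + 0) * ∑ x ∈ antidiagonal N,
        1 ^ x.1 * (-1) ^ x.2 * q ^ (2 * x.1 * x.2 + 3 * x.1 + (1 + 2 * 0) * x.2) =
      q ^ (N ^ 2 + N) * (1 - altProdSum (q ^ 2) (N + 1)) := by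
    intro N
    rw [← sum_antidiagonal_shift_right, Finset.mul_sum, Finset.mul_sum]
    refine Finset.sum_congr rfl fun x hx => ?_
    rw [← mem_antidiagonal.1 hx]
    ring
  have h4 : ∀ N : ℕ, q ^ (N ^ 2 + 2) * ∑ x ∈ antidiagonal N,
        1 ^ x.1 * (-1) ^ x.2 * q ^ (2 * x.1 * x.2 + 3 * x.1 + (1 + 2 * 2) * x.2) =
      q ^ (N ^ 2 + 3 * N + 2) * (altProdSum (q ^ 2) (N + 1) + (-1) ^ N) := by
    intro N
    rw [← sum_antidiagonal_shift_left, Finset.mul_sum, Finset.mul_sum]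
    refine Finset.sum_congr rfl fun x hx => ?_
    rw [← mem_antidiagonal.1 hx]
    ring
  rw [tsum_int_eq (summable_thetaTerm_mul_partThetaInt 1 hq _)]
  simp_rw [h1, h2]
  have hD := hD1.add hD2
  rw [← hD.tsum_eq]
  have hS := hD.summable
  simp_rw [h3, h4] at hS ⊢
  exact tsum_altProdSum_shift hq hS

/-- The Hecke series of ρ, whose summand 2 `triSum` - 1 arises from `triSum` and `triSum` - 1 in the
two halves. -/
theorem tsum_odd_neg_one {q : ℂ} (hq : ‖q‖ < 1) (hq0 : q ≠ 0) :
    ∑' l, thetaTerm (-q) (q ^ 2) l * partThetaInt q (-1 - 2 * l - 1) =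
      -q * ∑' n : ℕ, q ^ (n * (n + 1)) * ((-1) ^ n * (2 * triSum q n - 1)) := by
  have hD1 := hasSum_partTheta_double hq (s := -1) (by simp) 4 4 2
  have hD2 := hasSum_partTheta_double hq (s := -1) (by simp) 2 1 0
  have h1 : ∀ n : ℕ, thetaTerm (-q) (q ^ 2) n * partThetaInt q (-1 - 2 * n - 1) =
      (-1) ^ n * q ^ (n ^ 2 + 4 * n + 4) * partTheta q (2 * n + 2) := by
    intro n
    rw [show (-1 - 2 * (n : ℤ) - 1) = -((2 * n + 2 : ℕ) : ℤ) by push_cast; ring,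
      partThetaInt_neg hq, thetaTerm_neg_sq_natCast hq0]
    ring
  have h2 : ∀ n : ℕ, thetaTerm (-q) (q ^ 2) (-(n + 1)) *
        partThetaInt q (-1 - 2 * (-(n + 1)) - 1) =
      -((-1) ^ n * q ^ (n ^ 2 + 2 * n + 1) * partTheta q (2 * n + 0)) := by
    intro n
    rw [show (-1 - 2 * (-((n : ℤ) + 1)) - 1) = ((2 * n + 0 : ℕ) : ℤ) by push_cast; ring,
      partThetaInt_natCast, thetaTerm_neg_sq_neg_succ hq0]
    ring
  have h3 : ∀ N : ℕ, q ^ (N ^ 2 + 4) * ∑ x ∈ antidiagonal N,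
        (-1) ^ x.1 * (-1) ^ x.2 * q ^ (2 * x.1 * x.2 + 4 * x.1 + (1 + 2 * 2) * x.2) =
      (-1) ^ N * q ^ (N ^ 2 + 4 * N + 4) * triSum q N := by
    intro N
    rw [← sum_antidiagonal_eq_triSum', Finset.mul_sum, Finset.mul_sum]
    refine Finset.sum_congr rfl fun x hx => ?_
    rw [← mem_antidiagonal.1 hx]
    ring
  have h4 : ∀ N : ℕ, q ^ (N ^ 2 + 1) * ∑ x ∈ antidiagonal N,
        (-1) ^ x.1 * (-1) ^ x.2 * q ^ (2 * x.1 * x.2 + 2 * x.1 + (1 + 2 * 0) * x.2) =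
      (-1) ^ N * q ^ (N ^ 2 + N + 1) * triSum q N := by
    intro N
    rw [← sum_antidiagonal_eq_triSum, Finset.mul_sum, Finset.mul_sum]
    refine Finset.sum_congr rfl fun x hx => ?_
    rw [← mem_antidiagonal.1 hx]
    ring
  rw [tsum_int_eq (summable_thetaTerm_mul_partThetaInt (-q) hq _)]
  simp_rw [h1, h2]
  rw [tsum_neg, ← hD1.tsum_eq, ← hD2.tsum_eq]
  have hS2 := hD2.summable
  simp_rw [h3, h4] at hS2 ⊢
  set g : ℕ → ℂ := fun n => (-1) ^ n * q ^ (n ^ 2 + n + 1) * (triSum q n - 1) with hgdef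
  have hg : Summable g := by
    refine ((summable_norm_pow_mul hq (f := fun n => n ^ 2 + n + 1) (fun n => by omega)
      (c := fun n => (-1) ^ n * (triSum q n - 1)) (K := (1 - ‖q‖)⁻¹ + 1) fun n => ?_).of_norm).congr
        fun n => by rw [hgdef]; ring
    rw [norm_mul, norm_neg_one_pow, one_mul]
    refine (norm_sub_le _ _).trans ?_
    rw [norm_one]
    linarith [norm_triSum_le hq n]
  have hg0 : g 0 = 0 := by simp [hgdef, triSum]
  -- The recurrence of `triSum` trades the index n for n + 1; g 0 = 0 then allows summation from 0.
  have e : ∀ n : ℕ, (-1) ^ n * q ^ (n ^ 2 + 4 * n + 4) * triSum q n = - g (n + 1) := by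
    intro n
    simp only [hgdef, triSum]
    ring
  simp_rw [e]
  rw [tsum_neg, tsum_succ_eq_of_zero hg hg0, ← neg_add, ← hg.tsum_add hS2, ← tsum_mul_left,
    ← tsum_neg]
  refine tsum_congr fun n => ?_
  rw [hgdef]
  ring

theorem tsum_odd_zero {q : ℂ} (hq : ‖q‖ < 1) (hq0 : q ≠ 0) :
    ∑' l, thetaTerm (-q) (q ^ 2) l * partThetaInt q (0 - 2 * l - 1) =
      - ∑' n : ℕ, q ^ ((n + 1) ^ 2) * ((-1) ^ n * (1 - q ^ (n + 1)) * triSum q n) := by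
  have hD1 := hasSum_partTheta_double hq (s := -1) (by simp) 4 2 1
  have hD2 := hasSum_partTheta_double hq (s := -1) (by simp) 2 1 1
  have h1 : ∀ n : ℕ, thetaTerm (-q) (q ^ 2) n * partThetaInt q (0 - 2 * n - 1) =
      (-1) ^ n * q ^ (n ^ 2 + 4 * n + 2) * partTheta q (2 * n + 1) := by
    intro n
    rw [show (0 - 2 * (n : ℤ) - 1) = -((2 * n + 1 : ℕ) : ℤ) by push_cast; ring,
      partThetaInt_neg hq, thetaTerm_neg_sq_natCast hq0]
    ring
  have h2 : ∀ n : ℕ, thetaTerm (-q) (q ^ 2) (-(n + 1)) *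
        partThetaInt q (0 - 2 * (-(n + 1)) - 1) =
      -((-1) ^ n * q ^ (n ^ 2 + 2 * n + 1) * partTheta q (2 * n + 1)) := by
    intro n
    rw [show (0 - 2 * (-((n : ℤ) + 1)) - 1) = ((2 * n + 1 : ℕ) : ℤ) by push_cast; ring,
      partThetaInt_natCast, thetaTerm_neg_sq_neg_succ hq0]
    ring
  have h3 : ∀ N : ℕ, q ^ (N ^ 2 + 2) * ∑ x ∈ antidiagonal N,
        (-1) ^ x.1 * (-1) ^ x.2 * q ^ (2 * x.1 * x.2 + 4 * x.1 + (1 + 2 * 1) * x.2) =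
      (-1) ^ N * q ^ (N ^ 2 + 3 * N + 2) * triSum q N := by
    intro N
    rw [← sum_antidiagonal_eq_triSum, Finset.mul_sum, Finset.mul_sum]
    refine Finset.sum_congr rfl fun x hx => ?_
    rw [← mem_antidiagonal.1 hx]
    ring
  have h4 : ∀ N : ℕ, q ^ (N ^ 2 + 1) * ∑ x ∈ antidiagonal N,
        (-1) ^ x.1 * (-1) ^ x.2 * q ^ (2 * x.1 * x.2 + 2 * x.1 + (1 + 2 * 1) * x.2) =
      (-1) ^ N * q ^ (N ^ 2 + 2 * N + 1) * triSum q N := by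
    intro N
    rw [← sum_antidiagonal_eq_triSum', Finset.mul_sum, Finset.mul_sum]
    refine Finset.sum_congr rfl fun x hx => ?_
    rw [← mem_antidiagonal.1 hx]
    ring
  rw [tsum_int_eq (summable_thetaTerm_mul_partThetaInt (-q) hq _)]
  simp_rw [h1, h2]
  have hS1 := hD1.summable
  have hS2 := hD2.summable
  rw [tsum_neg, ← hD1.tsum_eq, ← hD2.tsum_eq]
  simp_rw [h3, h4] at hS1 hS2 ⊢
  rw [← sub_eq_add_neg, ← hS1.tsum_sub hS2, ← tsum_neg]
  exact tsum_congr fun n => by ring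

/-! ### The convolution side for trivial signs: λ(-q) and μ(-q). -/

theorem summable_thetaTerm_mul_thetaConv (ε : ℂ) {q : ℂ} (hq : ‖q‖ < 1) (m : ℤ) :
    Summable fun i => thetaTerm ε (-q) i * thetaConv ε q (m - i) := by
  obtain ⟨C, hC⟩ := exists_norm_thetaConv_le ε hq
  exact (summable_norm_mul_bounded (summable_norm_thetaTerm ε (by rwa [norm_neg]))
    fun l => hC (m - l)).of_norm

theorem thetaTerm_one_natCast (q : ℂ) (n : ℕ) : thetaTerm 1 q n = q ^ n.choose 2 := by
  rw [thetaTerm, tri_natCast, one_zpow, mul_one, zpow_natCast]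

theorem thetaTerm_one_one_sub (q : ℂ) (l : ℤ) : thetaTerm 1 q (1 - l) = thetaTerm 1 q l := by
  rw [thetaTerm, thetaTerm, tri_one_sub, one_zpow, one_zpow]

theorem tsum_thetaTerm_one_mul_thetaConv_neg_one {q : ℂ} (hq : ‖q‖ < 1) (hq0 : q ≠ 0) :
    ∑' i, thetaTerm 1 (-q) i * thetaConv 1 q (-1 - i) =
      (∑' l, thetaTerm 1 (-q) l) *
        (-q * ∑' n : ℕ, (-q) ^ ((n + 1).choose 2 + n) * sqSum (-q) n) := by
  rw [tsum_int_eq (summable_thetaTerm_mul_thetaConv 1 hq _)]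
  have h1 : ∀ n : ℕ, thetaTerm 1 (-q) n * thetaConv 1 q (-1 - n) =
      (∑' l, thetaTerm 1 (-q) l) / 2 * -q * ((-q) ^ ((n + 1).choose 2 + n) * sqSum (-q) n) := by
    intro n
    rw [show (-1 - (n : ℤ)) = -(n + 1) by ring, thetaConv_one_neg_succ hq hq0,
      thetaTerm_one_natCast, choose_succ_two]
    ring
  have h2 : ∀ n : ℕ, thetaTerm 1 (-q) (-(n + 1)) * thetaConv 1 q (-1 - (-(n + 1))) =
      (∑' l, thetaTerm 1 (-q) l) / 2 * -q * ((-q) ^ ((n + 1).choose 2 + n) * sqSum (-q) n) := by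
    intro n
    rw [show (-1 - (-((n : ℤ) + 1))) = n by ring, thetaConv_one_natCast hq hq0,
      ← thetaTerm_one_one_sub, show (1 - -((n : ℤ) + 1)) = (n + 1 + 1 : ℕ) by push_cast; ring,
      thetaTerm_one_natCast, choose_succ_two (n + 1)]
    ring
  simp_rw [h1, h2, tsum_mul_left]
  ring

theorem tsum_thetaTerm_one_mul_thetaConv_zero {q : ℂ} (hq : ‖q‖ < 1) (hq0 : q ≠ 0) :
    ∑' i, thetaTerm 1 (-q) i * thetaConv 1 q (0 - i) =
      (∑' l, thetaTerm 1 (-q) l) / 2 * ∑' n : ℕ,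
        ((-q) ^ (n + 1).choose 2 + (-q) ^ ((n + 1).choose 2 + (2 * n + 1))) * sqSum (-q) n := by
  -- Reversing the summation puts the values of the convolution at n ≥ 0 in the nonnegative half.
  have hS := summable_comp_sub_left (summable_thetaTerm_mul_thetaConv 1 hq 0) 0
  rw [← tsum_comp_sub_left _ 0, tsum_int_eq hS]
  have h1 : ∀ n : ℕ, thetaTerm 1 (-q) (0 - n) * thetaConv 1 q (0 - (0 - n)) =
      (∑' l, thetaTerm 1 (-q) l) / 2 * ((-q) ^ (n + 1).choose 2 * sqSum (-q) n) := by
    intro n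
    rw [show (0 - (0 - (n : ℤ))) = n by ring, thetaConv_one_natCast hq hq0,
      ← thetaTerm_one_one_sub, show (1 - (0 - (n : ℤ))) = (n + 1 : ℕ) by push_cast; ring,
      thetaTerm_one_natCast]
    ring
  have h2 : ∀ n : ℕ, thetaTerm 1 (-q) (0 - (-(n + 1))) * thetaConv 1 q (0 - (0 - (-(n + 1)))) =
      (∑' l, thetaTerm 1 (-q) l) / 2 *
        ((-q) ^ ((n + 1).choose 2 + (2 * n + 1)) * sqSum (-q) n) := by
    intro n
    rw [show (0 - (0 - (-((n : ℤ) + 1)))) = -(n + 1) by ring, thetaConv_one_neg_succ hq hq0,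
      show (0 - (-((n : ℤ) + 1))) = (n + 1 : ℕ) by push_cast; ring, thetaTerm_one_natCast]
    ring
  have hb : ∀ f : ℕ → ℕ, (∀ n, n ≤ f n) → Summable fun n : ℕ => (-q) ^ f n * sqSum (-q) n :=
    fun f hf => (summable_norm_pow_mul (by rwa [norm_neg]) hf
      (norm_sqSum_le (q := -q) (by rwa [norm_neg]))).of_norm
  simp_rw [h1, h2, tsum_mul_left, add_mul]
  rw [Summable.tsum_add (hb _ le_choose_succ_two) (hb _ fun n => by omega)]
  ring

/-! ### Product identities -/

theorem qPochInf_eq_mul_sq (a : ℂ) {q : ℂ} (hq : ‖q‖ < 1) :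
    qPochInf a q = qPochInf a (q ^ 2) * qPochInf (a * q) (q ^ 2) := by
  rw [qPochInf_eq_prod a hq (k := 2) (by norm_num), Finset.prod_range_succ, Finset.prod_range_one, pow_zero,
    mul_one, pow_one]

theorem qPochInf_eq_mul_cube (a : ℂ) {q : ℂ} (hq : ‖q‖ < 1) :
    qPochInf a q = qPochInf a (q ^ 3) * qPochInf (a * q) (q ^ 3) * qPochInf (a * q ^ 2) (q ^ 3) := by
  rw [qPochInf_eq_prod a hq (k := 3) (by norm_num), Finset.prod_range_succ, Finset.prod_range_succ,
    Finset.prod_range_one, pow_zero, mul_one, pow_one]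

theorem qPochInf_self {q : ℂ} (hq : ‖q‖ < 1) :
    qPochInf q q = qPochInf q (q ^ 2) * qPochInf (q ^ 2) (q ^ 2) := by
  rw [qPochInf_eq_mul_sq q hq, ← sq]

/-- Euler's identity: partitions into odd parts against partitions into distinct parts. -/
theorem qPochInf_odd_mul_distinct {q : ℂ} (hq : ‖q‖ < 1) :
    qPochInf q (q ^ 2) * qPochInf (-q) q = 1 := by
  have h := qPochInf_mul_neg q hq
  have hq2 := norm_sq_lt_one hq
  apply mul_right_cancel₀ (qPochInf_ne_zero hq2 hq2)
  rw [qPochInf_self hq] at h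
  linear_combination h

theorem tsum_thetaTerm {ε q : ℂ} (hε : ε ≠ 0) (hq : ‖q‖ < 1) (hq0 : q ≠ 0) :
    ∑' l, thetaTerm ε q l = qPochInf (-ε) q * qPochInf (-(q / ε)) q * qPochInf q q := by
  have h := triple_product hq hq0 (neg_ne_zero.2 hε)
  rw [neg_neg, div_neg] at h
  exact h

theorem qPochInf_neg_one {q : ℂ} (hq : ‖q‖ < 1) : qPochInf (-1) q = 2 * qPochInf (-q) q := by
  rw [qPochInf_succ _ hq]
  norm_num

theorem tsum_thetaTerm_one {q : ℂ} (hq : ‖q‖ < 1) (hq0 : q ≠ 0) :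
    ∑' l, thetaTerm 1 q l = 2 * (qPochInf (-q) q ^ 2 * qPochInf q q) := by
  rw [tsum_thetaTerm one_ne_zero hq hq0, div_one, qPochInf_neg_one hq]
  ring

theorem tsum_thetaTerm_self {q : ℂ} (hq : ‖q‖ < 1) (hq0 : q ≠ 0) :
    ∑' l, thetaTerm q q l = 2 * (qPochInf (-q) q ^ 2 * qPochInf q q) := by
  rw [tsum_thetaTerm hq0 hq hq0, div_self hq0, qPochInf_neg_one hq]
  ring

theorem tsum_thetaTerm_sq {ε q : ℂ} (hε : ε ^ 2 = q ^ 2) (hq : ‖q‖ < 1) (hq0 : q ≠ 0) :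
    ∑' l, thetaTerm ε (q ^ 2) l = qPochInf (-ε) (q ^ 2) ^ 2 * qPochInf (q ^ 2) (q ^ 2) := by
  have hε0 : ε ≠ 0 := by rintro rfl; exact hq0 (by simpa using hε.symm)
  rw [tsum_thetaTerm hε0 (norm_sq_lt_one hq) (pow_ne_zero 2 hq0), ← hε, sq ε,
    mul_div_cancel_left₀ _ hε0]
  ring

/-- Split (-p;p)_∞ modulo 3 and apply Euler's identity in base p and in base p³. -/
theorem cubic_product_zero {p : ℂ} (hp : ‖p‖ < 1) :
    qPochInf p (p ^ 2) * (qPochInf (-p) (p ^ 3) * qPochInf (-p ^ 2) (p ^ 3) *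
      qPochInf (p ^ 3) (p ^ 3)) =
      qPochInf (p ^ 3) (p ^ 6) ^ 2 * qPochInf (p ^ 6) (p ^ 6) := by
  have hr : ‖p ^ 3‖ < 1 := norm_pow_succ_lt_one hp 2
  have h1 := qPochInf_odd_mul_distinct hp
  rw [qPochInf_eq_mul_cube (-p) hp, show -p * p = -p ^ 2 by ring,
    show -p * p ^ 2 = -p ^ 3 by ring] at h1
  have h2 := qPochInf_odd_mul_distinct hr
  have h3 := qPochInf_self hr
  rw [show (p ^ 3) ^ 2 = p ^ 6 by ring] at h2 h3
  rw [h3]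
  linear_combination qPochInf (p ^ 3) (p ^ 6) ^ 2 * qPochInf (p ^ 6) (p ^ 6) * h1 -
    qPochInf p (p ^ 2) * qPochInf (-p) (p ^ 3) * qPochInf (-p ^ 2) (p ^ 3) *
      qPochInf (p ^ 3) (p ^ 6) * qPochInf (p ^ 6) (p ^ 6) * h2

theorem cubic_product_neg_one {p : ℂ} (hp : ‖p‖ < 1) :
    qPochInf p (p ^ 2) * (qPochInf (-p ^ 3) (p ^ 3) ^ 2 * qPochInf (p ^ 3) (p ^ 3)) =
      qPochInf p (p ^ 6) * qPochInf (p ^ 5) (p ^ 6) * qPochInf (p ^ 6) (p ^ 6) := by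
  have hr : ‖p ^ 3‖ < 1 := norm_pow_succ_lt_one hp 2
  have h1 := qPochInf_eq_mul_cube p (norm_sq_lt_one hp)
  rw [show p * p ^ 2 = p ^ 3 by ring, show p * (p ^ 2) ^ 2 = p ^ 5 by ring,
    show (p ^ 2) ^ 3 = p ^ 6 by ring] at h1
  have h2 := qPochInf_odd_mul_distinct hr
  have h3 := qPochInf_mul_neg (p ^ 3) hr
  rw [show (p ^ 3) ^ 2 = p ^ 6 by ring] at h2 h3
  rw [h1, ← h3]
  linear_combination qPochInf p (p ^ 6) * qPochInf (p ^ 5) (p ^ 6) * qPochInf (-p ^ 3) (p ^ 3) *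
    qPochInf (p ^ 3) (p ^ 3) * h2

/-! ### The theta quotients -/

theorem thetaConv_neg_one_zero {q : ℂ} (hq : ‖q‖ < 1) (hq0 : q ≠ 0) :
    thetaConv (-1) q 0 = qPochInf (-q) (q ^ 2) * qPochInf (q ^ 2) (q ^ 2) ^ 2 := by
  have hq2 := norm_sq_lt_one hq
  have hq' : ‖-q‖ < 1 := by rwa [norm_neg]
  have h := thetaConv_neg_one_zero_mul hq hq0
  have h1 : ∑' m : ℤ, q ^ (m ^ 2) = ∑' l, thetaTerm q (q ^ 2) l := by
    refine tsum_congr fun m => ?_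
    have := thetaTerm_neg_sq (neg_ne_zero.2 hq0) m
    rw [neg_neg, neg_sq] at this
    exact this.symm
  have h2 := qPochInf_self hq'
  rw [neg_sq] at h2
  rw [h1, tsum_thetaTerm_sq rfl hq hq0, h2] at h
  have hB := qPochInf_ne_zero hq' hq2
  have hD := qPochInf_ne_zero hq2 hq2
  apply mul_right_cancel₀ (mul_ne_zero (pow_ne_zero 2 hB) hD)
  linear_combination h

theorem neg_one_zpow_mul_zpow_sq (q : ℂ) (m : ℤ) : q ^ (m ^ 2) = (-1) ^ m * (-q) ^ (m ^ 2) := by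
  rcases m.even_or_odd with h | h
  · rw [h.neg_one_zpow, (h.pow_of_ne_zero two_ne_zero).neg_zpow, one_mul]
  · rw [h.neg_one_zpow, h.pow.neg_zpow]
    ring

theorem neg_one_zpow_mul_self (m : ℤ) : (-1 : ℂ) ^ m * (-1) ^ m = 1 := by
  rw [← mul_zpow]
  norm_num

/-- The signs cancel, and i(i-1)/2 + i² = 3 i(i-1)/2 + i: a theta series in base (-q)³, the source
of the modulus 6. -/
theorem tsum_thetaTerm_neg_one_mul_thetaConv_zero {q : ℂ} (hq : ‖q‖ < 1) (hq0 : q ≠ 0) :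
    ∑' i, thetaTerm (-1) (-q) i * thetaConv (-1) q (0 - i) =
      thetaConv (-1) q 0 * (qPochInf (- -q) ((-q) ^ 3) * qPochInf (-(-q) ^ 2) ((-q) ^ 3) *
        qPochInf ((-q) ^ 3) ((-q) ^ 3)) := by
  have hp : ‖-q‖ < 1 := by rwa [norm_neg]
  have hp0 : -q ≠ 0 := neg_ne_zero.2 hq0
  have h := tsum_thetaTerm hp0 (norm_pow_succ_lt_one hp 2) (pow_ne_zero 3 hp0)
  rw [show (-q) ^ (2 + 1) / -q = (-q) ^ 2 by field_simp; ring] at h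
  rw [← h, ← tsum_mul_left]
  refine tsum_congr fun i => ?_
  have e1 : ((-q) ^ (2 + 1)) ^ tri i * (-q) ^ i = (-q) ^ tri i * (-q) ^ (i ^ 2) := by
    rw [← zpow_natCast, ← zpow_mul, ← zpow_add₀ hp0, ← zpow_add₀ hp0]
    congr 1
    have := two_mul_tri i
    push_cast
    linarith
  rw [thetaConv_neg_one hq hq0, zero_sub, neg_sq, neg_one_zpow_mul_zpow_sq q, thetaTerm, thetaTerm,
    e1]
  linear_combination (-q) ^ tri i * (-q) ^ (i ^ 2) * thetaConv (-1) q 0 * neg_one_zpow_mul_self i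

theorem tsum_thetaTerm_neg_one_mul_thetaConv_neg_one {q : ℂ} (hq : ‖q‖ < 1) (hq0 : q ≠ 0) :
    ∑' i, thetaTerm (-1) (-q) i * thetaConv (-1) q (-1 - i) =
      thetaConv (-1) q 0 * (q * (2 * (qPochInf (-(-q) ^ 3) ((-q) ^ 3) ^ 2 *
        qPochInf ((-q) ^ 3) ((-q) ^ 3)))) := by
  have hp : ‖-q‖ < 1 := by rwa [norm_neg]
  have hp0 : -q ≠ 0 := neg_ne_zero.2 hq0
  have h := tsum_thetaTerm_self (norm_pow_succ_lt_one hp 2) (pow_ne_zero 3 hp0)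
  rw [← h, ← tsum_mul_left, ← tsum_mul_left]
  refine tsum_congr fun i => ?_
  have e1 : (-q) * (((-q) ^ (2 + 1)) ^ tri i * ((-q) ^ (2 + 1)) ^ i) =
      (-q) ^ tri i * (-q) ^ ((i + 1) ^ 2) := by
    rw [← zpow_natCast, ← zpow_mul, ← zpow_mul, ← zpow_add₀ hp0, ← zpow_add₀ hp0,
      ← zpow_one_add₀ hp0]
    congr 1
    have := two_mul_tri i
    push_cast
    linarith
  have e2 : (-1 : ℂ) ^ i * (-1) ^ (i + 1) = -1 := by
    rw [zpow_add_one₀ (by norm_num)]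
    linear_combination -neg_one_zpow_mul_self i
  rw [thetaConv_neg_one hq hq0, show -1 - i = -(i + 1) by ring, neg_sq,
    neg_one_zpow_mul_zpow_sq q, thetaTerm, thetaTerm]
  linear_combination (-q) ^ tri i * (-q) ^ ((i + 1) ^ 2) * thetaConv (-1) q 0 * e2 +
    thetaConv (-1) q 0 * e1

/-! ### The identities -/

theorem qPochInf_three_mul {q : ℂ} (hq : ‖q‖ < 1) :
    qPochInf q (q ^ 2) * qPochInf (-q) (q ^ 2) * qPochInf (-q ^ 2) (q ^ 2) = 1 := by
  have h := qPochInf_odd_mul_distinct hq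
  rw [qPochInf_eq_mul_sq (-q) hq, show -q * q = -q ^ 2 by ring] at h
  linear_combination h

theorem psi_sq_hecke {q : ℂ} (hq : ‖q‖ < 1) :
    ∑' n : ℕ, (q ^ 2) ^ (2 * n ^ 2 + 3 * n + 1) * sqSum (q ^ 2) n =
      qPochInf (-q ^ 2) (q ^ 2) ^ 2 * qPochInf (q ^ 2) (q ^ 2) * psi (q ^ 2) := by
  have hq2 := norm_sq_lt_one hq
  have h := psi_hecke hq2
  rw [← qPochInf_mul_neg _ hq2, ← qPochInf_mul_neg _ hq2] at h
  linear_combination (- ∑' n : ℕ, (q ^ 2) ^ (2 * n ^ 2 + 3 * n + 1) * sqSum (q ^ 2) n) *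
    qPochInf_three_mul hq - qPochInf (-q ^ 2) (q ^ 2) * h

theorem phi_sq_hecke {q : ℂ} (hq : ‖q‖ < 1) :
    ∑' n : ℕ, ((q ^ 2) ^ (2 * n ^ 2 + n) + (q ^ 2) ^ (2 * n ^ 2 + 5 * n + 2)) * sqSum (q ^ 2) n =
      qPochInf (-q ^ 2) (q ^ 2) ^ 2 * qPochInf (q ^ 2) (q ^ 2) * phi (q ^ 2) := by
  have hq2 := norm_sq_lt_one hq
  have h := phi_hecke hq2
  rw [← qPochInf_mul_neg _ hq2, ← qPochInf_mul_neg _ hq2] at h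
  linear_combination (- ∑' n : ℕ, ((q ^ 2) ^ (2 * n ^ 2 + n) + (q ^ 2) ^ (2 * n ^ 2 + 5 * n + 2)) *
    sqSum (q ^ 2) n) * qPochInf_three_mul hq - qPochInf (-q ^ 2) (q ^ 2) * h

theorem rho_hecke' {q : ℂ} (hq : ‖q‖ < 1) :
    ∑' n : ℕ, q ^ (n * (n + 1)) * ((-1) ^ n * (2 * triSum q n - 1)) =
      qPochInf q (q ^ 2) ^ 2 * qPochInf (q ^ 2) (q ^ 2) * rho q := by
  have h := rho_hecke hq
  rw [qPochInf_self hq] at h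
  linear_combination (- ∑' n : ℕ, q ^ (n * (n + 1)) * ((-1) ^ n * (2 * triSum q n - 1))) *
    qPochInf_odd_mul_distinct hq - qPochInf q (q ^ 2) * h

theorem sigma_hecke' {q : ℂ} (hq : ‖q‖ < 1) :
    ∑' n : ℕ, q ^ ((n + 1) ^ 2) * ((-1) ^ n * (1 - q ^ (n + 1)) * triSum q n) =
      qPochInf q (q ^ 2) ^ 2 * qPochInf (q ^ 2) (q ^ 2) * sigma q := by
  have h := sigma_hecke hq
  rw [qPochInf_self hq] at h
  linear_combination (- ∑' n : ℕ, q ^ ((n + 1) ^ 2) *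
    ((-1) ^ n * (1 - q ^ (n + 1)) * triSum q n)) *
    qPochInf_odd_mul_distinct hq - qPochInf q (q ^ 2) * h

theorem qPochInf_neg_neg {q : ℂ} (hq : ‖q‖ < 1) :
    qPochInf (-q) (-q) = qPochInf (-q) (q ^ 2) * qPochInf (q ^ 2) (q ^ 2) := by
  have h := qPochInf_self (q := -q) (by rwa [norm_neg])
  rwa [neg_sq] at h

theorem qPochInf_self_neg {q : ℂ} (hq : ‖q‖ < 1) :
    qPochInf (- -q) (-q) = qPochInf q (q ^ 2) * qPochInf (-q ^ 2) (q ^ 2) := by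
  rw [neg_neg, qPochInf_eq_mul_sq q (by rwa [norm_neg]), neg_sq, mul_neg, ← sq]

theorem qPochInf_neg_odd_ne_zero {q : ℂ} (hq : ‖q‖ < 1) : qPochInf (-q) (q ^ 2) ≠ 0 :=
  qPochInf_ne_zero (by rwa [norm_neg]) (norm_sq_lt_one hq)

theorem lambda_neg_hecke {q : ℂ} (hq : ‖q‖ < 1) :
    ∑' n : ℕ, (-q) ^ ((n + 1).choose 2 + n) * sqSum (-q) n =
      qPochInf q (q ^ 2) * qPochInf (-q ^ 2) (q ^ 2) * qPochInf (q ^ 2) (q ^ 2) * lambda (-q) := by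
  have h := lambda_hecke (q := -q) (by rwa [norm_neg])
  rw [qPochInf_neg_neg hq, qPochInf_self_neg hq, neg_sq] at h
  apply mul_left_cancel₀ (qPochInf_neg_odd_ne_zero hq)
  rw [← h]
  ring

theorem mu_neg_hecke {q : ℂ} (hq : ‖q‖ < 1) :
    ∑' n : ℕ, ((-q) ^ (n + 1).choose 2 + (-q) ^ ((n + 1).choose 2 + (2 * n + 1))) * sqSum (-q) n =
      2 * (qPochInf q (q ^ 2) * qPochInf (-q ^ 2) (q ^ 2) * qPochInf (q ^ 2) (q ^ 2) *
        mu (-q)) := by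
  have h := (mu_cesaro (q := -q) (by rwa [norm_neg])).2
  rw [qPochInf_neg_neg hq, qPochInf_self_neg hq, neg_sq] at h
  apply mul_left_cancel₀ (qPochInf_neg_odd_ne_zero hq)
  rw [← h]
  ring

theorem tsum_thetaTerm_neg_sq {q : ℂ} (hq : ‖q‖ < 1) (hq0 : q ≠ 0) :
    ∑' l, thetaTerm (-q) (q ^ 2) l = qPochInf q (q ^ 2) ^ 2 * qPochInf (q ^ 2) (q ^ 2) := by
  rw [tsum_thetaTerm_sq (neg_sq q) hq hq0, neg_neg]

theorem tsum_thetaTerm_one_neg {q : ℂ} (hq : ‖q‖ < 1) (hq0 : q ≠ 0) :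
    ∑' l, thetaTerm 1 (-q) l = 2 * (qPochInf q (q ^ 2) ^ 2 * qPochInf (-q ^ 2) (q ^ 2) ^ 2 *
      (qPochInf (-q) (q ^ 2) * qPochInf (q ^ 2) (q ^ 2))) := by
  rw [tsum_thetaTerm_one (by rwa [norm_neg]) (neg_ne_zero.2 hq0), qPochInf_neg_neg hq,
    qPochInf_self_neg hq]
  ring

/-- The convolution identity for ε = 1 at m = -1, with A B C = 1 from Euler's identity removing the
product prefactors. -/
theorem lambda_neg_eq {q : ℂ} (hq : ‖q‖ < 1) (hq0 : q ≠ 0) :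
    q * lambda (-q) = q * rho q - psi (q ^ 2) := by
  have hq2 := norm_sq_lt_one hq
  have h := tsum_thetaTerm_mul_thetaConv (one_pow 2) hq hq0 (-1)
  rw [tsum_thetaTerm_one_mul_thetaConv_neg_one hq hq0, tsum_even_neg_one hq,
    tsum_odd_neg_one hq hq0, psi_sq_hecke hq, rho_hecke' hq, lambda_neg_hecke hq,
    tsum_thetaTerm_neg_sq hq hq0, tsum_thetaTerm_one hq2 (pow_ne_zero 2 hq0),
    tsum_thetaTerm_one_neg hq hq0] at h
  have hA := qPochInf_ne_zero hq hq2
  have hC := qPochInf_ne_zero (by rwa [norm_neg] : ‖-q ^ 2‖ < 1) hq2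
  have hD := qPochInf_ne_zero hq2 hq2
  have hE := qPochInf_three_mul hq
  set A := qPochInf q (q ^ 2)
  set B := qPochInf (-q) (q ^ 2)
  set C := qPochInf (-q ^ 2) (q ^ 2)
  set D := qPochInf (q ^ 2) (q ^ 2)
  apply mul_left_cancel₀ (by simp [hA, hC, hD] : 2 * (A ^ 2 * C ^ 2 * D ^ 2) ≠ 0)
  linear_combination -h - 2 * q * A ^ 2 * C ^ 2 * D ^ 2 * lambda (-q) * hE

theorem mu_neg_eq {q : ℂ} (hq : ‖q‖ < 1) (hq0 : q ≠ 0) :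
    2 * mu (-q) = phi (q ^ 2) - 2 * sigma q := by
  have hq2 := norm_sq_lt_one hq
  have h := tsum_thetaTerm_mul_thetaConv (one_pow 2) hq hq0 0
  rw [tsum_thetaTerm_one_mul_thetaConv_zero hq hq0, tsum_even_zero hq,
    tsum_odd_zero hq hq0, phi_sq_hecke hq, sigma_hecke' hq, mu_neg_hecke hq,
    tsum_thetaTerm_neg_sq hq hq0, tsum_thetaTerm_one hq2 (pow_ne_zero 2 hq0),
    tsum_thetaTerm_one_neg hq hq0] at h
  have hA := qPochInf_ne_zero hq hq2
  have hC := qPochInf_ne_zero (by rwa [norm_neg] : ‖-q ^ 2‖ < 1) hq2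
  have hD := qPochInf_ne_zero hq2 hq2
  have hE := qPochInf_three_mul hq
  set A := qPochInf q (q ^ 2)
  set B := qPochInf (-q) (q ^ 2)
  set C := qPochInf (-q ^ 2) (q ^ 2)
  set D := qPochInf (q ^ 2) (q ^ 2)
  apply mul_left_cancel₀ (by simp [hA, hC, hD] : A ^ 2 * C ^ 2 * D ^ 2 ≠ 0)
  linear_combination h - 2 * A ^ 2 * C ^ 2 * D ^ 2 * mu (-q) * hE

theorem psi_add_rho {q : ℂ} (hq : ‖q‖ < 1) (hq0 : q ≠ 0) :
    psi (q ^ 2) + q * rho q = q * (qPochInf (-q) (q ^ 2) ^ 2 *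
      qPochInf₃ (-q) (-q ^ 5) (q ^ 6) (q ^ 6)) := by
  have hq2 := norm_sq_lt_one hq
  have h := tsum_thetaTerm_mul_thetaConv (ε := -1) (by norm_num) hq hq0 (-1)
  have hX := cubic_product_neg_one (p := -q) (by rwa [norm_neg])
  rw [tsum_thetaTerm_neg_one_mul_thetaConv_neg_one hq hq0, thetaConv_neg_one_zero hq hq0,
    tsum_even_neg_one hq, tsum_odd_neg_one hq hq0, psi_sq_hecke hq, rho_hecke' hq,
    tsum_thetaTerm_neg_sq hq hq0, tsum_thetaTerm_one hq2 (pow_ne_zero 2 hq0)] at h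
  rw [neg_sq, show (-q) ^ 5 = -q ^ 5 by ring, show (-q) ^ 6 = q ^ 6 by ring] at hX
  have hD := qPochInf_ne_zero hq2 hq2
  have hE := qPochInf_three_mul hq
  rw [qPochInf₃, ← hX]
  set A := qPochInf q (q ^ 2)
  set B := qPochInf (-q) (q ^ 2)
  set C := qPochInf (-q ^ 2) (q ^ 2)
  set D := qPochInf (q ^ 2) (q ^ 2)
  apply mul_left_cancel₀ (by simp [hD] : 2 * D ^ 2 ≠ 0)
  -- The factor B² completes A² C² to (A B C)² = 1, and (A B C)² - 1 factors as (A B C + 1)(A B C -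
  -- 1).
  linear_combination -B ^ 2 * h - 2 * D ^ 2 * (psi (q ^ 2) + q * rho q) * (A * B * C + 1) * hE

theorem phi_add_sigma {q : ℂ} (hq : ‖q‖ < 1) (hq0 : q ≠ 0) :
    phi (q ^ 2) + 2 * sigma q = qPochInf (-q) (q ^ 2) ^ 2 *
      qPochInf₃ (-q ^ 3) (-q ^ 3) (q ^ 6) (q ^ 6) := by
  have hq2 := norm_sq_lt_one hq
  have h := tsum_thetaTerm_mul_thetaConv (ε := -1) (by norm_num) hq hq0 0
  have hX := cubic_product_zero (p := -q) (by rwa [norm_neg])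
  rw [tsum_thetaTerm_neg_one_mul_thetaConv_zero hq hq0, thetaConv_neg_one_zero hq hq0,
    tsum_even_zero hq, tsum_odd_zero hq hq0, phi_sq_hecke hq, sigma_hecke' hq,
    tsum_thetaTerm_neg_sq hq hq0, tsum_thetaTerm_one hq2 (pow_ne_zero 2 hq0)] at h
  rw [show (-q) ^ 6 = q ^ 6 by ring] at hX
  have hD := qPochInf_ne_zero hq2 hq2
  have hE := qPochInf_three_mul hq
  have hY : qPochInf₃ (-q ^ 3) (-q ^ 3) (q ^ 6) (q ^ 6) =
      qPochInf ((-q) ^ 3) (q ^ 6) ^ 2 * qPochInf (q ^ 6) (q ^ 6) := by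
    rw [qPochInf₃, show (-q) ^ 3 = -q ^ 3 by ring]
    ring
  rw [hY, ← hX]
  simp only [neg_sq] at h ⊢
  set A := qPochInf q (q ^ 2)
  set B := qPochInf (-q) (q ^ 2)
  set C := qPochInf (-q ^ 2) (q ^ 2)
  set D := qPochInf (q ^ 2) (q ^ 2)
  apply mul_left_cancel₀ (pow_ne_zero 2 hD)
  linear_combination -B ^ 2 * h - D ^ 2 * (phi (q ^ 2) + 2 * sigma q) * (A * B * C + 1) * hE

/-! ### The value at the origin -/

theorem phi_zero : phi 0 = 1 := by
  rw [phi, tsum_eq_single 0]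
  · simp [phiTerm]
  · intro n hn
    simp [phiTerm, hn]

theorem sigma_zero : sigma 0 = 0 := by
  rw [sigma]
  convert tsum_zero with n
  have : (n + 1) * (n + 2) / 2 ≠ 0 := by
    have : 2 ≤ (n + 1) * (n + 2) := by nlinarith
    omega
  simp [sigmaTerm, this]

theorem two_mul_mu_zero : 2 * mu 0 = 1 := by
  have h := (mu_cesaro (q := 0) (by simp)).2
  rw [tsum_eq_single 0] at h
  · simp [sqSum, qPochInf_zero] at h
    linear_combination h
  · intro n hn
    have : (n + 1).choose 2 ≠ 0 := by
      have := le_choose_succ_two n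
      omega
    simp [this]

end SixthOrder

theorem mainTheorem1 (q : ℂ) (hq : ‖q‖ < 1) :
    -- the defining series converge throughout the unit disc, that of `μ` in the Cesàro sense
    (Summable (SixthOrder.phiTerm q) ∧ Summable (SixthOrder.psiTerm q) ∧
      Summable (SixthOrder.rhoTerm q) ∧ Summable (SixthOrder.sigmaTerm q) ∧
      Summable (SixthOrder.lambdaTerm q) ∧
      SixthOrder.HasCesaroSum (SixthOrder.muTerm q) (SixthOrder.mu q)) ∧
    -- the four identities
    (q ≠ 0 →
      q⁻¹ * SixthOrder.psi (q ^ 2) + SixthOrder.rho q =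
        SixthOrder.qPochInf (-q) (q ^ 2) ^ 2 *
          SixthOrder.qPochInf₃ (-q) (-q ^ 5) (q ^ 6) (q ^ 6)) ∧
    (SixthOrder.phi (q ^ 2) + 2 * SixthOrder.sigma q =
        SixthOrder.qPochInf (-q) (q ^ 2) ^ 2 *
          SixthOrder.qPochInf₃ (-q ^ 3) (-q ^ 3) (q ^ 6) (q ^ 6)) ∧
    (2 * SixthOrder.phi (q ^ 2) - 2 * SixthOrder.mu (-q) =
        SixthOrder.qPochInf (-q) (q ^ 2) ^ 2 *
          SixthOrder.qPochInf₃ (-q ^ 3) (-q ^ 3) (q ^ 6) (q ^ 6)) ∧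
    (q ≠ 0 →
      2 * q⁻¹ * SixthOrder.psi (q ^ 2) + SixthOrder.lambda (-q) =
        SixthOrder.qPochInf (-q) (q ^ 2) ^ 2 *
          SixthOrder.qPochInf₃ (-q) (-q ^ 5) (q ^ 6) (q ^ 6)) := by
  refine ⟨⟨SixthOrder.summable_phiTerm hq, SixthOrder.summable_psiTerm hq,
    SixthOrder.summable_rhoTerm hq, SixthOrder.summable_sigmaTerm hq,
    SixthOrder.summable_lambdaTerm hq, (SixthOrder.mu_cesaro hq).1⟩, fun hq0 => ?_, ?_, ?_,
    fun hq0 => ?_⟩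
  · apply mul_left_cancel₀ hq0
    rw [← SixthOrder.psi_add_rho hq hq0, mul_add, mul_inv_cancel_left₀ hq0]
  -- The triple product requires q ≠ 0; at the origin both sides equal 1.
  · by_cases hq0 : q = 0
    · subst hq0
      simp [SixthOrder.phi_zero, SixthOrder.sigma_zero, SixthOrder.qPochInf₃, SixthOrder.qPochInf_zero]
    · exact SixthOrder.phi_add_sigma hq hq0
  · by_cases hq0 : q = 0
    · subst hq0
      have h := SixthOrder.two_mul_mu_zero
      simp [SixthOrder.phi_zero, SixthOrder.qPochInf₃, SixthOrder.qPochInf_zero, h]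
      norm_num
    · rw [← SixthOrder.phi_add_sigma hq hq0, SixthOrder.mu_neg_eq hq hq0]
      ring
  · apply mul_left_cancel₀ hq0
    rw [← SixthOrder.psi_add_rho hq hq0, mul_add, SixthOrder.lambda_neg_eq hq hq0]
    field_simp
    ring
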